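/- Let $\mathfrak g$ be a $7$-dimensional real Lie algebra that is $2$-step nilpotent, i.e. $0\neq[\mathfrak g,\mathfrak g]$ is contained in the centre of $\mathfrak g$. Write $e^{i_1\dots i_k}=e^{i_1}\wedge\dots\wedge e^{i_k}$, and let $d$ be the Chevalley--Eilenberg differential on $\Lambda^\bullet\mathfrak g^*$, so that $d\xi(x,y)=-\xi([x,y])$ for $\xi\in\mathfrak g^*$. A $\mathrm G_2$-structure on $\mathfrak g$ is a $3$-form $\varphi\in\Lambda^3\mathfrak g^*$ which in some basis $\{e^1,\dots,e^7\}$ of $\mathfrak g^*$ has the form $$\varphi=e^{127}+e^{347}+e^{567}+e^{135}-e^{146}-e^{236}-e^{245}.\qquad(\ast)$$ It determines an inner product $g$ and a $g$-volume form $\mathrm{vol}$ by $(x\lrcorner\varphi)\wedge(y\lrcorner\varphi)\wedge\varphi=6\,g(x,y)\,\mathrm{vol}$, hence a Hodge star $\star$; put $\psi=\star\varphi$. The structure $\varphi$ is coclosed if $d\psi=0$. Set $T=\frac16\star(d\varphi\wedge\varphi)\,\varphi-\star d\varphi$, and let $\nabla^1$ be the left-invariant connection $$g(\nabla^1_xy,z)=\tfrac12\big(g([x,y],z)+g([z,x],y)+g([z,y],x)\big)+\tfrac12T(x,y,z),\qquad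 x,y,z\in\mathfrak g,$$ that is, the Levi-Civita connection of $g$ plus $\frac12T$; for coclosed $\varphi$ it is the characteristic connection of $\varphi$. Its curvature is $R(x,y)=\nabla^1_x\nabla^1_y-\nabla^1_y\nabla^1_x-\nabla^1_{[x,y]}$, and $\nabla^1$ is a $\mathrm G_2$-instanton if $R\wedge\psi=0$. For every $\mathrm G_2$-structure $\varphi$ on $\mathfrak g$, the following are equivalent: (A) $\varphi$ is coclosed and $\nabla^1$ is a $\mathrm G_2$-instanton; (B) there is a basis $\{e^1,\dots,e^7\}$ of $\mathfrak g^*$ in which $\varphi$ is given by $(\ast)$ and one of the following holds: 1. $de^i=0$ for $i=1,\dots,6$ and $de^7=a(e^{12}-e^{56})+b(e^{34}-e^{56})$ for some $a,b\in\mathbb R$ not both zero; 2. $de^i=0$ for $i=1,\dots,4$, $de^5=\nu(e^{13}-e^{24})$, $de^6=\nu(-e^{14}-e^{23})$ and $de^7=\nu(e^{12}+e^{34})$ for some $\nu\neq0$; 3. $de^i=0$ for $i=1,\dots,4$, $de^5=-2\nu e^{24}$, $de^6=-2\nu e^{23}$ and $de^7=2\nu e^{34}$ for some $\nu\neq0$.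 In particular, there exists a coclosed $\mathrm G_2$-structure on $\mathfrak g$ whose connection $\nabla^1$ is a $\mathrm G_2$-instanton if and only if $\mathfrak g^*$ has a basis satisfying one of the structure equations 1, 2, 3. -/

import Mathlib

open Module

noncomputable section

/-- Alternating `k`-forms on a real vector space (left-invariant `k`-forms when `V` is the Lie
algebra of a Lie group). -/
abbrev AltForm (V : Type*) [AddCommGroup V] [Module ℝ V] (k : ℕ) : Type _ :=
  V [⋀^Fin k]→ₗ[ℝ] ℝ

section Exterior

variable {V : Type*} [AddCommGroup V] [Module ℝ V]

/-- The wedge product of a `k`-form with values in `N` and a real-valued `l`-form, i.e. the sum over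
`(k, l)`-shuffles `σ` of `sign σ • β (v ∘ σ ∘ last) • α (v ∘ σ ∘ first)`. For `N = ℝ` this is the
usual wedge product of forms. -/
def wedge {N : Type*} [AddCommGroup N] [Module ℝ N] {k l : ℕ}
    (α : V [⋀^Fin k]→ₗ[ℝ] N) (β : AltForm V l) : V [⋀^Fin (k + l)]→ₗ[ℝ] N :=
  ((TensorProduct.rid ℝ N).toLinearMap.compAlternatingMap (α.domCoprod β)).domDomCongr
    finSumFinEquiv

theorem wedge_add {N : Type*} [AddCommGroup N] [Module ℝ N] {k l : ℕ}
    (α : V [⋀^Fin k]→ₗ[ℝ] N) (β γ : AltForm V l) : wedge α (β + γ) = wedge α β + wedge α γ := by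
  simp only [wedge, ← AlternatingMap.domCoprod'_apply, TensorProduct.tmul_add, map_add]
  ext v
  simp

theorem wedge_smul {N : Type*} [AddCommGroup N] [Module ℝ N] {k l : ℕ}
    (α : V [⋀^Fin k]→ₗ[ℝ] N) (c : ℝ) (β : AltForm V l) : wedge α (c • β) = c • wedge α β := by
  simp only [wedge, ← AlternatingMap.domCoprod'_apply, TensorProduct.tmul_smul, map_smul]
  ext v
  simp

theorem wedge_zero {N : Type*} [AddCommGroup N] [Module ℝ N] {k l : ℕ}
    (α : V [⋀^Fin k]→ₗ[ℝ] N) : wedge α (0 : AltForm V l) = 0 := by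
  simpa using wedge_smul α 0 (0 : AltForm V l)

/-- The decomposable form `ξ₀ ∧ ⋯ ∧ ξₖ₋₁`, namely `v ↦ det (ξ_r (v_s))`. -/
def covectorWedge {k : ℕ} (ξ : Fin k → Dual ℝ V) : AltForm V k :=
  Matrix.detRowAlternating.compLinearMap (LinearMap.pi ξ)

theorem covectorWedge_apply {k : ℕ} (ξ : Fin k → Dual ℝ V) (v : Fin k → V) :
    covectorWedge ξ v = (Matrix.of fun s r => ξ r (v s)).det := rfl

theorem covectorWedge_update_add {k : ℕ} [DecidableEq (Fin k)] (ξ : Fin k → Dual ℝ V) (i : Fin k)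
    (a b : Dual ℝ V) : covectorWedge (Function.update ξ i (a + b)) =
      covectorWedge (Function.update ξ i a) + covectorWedge (Function.update ξ i b) := by
  ext v
  have h : ∀ c, covectorWedge (Function.update ξ i c) v =
      ((Matrix.of fun s r => ξ r (v s)).updateCol i fun s => c (v s)).det := fun c => by
    rw [covectorWedge_apply]
    congr 1
    ext s r
    by_cases hr : r = i
    · subst hr
      simp
    · simp [hr]
  rw [AlternatingMap.add_apply, h, h, h, ← Matrix.det_updateCol_add]
  rfl

theorem covectorWedge_update_smul {k : ℕ} [DecidableEq (Fin k)] (ξ : Fin k → Dual ℝ V) (i : Fin k)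
    (t : ℝ) (a : Dual ℝ V) : covectorWedge (Function.update ξ i (t • a)) =
      t • covectorWedge (Function.update ξ i a) := by
  ext v
  have h : ∀ c, covectorWedge (Function.update ξ i c) v =
      ((Matrix.of fun s r => ξ r (v s)).updateCol i fun s => c (v s)).det := fun c => by
    rw [covectorWedge_apply]
    congr 1
    ext s r
    by_cases hr : r = i
    · subst hr
      simp
    · simp [hr]
  rw [AlternatingMap.smul_apply, h, h, smul_eq_mul, ← Matrix.det_updateCol_smul]
  rfl

theorem covectorWedge_eq_zero {k : ℕ} {i j : Fin k} (ξ : Fin k → Dual ℝ V) (h : ξ i = ξ j)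
    (hij : i ≠ j) : covectorWedge ξ = 0 := by
  ext v
  rw [covectorWedge_apply]
  exact Matrix.det_zero_of_column_eq hij fun s => by simp [h]

/-- The model `3`-form
`e¹²⁷ + e³⁴⁷ + e⁵⁶⁷ + e¹³⁵ - e¹⁴⁶ - e²³⁶ - e²⁴⁵`; the covectors `e¹, …, e⁷` are
`e 0, …, e 6`. -/
def stdForm (e : Fin 7 → Dual ℝ V) : AltForm V 3 :=
  covectorWedge ![e 0, e 1, e 6] + covectorWedge ![e 2, e 3, e 6] + covectorWedge ![e 4, e 5, e 6]
    + covectorWedge ![e 0, e 2, e 4] - covectorWedge ![e 0, e 3, e 5]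
    - covectorWedge ![e 1, e 2, e 5] - covectorWedge ![e 1, e 3, e 4]

end Exterior

section ChevalleyEilenberg

variable {𝔤 : Type*} [LieRing 𝔤] [LieAlgebra ℝ 𝔤]

/-- The Chevalley–Eilenberg differential (trivial coefficients)
`dω(x₀,…,xₙ₊₁) = ∑_{i<j} (-1)^(i+j) ω([xᵢ,xⱼ], x₀,…,x̂ᵢ,…,x̂ⱼ,…,xₙ₊₁)`. It is written as a sum over
all ordered pairs `(i, j)` with `i ≠ j`, in which every term above occurs twice. -/
def ceDiff {n : ℕ} (ω : AltForm 𝔤 (n + 1)) : AltForm 𝔤 (n + 2) :=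
  (-(1 / 2) : ℝ) • AlternatingMap.alternatizeUncurryFin
    (AlternatingMap.alternatizeUncurryFinLM ∘ₗ
      (LieModule.toEnd ℝ 𝔤 𝔤 : 𝔤 →ₗ[ℝ] 𝔤 →ₗ[ℝ] 𝔤).compr₂ ω.curryLeft)

theorem ceDiff_apply {n : ℕ} (ω : AltForm 𝔤 (n + 1)) (x : Fin (n + 2) → 𝔤) :
    ceDiff ω x = -(1 / 2) * ∑ i : Fin (n + 2), ∑ j : Fin (n + 1), (-1) ^ (i + j : ℕ) *
      ω (Matrix.vecCons ⁅x i, i.removeNth x j⁆ (j.removeNth (i.removeNth x))) := by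
  simp [ceDiff, AlternatingMap.alternatizeUncurryFin_apply, Finset.mul_sum, pow_add, mul_assoc]

theorem ceDiff_one_apply (ω : AltForm 𝔤 1) (x y : 𝔤) : ceDiff ω ![x, y] = -ω ![⁅x, y⁆] := by
  have h : ∀ v : Fin 0 → 𝔤, v = ![] := fun v => Subsingleton.elim _ _
  have h1 : ω ![⁅y, x⁆] = -ω ![⁅x, y⁆] := by
    have hu : ∀ w, Function.update ![⁅x, y⁆] 0 w = ![w] := fun w => by
      funext j
      fin_cases j
      rfl
    have h2 := ω.map_update_smul ![⁅x, y⁆] 0 (-1) ⁅y, x⁆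
    rw [hu, hu] at h2
    rw [neg_one_smul, neg_one_smul, lie_skew] at h2
    rw [h2, neg_neg]
  simp [ceDiff_apply, Fin.sum_univ_succ, Fin.removeNth, h, h1]
  ring

/-- The curvature `R(x, y) = ∇ₓ∇_y - ∇_y∇ₓ - ∇_[x,y]` of a left-invariant connection, as an
endomorphism-valued `2`-form. -/
def curvature (D : 𝔤 →ₗ[ℝ] End ℝ 𝔤) : 𝔤 [⋀^Fin 2]→ₗ[ℝ] End ℝ 𝔤 where
  toFun v := D (v 0) * D (v 1) - D (v 1) * D (v 0) - D ⁅v 0, v 1⁆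
  map_update_add' := by
    intro _ m i x y
    fin_cases i <;> simp [add_mul, mul_add] <;> abel
  map_update_smul' := by
    intro _ m i c x
    fin_cases i <;> simp [smul_sub]
  map_eq_zero_of_eq' := by
    intro v i j hv hij
    fin_cases i <;> fin_cases j <;> simp_all

end ChevalleyEilenberg

/-- A `G₂`-structure on a real vector space: a `3`-form isomorphic to the model form, together with
the metric and the volume form that it induces through
`(X ⌟ φ) ∧ (Y ⌟ φ) ∧ φ = 6 g(X, Y) vol`. Both are determined by `φ`. -/
structure G2Structure (V : Type*) [AddCommGroup V] [Module ℝ V] where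
  φ : AltForm V 3
  positive : ∃ e : Basis (Fin 7) ℝ (Dual ℝ V), φ = stdForm e
  metric : LinearMap.BilinForm ℝ V
  metric_symm : ∀ x y, metric x y = metric y x
  metric_pos : ∀ x, x ≠ 0 → 0 < metric x x
  vol : AltForm V 7
  /-- `vol` is a Riemannian volume form of the metric. -/
  vol_sq : ∀ v : Fin 7 → V, vol v ^ 2 = (Matrix.of fun i j => metric (v i) (v j)).det
  induced : ∀ X Y, wedge (wedge (φ.curryLeft X) (φ.curryLeft Y)) φ = (6 * metric X Y) • vol

namespace G2Structure

section Linear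

variable {V : Type*} [AddCommGroup V] [Module ℝ V]

theorem finiteDimensional (S : G2Structure V) : FiniteDimensional ℝ V := by
  obtain ⟨e, -⟩ := S.positive
  exact (Module.finite_dual_iff ℝ).mp (Module.Finite.of_basis e)

theorem finrank_eq (S : G2Structure V) : finrank ℝ V = 7 := by
  obtain ⟨e, -⟩ := S.positive
  rw [← Subspace.dual_finrank_eq, finrank_eq_card_basis e, Fintype.card_fin]

theorem nondegenerate (S : G2Structure V) : S.metric.Nondegenerate := by
  refine ⟨fun x hx => ?_, fun x hx => ?_⟩ <;> by_contra h <;>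
    exact (S.metric_pos x h).ne' (hx x)

/-- Some basis of `V`, used only to evaluate top-degree forms. -/
def auxBasis (S : G2Structure V) : Basis (Fin 7) ℝ V :=
  haveI := S.finiteDimensional
  finBasisOfFinrankEq ℝ V S.finrank_eq

theorem vol_auxBasis_ne_zero (S : G2Structure V) : S.vol S.auxBasis ≠ 0 := by
  have h := S.vol_sq S.auxBasis
  have h2 := (LinearMap.BilinForm.nondegenerate_iff_det_ne_zero S.auxBasis).mp S.nondegenerate
  intro h0
  apply h2
  rw [h0] at h
  rw [show LinearMap.BilinForm.toMatrix S.auxBasis S.metric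
    = Matrix.of fun i j => S.metric (S.auxBasis i) (S.auxBasis j) from ?_, ← h]
  · norm_num
  · ext i j
    simp [LinearMap.BilinForm.toMatrix_apply]

/-- The number `c` with `ω = c • vol`, for a top-degree form `ω`. -/
def topCoeff (S : G2Structure V) {n : ℕ} (h : n = 7) (ω : AltForm V n) : ℝ :=
  ω (S.auxBasis ∘ Fin.cast h) / S.vol S.auxBasis

theorem topCoeff_add (S : G2Structure V) {n : ℕ} (h : n = 7) (ω η : AltForm V n) :
    S.topCoeff h (ω + η) = S.topCoeff h ω + S.topCoeff h η := by
  simp [topCoeff, add_div]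

theorem topCoeff_smul (S : G2Structure V) {n : ℕ} (h : n = 7) (c : ℝ) (ω : AltForm V n) :
    S.topCoeff h (c • ω) = c * S.topCoeff h ω := by
  simp [topCoeff, mul_div_assoc]

theorem topCoeff_zero (S : G2Structure V) {n : ℕ} (h : n = 7) :
    S.topCoeff h (0 : AltForm V n) = 0 := by
  simp [topCoeff]

theorem topCoeff_smul_vol (S : G2Structure V) (ω : AltForm V 7) :
    S.topCoeff rfl ω • S.vol = ω := by
  have h1 := S.vol.eq_smul_basis_det S.auxBasis
  have h2 := ω.eq_smul_basis_det S.auxBasis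
  have h0 := S.vol_auxBasis_ne_zero
  have h3 : S.topCoeff rfl ω = ω S.auxBasis / S.vol S.auxBasis := rfl
  rw [h3]
  conv_rhs => rw [h2]
  conv_lhs => rw [h1]
  rw [smul_smul]
  congr 1
  simp only [AlternatingMap.smul_apply, Basis.det_self, smul_eq_mul, mul_one]
  exact div_mul_cancel₀ _ h0

theorem covectorWedge_flat_add (S : G2Structure V) {m : ℕ} [DecidableEq (Fin m)] (v : Fin m → V)
    (i : Fin m) (x y : V) :
    covectorWedge (fun r => S.metric (Function.update v i (x + y) r)) =
      covectorWedge (fun r => S.metric (Function.update v i x r)) +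
        covectorWedge (fun r => S.metric (Function.update v i y r)) := by
  have h : ∀ z, (fun r => S.metric (Function.update v i z r)) =
      Function.update (fun r => S.metric (v r)) i (S.metric z) := fun z => by
    ext1 r
    by_cases hr : r = i
    · subst hr
      simp
    · simp [hr]
  simp only [h, map_add, covectorWedge_update_add]

theorem covectorWedge_flat_smul (S : G2Structure V) {m : ℕ} [DecidableEq (Fin m)] (v : Fin m → V)
    (i : Fin m) (c : ℝ) (x : V) :
    covectorWedge (fun r => S.metric (Function.update v i (c • x) r)) =
      c • covectorWedge (fun r => S.metric (Function.update v i x r)) := by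
  have h : ∀ z, (fun r => S.metric (Function.update v i z r)) =
      Function.update (fun r => S.metric (v r)) i (S.metric z) := fun z => by
    ext1 r
    by_cases hr : r = i
    · subst hr
      simp
    · simp [hr]
  simp only [h, map_smul, covectorWedge_update_smul]

/-- The Hodge star: `⋆β` is the form such that
`(⋆β)(v₁, …, vₘ) vol = β ∧ v₁♭ ∧ ⋯ ∧ vₘ♭`, where `v♭ = g(v, ·)`. -/
def star (S : G2Structure V) {k m : ℕ} (h : k + m = 7) (β : AltForm V k) : AltForm V m where
  toFun v := S.topCoeff h (wedge β (covectorWedge fun r => S.metric (v r)))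
  map_update_add' := by
    intro _ v i x y
    rw [covectorWedge_flat_add, wedge_add, topCoeff_add]
  map_update_smul' := by
    intro _ v i c x
    rw [covectorWedge_flat_smul, wedge_smul, topCoeff_smul, smul_eq_mul]
  map_eq_zero_of_eq' := by
    intro v i j hv hij
    rw [covectorWedge_eq_zero (i := i) (j := j) _ (by simp [hv]) hij, wedge_zero, topCoeff_zero]

theorem star_apply_smul_vol (S : G2Structure V) {k m : ℕ} (h : k + m = 7) (β : AltForm V k)
    (v : Fin m → V) :
    S.star h β v • S.vol =
      (wedge β (covectorWedge fun r => S.metric (v r))).domDomCongr (finCongr h) :=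
  S.topCoeff_smul_vol ((wedge β (covectorWedge fun r => S.metric (v r))).domDomCongr (finCongr h))

theorem apply_add₀ (ω : AltForm V 3) (x y z w : V) :
    ω ![x + w, y, z] = ω ![x, y, z] + ω ![w, y, z] := by
  have hu : ∀ u, Function.update ![x, y, z] 0 u = ![u, y, z] := fun u => by
    funext j
    fin_cases j <;> rfl
  have h := ω.map_update_add ![x, y, z] 0 x w
  rwa [hu, hu, hu] at h

theorem apply_smul₀ (ω : AltForm V 3) (c : ℝ) (x y z : V) :
    ω ![c • x, y, z] = c * ω ![x, y, z] := by
  have hu : ∀ u, Function.update ![x, y, z] 0 u = ![u, y, z] := fun u => by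
    funext j
    fin_cases j <;> rfl
  have h := ω.map_update_smul ![x, y, z] 0 c x
  rwa [hu, hu] at h

theorem apply_add₁ (ω : AltForm V 3) (x y z w : V) :
    ω ![x, y + w, z] = ω ![x, y, z] + ω ![x, w, z] := by
  have hu : ∀ u, Function.update ![x, y, z] 1 u = ![x, u, z] := fun u => by
    funext j
    fin_cases j <;> rfl
  have h := ω.map_update_add ![x, y, z] 1 y w
  rwa [hu, hu, hu] at h

theorem apply_smul₁ (ω : AltForm V 3) (c : ℝ) (x y z : V) :
    ω ![x, c • y, z] = c * ω ![x, y, z] := by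
  have hu : ∀ u, Function.update ![x, y, z] 1 u = ![x, u, z] := fun u => by
    funext j
    fin_cases j <;> rfl
  have h := ω.map_update_smul ![x, y, z] 1 c y
  rwa [hu, hu] at h

theorem apply_add₂ (ω : AltForm V 3) (x y z w : V) :
    ω ![x, y, z + w] = ω ![x, y, z] + ω ![x, y, w] := by
  have hu : ∀ u, Function.update ![x, y, z] 2 u = ![x, y, u] := fun u => by
    funext j
    fin_cases j <;> rfl
  have h := ω.map_update_add ![x, y, z] 2 z w
  rwa [hu, hu, hu] at h

theorem apply_smul₂ (ω : AltForm V 3) (c : ℝ) (x y z : V) :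
    ω ![x, y, c • z] = c * ω ![x, y, z] := by
  have hu : ∀ u, Function.update ![x, y, z] 2 u = ![x, y, u] := fun u => by
    funext j
    fin_cases j <;> rfl
  have h := ω.map_update_smul ![x, y, z] 2 c z
  rwa [hu, hu] at h

/-- The `4`-form `ψ = ⋆φ`. -/
def ψ (S : G2Structure V) : AltForm V 4 := S.star rfl S.φ

end Linear

section Lie

variable {𝔤 : Type*} [LieRing 𝔤] [LieAlgebra ℝ 𝔤]

/-- A `G₂`-structure on a Lie algebra is coclosed if `dψ = 0`. -/
def IsCoclosed (S : G2Structure 𝔤) : Prop := ceDiff S.ψ = 0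

/-- The torsion form `T = (1/6) ⋆(dφ ∧ φ) φ - ⋆dφ` of a coclosed `G₂`-structure. -/
def torsion (S : G2Structure 𝔤) : AltForm 𝔤 3 :=
  (1 / 6 * S.star (m := 0) rfl (wedge (ceDiff S.φ) S.φ) ![]) • S.φ - S.star rfl (ceDiff S.φ)

/-- `z ↦ (1/2) (g([x,y],z) + g([z,x],y) + g([z,y],x)) + (t/2) T(x,y,z)`: the first summand is the
right-hand side of Koszul's formula for the Levi-Civita connection of the metric. -/
def connectionForm (S : G2Structure 𝔤) (t : ℝ) : 𝔤 →ₗ[ℝ] 𝔤 →ₗ[ℝ] Dual ℝ 𝔤 :=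
  LinearMap.mk₂ ℝ (fun x y =>
    { toFun := fun z =>
        1 / 2 * (S.metric ⁅x, y⁆ z + S.metric ⁅z, x⁆ y + S.metric ⁅z, y⁆ x)
          + t / 2 * S.torsion ![x, y, z]
      map_add' := fun z w => by
        rw [apply_add₂]
        simp only [add_lie, map_add, LinearMap.add_apply]
        ring
      map_smul' := fun c z => by
        rw [apply_smul₂]
        simp only [smul_lie, map_smul, LinearMap.smul_apply, smul_eq_mul,
          RingHom.id_apply]
        ring })
    (fun x x' y => by
      ext z
      simp only [LinearMap.coe_mk, AddHom.coe_mk, LinearMap.add_apply, apply_add₀, lie_add, add_lie,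
        map_add]
      ring)
    (fun c x y => by
      ext z
      simp only [LinearMap.coe_mk, AddHom.coe_mk, LinearMap.smul_apply, apply_smul₀, lie_smul,
        smul_lie, map_smul, smul_eq_mul]
      ring)
    (fun x y y' => by
      ext z
      simp only [LinearMap.coe_mk, AddHom.coe_mk, LinearMap.add_apply, apply_add₁, lie_add, map_add]
      ring)
    (fun c x y => by
      ext z
      simp only [LinearMap.coe_mk, AddHom.coe_mk, LinearMap.smul_apply, apply_smul₁, lie_smul,
        map_smul, smul_eq_mul]
      ring)

/-- The left-invariant connection `∇ᵗ` with
`g(∇ᵗₓ y, z) = g(∇ᵍₓ y, z) + (t/2) T(x, y, z)`. -/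
def connection (S : G2Structure 𝔤) (t : ℝ) : 𝔤 →ₗ[ℝ] End ℝ 𝔤 :=
  haveI := S.finiteDimensional
  (S.connectionForm t).compr₂ (S.metric.toDual S.nondegenerate).symm.toLinearMap

theorem metric_connection (S : G2Structure 𝔤) (t : ℝ) (x y z : 𝔤) :
    S.metric (S.connection t x y) z =
      1 / 2 * (S.metric ⁅x, y⁆ z + S.metric ⁅z, x⁆ y + S.metric ⁅z, y⁆ x)
        + t / 2 * S.torsion ![x, y, z] := by
  have := S.finiteDimensional
  exact LinearMap.BilinForm.apply_toDual_symm_apply (hB := S.nondegenerate) _ _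

/-- A left-invariant connection `D` on the tangent bundle is a `G₂`-instanton if its curvature
satisfies `R ∧ ψ = 0`. -/
def IsInstanton (S : G2Structure 𝔤) (D : 𝔤 →ₗ[ℝ] End ℝ 𝔤) : Prop :=
  wedge (curvature D) S.ψ = 0

end Lie

end G2Structure

section StructureEquations

variable {𝔤 : Type*} [LieRing 𝔤] [LieAlgebra ℝ 𝔤]

/-- The differential `dξ` of a covector. -/
def dCovector (ξ : Dual ℝ 𝔤) : AltForm 𝔤 2 := ceDiff (covectorWedge ![ξ])

/-- `de¹ = ⋯ = de⁶ = 0` and `de⁷ = a (e¹² - e⁵⁶) + b (e³⁴ - e⁵⁶)` with `(a, b) ≠ (0, 0)`. -/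
def HeisenbergEquations (e : Fin 7 → Dual ℝ 𝔤) : Prop :=
  ∃ a b : ℝ, ¬(a = 0 ∧ b = 0) ∧
    dCovector (e 0) = 0 ∧ dCovector (e 1) = 0 ∧ dCovector (e 2) = 0 ∧
    dCovector (e 3) = 0 ∧ dCovector (e 4) = 0 ∧ dCovector (e 5) = 0 ∧
    dCovector (e 6) = a • (covectorWedge ![e 0, e 1] - covectorWedge ![e 4, e 5])
      + b • (covectorWedge ![e 2, e 3] - covectorWedge ![e 4, e 5])

/-- `de¹ = ⋯ = de⁴ = 0`, `de⁵ = ν (e¹³ - e²⁴)`, `de⁶ = ν (-e¹⁴ - e²³)` and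
`de⁷ = ν (e¹² + e³⁴)` with `ν ≠ 0`. -/
def QuaternionicHeisenbergEquations (e : Fin 7 → Dual ℝ 𝔤) : Prop :=
  ∃ ν : ℝ, ν ≠ 0 ∧
    dCovector (e 0) = 0 ∧ dCovector (e 1) = 0 ∧ dCovector (e 2) = 0 ∧ dCovector (e 3) = 0 ∧
    dCovector (e 4) = ν • (covectorWedge ![e 0, e 2] - covectorWedge ![e 1, e 3]) ∧
    dCovector (e 5) = ν • (-covectorWedge ![e 0, e 3] - covectorWedge ![e 1, e 2]) ∧
    dCovector (e 6) = ν • (covectorWedge ![e 0, e 1] + covectorWedge ![e 2, e 3])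

/-- `de¹ = ⋯ = de⁴ = 0`, `de⁵ = -2ν e²⁴`, `de⁶ = -2ν e²³` and `de⁷ = 2ν e³⁴` with `ν ≠ 0`. -/
def FreeTwoStepEquations (e : Fin 7 → Dual ℝ 𝔤) : Prop :=
  ∃ ν : ℝ, ν ≠ 0 ∧
    dCovector (e 0) = 0 ∧ dCovector (e 1) = 0 ∧ dCovector (e 2) = 0 ∧ dCovector (e 3) = 0 ∧
    dCovector (e 4) = (-2 * ν) • covectorWedge ![e 1, e 3] ∧
    dCovector (e 5) = (-2 * ν) • covectorWedge ![e 1, e 2] ∧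
    dCovector (e 6) = (2 * ν) • covectorWedge ![e 2, e 3]

/-- The structure equations take one of the three forms. -/
def InstantonStructureEquations (e : Fin 7 → Dual ℝ 𝔤) : Prop :=
  HeisenbergEquations e ∨ QuaternionicHeisenbergEquations e ∨ FreeTwoStepEquations e

end StructureEquations

end

/-!
The proof is a computation in `G₂`-frames, i.e. bases `f₀, …, f₆` in whose dual basis `φ` has the
model form. In such a frame the basis is orthonormal, `ψ` is the dual model `4`-form, and everything
is determined by the structure constants `c i j k` of the bracket: coclosedness is a list of linear
equations (`IsFrame.isCoclosed_iff`), the torsion is an explicit linear function of `c`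
(`IsFrame.torsionRelations`), and the instanton condition is a list of quadratic equations
(`IsFrame.isInstanton_iff`). For each of the three families these equations hold, which gives one
direction (`IsFrame.isCoclosed_and_isInstanton`).

For the converse, the frame is adapted to the derived algebra `D`, which is central and of dimension
at most three since it is spanned by the brackets of a complement.

* If `D` is a line, the last vector of the frame is taken in `D` and the others are chosen with the
  help of principal axes, so that `dψ = 0` leaves `de⁷ = a e¹² + b e³⁴ + d e⁵⁶`. The instanton
  equations force `(a + b + d)² = 0`.
* If `D` has dimension at least two, `f₅` and `f₆` are taken in `D`. Either `D` lies in
  `span (f₄, f₅, f₆)` with `f₄ = f₅ × f₆` central, or `D` is spanned by `f₅`, `f₆` and a vector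
  `s f₃ + C f₄` with `s ≠ 0`. In the second case a sum of squares among the instanton equations
  shows that the bracket vanishes (`slant_eq_zero`).
* In the first case `de⁵, de⁶, de⁷` are `2`-forms on the four-dimensional `span (f₀, …, f₃)`, with
  self-dual part a `3 × 3`-matrix `X` and anti-self-dual part a matrix `Y`. Coclosedness says that
  `X` is symmetric; the instanton equations force `X = m` to be scalar and the rows of `Y` to
  satisfy `y₂ × y₃ = -m y₁` and its cyclic permutations. If `m = 0`, the rows of `Y` are parallel
  and `D` is too small. If `m ≠ 0`, either `Y = 0`, the quaternionic Heisenberg algebra, or `Y` is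
  `|m|` times an orthogonal matrix. In the latter case there is an additional central vector in
  `span (f₀, …, f₃)` (`IsSpinConst.exists_central`), and choosing it as the new `f₀` turns `Y` into
  `-m`, the free `2`-step nilpotent algebra of rank three plus a line.

The last equivalence of the theorem follows because every basis is a `G₂`-frame of some
`G₂`-structure (`G2Structure.ofBasis`).
-/

noncomputable section

/-! ### Values of wedge products -/

section ExteriorAlgebra

variable {V : Type*} [AddCommGroup V] [Module ℝ V]

/-- The wedge product as a sum over shuffles, i.e. classes of permutations modulo those preserving
the two blocks. -/
theorem wedge_apply_eq_sum {N : Type*} [AddCommGroup N] [Module ℝ N] {k l : ℕ}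
    (α : V [⋀^Fin k]→ₗ[ℝ] N) (β : AltForm V l) (v : Fin (k + l) → V) :
    wedge α β v = ∑ σ : Equiv.Perm.ModSumCongr (Fin k) (Fin l), TensorProduct.rid ℝ N
      (AlternatingMap.domCoprod.summand α β σ (v ∘ finSumFinEquiv)) := by
  simp only [wedge, AlternatingMap.domDomCongr_apply, LinearMap.compAlternatingMap_apply,
    AlternatingMap.domCoprod_apply, LinearEquiv.coe_coe]
  rw [sum_apply, map_sum]

theorem rid_summand_mk {N : Type*} [AddCommGroup N] [Module ℝ N] {k l : ℕ}
    (α : V [⋀^Fin k]→ₗ[ℝ] N) (β : AltForm V l) (v : Fin k ⊕ Fin l → V)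
    (σ : Equiv.Perm (Fin k ⊕ Fin l)) :
    TensorProduct.rid ℝ N (AlternatingMap.domCoprod.summand α β (Quotient.mk'' σ) v) =
      Equiv.Perm.sign σ • (β (fun j => v (σ (Sum.inr j))) • α (fun i => v (σ (Sum.inl i)))) := by
  rw [AlternatingMap.domCoprod.summand_mk'']
  rcases Int.units_eq_one_or (Equiv.Perm.sign σ) with h | h <;>
    simp [h, MultilinearMap.domDomCongr_apply, MultilinearMap.domCoprod_apply]

/-- The value of a wedge product on `v` depends on the second factor only through its values on
the subfamilies of `v`. -/
theorem wedge_apply_congr {N : Type*} [AddCommGroup N] [Module ℝ N] {k l : ℕ}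
    (α : V [⋀^Fin k]→ₗ[ℝ] N) {β β' : AltForm V l} (v : Fin (k + l) → V)
    (h : ∀ g : Fin l → Fin (k + l), Function.Injective g → β (v ∘ g) = β' (v ∘ g)) :
    wedge α β v = wedge α β' v := by
  rw [wedge_apply_eq_sum, wedge_apply_eq_sum]
  refine Finset.sum_congr rfl fun σ _ => ?_
  induction σ using Quotient.inductionOn' with | _ σ
  rw [rid_summand_mk, rid_summand_mk]
  have := h (fun j => finSumFinEquiv (σ (Sum.inr j))) (fun a b hab => by simpa using hab)
  simp only [Function.comp_def] at this ⊢
  rw [this]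

/-- If the second factor kills every subfamily of `v` that meets the first `k` entries, only the
identity shuffle contributes to the wedge product. -/
theorem wedge_apply_of_vanish {N : Type*} [AddCommGroup N] [Module ℝ N] {k l : ℕ}
    (α : V [⋀^Fin k]→ₗ[ℝ] N) (β : AltForm V l) (v : Fin (k + l) → V)
    (h : ∀ g : Fin l → Fin (k + l), (∃ j s, g j = Fin.castAdd l s) → β (v ∘ g) = 0) :
    wedge α β v = β (v ∘ Fin.natAdd k) • α (v ∘ Fin.castAdd l) := by
  rw [wedge_apply_eq_sum]
  refine (Finset.sum_eq_single (Quotient.mk'' 1) ?_ ?_).trans ?_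
  · intro σ _ hσ
    induction σ using Quotient.inductionOn' with | _ σ
    rw [rid_summand_mk]
    have hex : ∃ j s, σ (Sum.inr j) = Sum.inl s := by
      by_contra hcon
      push Not at hcon
      apply hσ
      rw [Quotient.eq'', QuotientGroup.leftRel_apply, mul_one, Subgroup.inv_mem_iff]
      apply Equiv.Perm.mem_sumCongrHom_range_of_perm_mapsTo_inl
      rw [Equiv.Perm.perm_mapsTo_inl_iff_mapsTo_inr]
      rintro _ ⟨j, rfl⟩
      rcases hj : σ (Sum.inr j) with s | s
      · exact absurd hj (hcon j s)
      · exact ⟨s, rfl⟩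
    obtain ⟨j, s, hjs⟩ := hex
    have h0 := h (fun j => finSumFinEquiv (σ (Sum.inr j))) ⟨j, s, by simp [hjs]⟩
    simp only [Function.comp_def] at h0 ⊢
    rw [h0, zero_smul, smul_zero]
  · simp
  · rw [rid_summand_mk]
    simp [Function.comp_def]

theorem covectorWedge_apply_eq_zero {k : ℕ} (ξ : Fin k → Dual ℝ V) (v : Fin k → V) (s : Fin k)
    (h : ∀ r, ξ r (v s) = 0) : covectorWedge ξ v = 0 := by
  rw [covectorWedge_apply]
  exact Matrix.det_eq_zero_of_row_eq_zero s h

theorem covectorWedge_one_apply (a : Dual ℝ V) (x : V) : covectorWedge ![a] ![x] = a x := by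
  simp [covectorWedge_apply]

theorem covectorWedge_two_apply (a b : Dual ℝ V) (x y : V) :
    covectorWedge ![a, b] ![x, y] = a x * b y - b x * a y := by
  simp [covectorWedge_apply, Matrix.det_fin_two]

theorem covectorWedge_three_apply (a b c : Dual ℝ V) (x y z : V) :
    covectorWedge ![a, b, c] ![x, y, z] =
      a x * b y * c z - a x * c y * b z - b x * a y * c z + b x * c y * a z
        + c x * a y * b z - c x * b y * a z := by
  simp [covectorWedge_apply, Matrix.det_fin_three]

/-- Alternating forms that agree on the increasing subfamilies of a basis are equal. -/
theorem AlternatingMap.ext_of_strictMono {N : Type*} [AddCommGroup N] [Module ℝ N] {n k : ℕ}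
    (f : Basis (Fin n) ℝ V) {α β : V [⋀^Fin k]→ₗ[ℝ] N}
    (h : ∀ K : Fin k → Fin n, StrictMono K → α (f ∘ K) = β (f ∘ K)) : α = β := by
  refine f.ext_alternating fun K hK => ?_
  have hm : StrictMono (K ∘ Tuple.sort K) :=
    (Tuple.monotone_sort K).strictMono_of_injective (hK.comp (Equiv.injective _))
  have := h _ hm
  rw [← Function.comp_assoc, α.map_perm, β.map_perm] at this
  exact smul_left_cancel _ this

theorem AlternatingMap.ext_two (f : Basis (Fin 7) ℝ V) {α β : AltForm V 2}
    (h : ∀ i j, i < j → α ![f i, f j] = β ![f i, f j]) : α = β := by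
  refine AlternatingMap.ext_of_strictMono f fun K hK => ?_
  have := h (K 0) (K 1) (hK (by decide))
  convert this using 2 <;> (ext i; fin_cases i <;> rfl)

/-- The wedge product with a decomposable form `ξ`, evaluated on a family of vectors of which some
are killed by `ξ` and the others are dual to it. -/
theorem wedge_covectorWedge_apply {N : Type*} [AddCommGroup N] [Module ℝ N] {k l : ℕ}
    (α : V [⋀^Fin k]→ₗ[ℝ] N) (ξ : Fin l → Dual ℝ V) (v : Fin (k + l) → V)
    (σ : Equiv.Perm (Fin (k + l))) (h0 : ∀ r s, ξ r (v (σ (Fin.castAdd l s))) = 0)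
    (h1 : ∀ r s, ξ r (v (σ (Fin.natAdd k s))) = if s = r then 1 else 0) :
    wedge α (covectorWedge ξ) v =
      Equiv.Perm.sign σ • α (fun i => v (σ (Fin.castAdd l i))) := by
  have h2 : covectorWedge ξ ((v ∘ σ) ∘ Fin.natAdd k) = 1 := by
    rw [covectorWedge_apply, ← Matrix.det_one (n := Fin l) (R := ℝ)]
    congr 1
    ext s r
    simp [h1, Matrix.one_apply]
  have h3 := wedge_apply_of_vanish α (covectorWedge ξ) (v ∘ σ) (by
    rintro g ⟨j, s, hj⟩
    exact covectorWedge_apply_eq_zero _ _ j fun r => by simp [hj, h0])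
  rw [(wedge α (covectorWedge ξ)).map_congr_perm v σ, h3, h2, one_smul]
  rfl

theorem AlternatingMap.two_self (β : AltForm V 2) (x : V) : β ![x, x] = 0 :=
  β.map_eq_zero_of_eq (i := 0) (j := 1) _ rfl (by decide)

theorem AlternatingMap.two_swap (β : AltForm V 2) (x y : V) : β ![y, x] = -β ![x, y] := by
  have := β.map_swap ![x, y] (i := 0) (j := 1) (by decide)
  rw [← this]
  congr 1
  ext i
  fin_cases i <;> rfl

/-- The wedge product of two `2`-forms as a sum over `(2, 2)`-shuffles, on vectors admitting dual
covectors. -/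
theorem wedge_two_two_apply (α β : AltForm V 2) (v : Fin (2 + 2) → V) (ε : Fin 4 → Dual ℝ V)
    (hε : ∀ p q, ε p (v q) = if q = p then 1 else 0) :
    wedge α β v = α ![v 0, v 1] * β ![v 2, v 3] - α ![v 0, v 2] * β ![v 1, v 3]
      + α ![v 0, v 3] * β ![v 1, v 2] + α ![v 1, v 2] * β ![v 0, v 3]
      - α ![v 1, v 3] * β ![v 0, v 2] + α ![v 2, v 3] * β ![v 0, v 1] := by
  -- on the vectors at hand `β` agrees with a combination of decomposable forms
  have key : wedge α β v = wedge α
      (β ![v 2, v 3] • covectorWedge ![ε 2, ε 3] + β ![v 1, v 3] • covectorWedge ![ε 1, ε 3]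
        + β ![v 1, v 2] • covectorWedge ![ε 1, ε 2] + β ![v 0, v 3] • covectorWedge ![ε 0, ε 3]
        + β ![v 0, v 2] • covectorWedge ![ε 0, ε 2] + β ![v 0, v 1] • covectorWedge ![ε 0, ε 1]) v
          := by
    refine wedge_apply_congr α v fun g _ => ?_
    obtain ⟨a, b, rfl⟩ : ∃ a b, g = ![a, b] := ⟨g 0, g 1, by ext i; fin_cases i <;> rfl⟩
    have : v ∘ ![a, b] = ![v a, v b] := by ext i; fin_cases i <;> rfl
    rw [this]
    simp only [AlternatingMap.add_apply, AlternatingMap.smul_apply, covectorWedge_two_apply, hε]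
    fin_cases a <;> fin_cases b <;> simp [AlternatingMap.two_self] <;>
      exact AlternatingMap.two_swap _ _ _
  have aux : ∀ (p q r s : Fin 4) (σ : Equiv.Perm (Fin 4)) (c : ℤˣ) (_ : Equiv.Perm.sign σ = c)
      (_ : p ≠ q) (_ : σ 0 = r) (_ : σ 1 = s) (_ : σ 2 = p) (_ : σ 3 = q),
      wedge α (covectorWedge ![ε p, ε q]) v = c • α ![v r, v s] := by
    rintro p q r s σ c rfl hpq rfl rfl rfl rfl
    rw [wedge_covectorWedge_apply α ![ε (σ 2), ε (σ 3)] v σ]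
    · congr 2
      ext i
      fin_cases i <;> rfl
    · intro r s
      fin_cases r <;> fin_cases s <;> simp [hε, Fin.castAdd, Fin.castLE]
    · intro r s
      fin_cases r <;> fin_cases s <;> simp [hε, Fin.natAdd]
  rw [key]
  simp only [wedge_add, wedge_smul, AlternatingMap.add_apply, AlternatingMap.smul_apply]
  rw [aux 2 3 0 1 1 1, aux 1 3 0 2 (Equiv.swap 1 2) (-1),
    aux 1 2 0 3 ⟨![0, 3, 1, 2], ![0, 2, 3, 1], by decide, by decide⟩ 1,
    aux 0 3 1 2 ⟨![1, 2, 0, 3], ![2, 0, 1, 3], by decide, by decide⟩ 1,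
    aux 0 2 1 3 ⟨![1, 3, 0, 2], ![2, 0, 3, 1], by decide, by decide⟩ (-1),
    aux 0 1 2 3 ⟨![2, 3, 0, 1], ![2, 3, 0, 1], by decide, by decide⟩ 1] <;> try decide
  simp
  ring

end ExteriorAlgebra

/-! ### The model `3`-form -/

section ModelForm

variable {V : Type*} [AddCommGroup V] [Module ℝ V]

theorem wedge_sub {N : Type*} [AddCommGroup N] [Module ℝ N] {k l : ℕ}
    (α : V [⋀^Fin k]→ₗ[ℝ] N) (β γ : AltForm V l) : wedge α (β - γ) = wedge α β - wedge α γ := by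
  rw [sub_eq_add_neg, ← neg_one_smul ℝ, wedge_add, wedge_smul, neg_one_smul, ← sub_eq_add_neg]

/-- The model `3`-form, arranged as the scalar product of the cross product of `x` and `y` with
`z`. -/
theorem stdForm_apply (e : Fin 7 → Dual ℝ V) (x y z : V) :
    stdForm e ![x, y, z] =
      (e 0 x * e 1 y - e 1 x * e 0 y + e 2 x * e 3 y - e 3 x * e 2 y
        + e 4 x * e 5 y - e 5 x * e 4 y) * e 6 z
      + (e 6 x * e 0 y - e 0 x * e 6 y - e 2 x * e 5 y + e 5 x * e 2 y
        + e 4 x * e 3 y - e 3 x * e 4 y) * e 1 z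
      + (e 1 x * e 6 y - e 6 x * e 1 y + e 2 x * e 4 y - e 4 x * e 2 y
        - e 3 x * e 5 y + e 5 x * e 3 y) * e 0 z
      + (e 3 x * e 6 y - e 6 x * e 3 y - e 0 x * e 4 y + e 4 x * e 0 y
        + e 1 x * e 5 y - e 5 x * e 1 y) * e 2 z
      + (e 6 x * e 2 y - e 2 x * e 6 y + e 0 x * e 5 y - e 5 x * e 0 y
        + e 1 x * e 4 y - e 4 x * e 1 y) * e 3 z
      + (e 5 x * e 6 y - e 6 x * e 5 y + e 0 x * e 2 y - e 2 x * e 0 y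
        - e 1 x * e 3 y + e 3 x * e 1 y) * e 4 z
      + (e 6 x * e 4 y - e 4 x * e 6 y - e 0 x * e 3 y + e 3 x * e 0 y
        - e 1 x * e 2 y + e 2 x * e 1 y) * e 5 z := by
  simp only [stdForm, AlternatingMap.add_apply, AlternatingMap.sub_apply,
    covectorWedge_three_apply]
  ring

theorem Module.Basis.coord_self_apply {ι : Type*} [DecidableEq ι] (f : Basis ι ℝ V) (i j : ι) :
    f.coord i (f j) = if j = i then 1 else 0 := by
  simp [Finsupp.single_apply]

/-- The covectors `φ(·, f_i, f_j)` for the model form `φ`,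
  i.e. the multiplication table of the cross product. -/
theorem stdForm_basis_apply (f : Basis (Fin 7) ℝ V) (w : V) :
    stdForm f.coord ![w, f 0, f 1] = f.coord 6 w ∧
    stdForm f.coord ![w, f 0, f 2] = f.coord 4 w ∧
    stdForm f.coord ![w, f 0, f 3] = -f.coord 5 w ∧
    stdForm f.coord ![w, f 0, f 4] = -f.coord 2 w ∧
    stdForm f.coord ![w, f 0, f 5] = f.coord 3 w ∧
    stdForm f.coord ![w, f 0, f 6] = -f.coord 1 w ∧
    stdForm f.coord ![w, f 1, f 2] = -f.coord 5 w ∧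
    stdForm f.coord ![w, f 1, f 3] = -f.coord 4 w ∧
    stdForm f.coord ![w, f 1, f 4] = f.coord 3 w ∧
    stdForm f.coord ![w, f 1, f 5] = f.coord 2 w ∧
    stdForm f.coord ![w, f 1, f 6] = f.coord 0 w ∧
    stdForm f.coord ![w, f 2, f 3] = f.coord 6 w ∧
    stdForm f.coord ![w, f 2, f 4] = f.coord 0 w ∧
    stdForm f.coord ![w, f 2, f 5] = -f.coord 1 w ∧
    stdForm f.coord ![w, f 2, f 6] = -f.coord 3 w ∧
    stdForm f.coord ![w, f 3, f 4] = -f.coord 1 w ∧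
    stdForm f.coord ![w, f 3, f 5] = -f.coord 0 w ∧
    stdForm f.coord ![w, f 3, f 6] = f.coord 2 w ∧
    stdForm f.coord ![w, f 4, f 5] = f.coord 6 w ∧
    stdForm f.coord ![w, f 4, f 6] = -f.coord 5 w ∧
    stdForm f.coord ![w, f 5, f 6] = f.coord 4 w := by
  refine ⟨?_, ?_, ?_, ?_, ?_, ?_, ?_, ?_, ?_, ?_, ?_, ?_, ?_, ?_, ?_, ?_, ?_, ?_, ?_, ?_, ?_⟩ <;>
    simp [stdForm_apply]

/-- The wedge product with a decomposable form in the coordinates of a basis `f`, evaluated on basis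
vectors `f_I, f_K` listed in the order given by `σ`. -/
theorem wedge_coord_apply {N : Type*} [AddCommGroup N] [Module ℝ N] {k l n : ℕ}
    (f : Basis (Fin n) ℝ V) (α : V [⋀^Fin k]→ₗ[ℝ] N) (v : Fin (k + l) → V) (I : Fin k → Fin n)
    (K : Fin l → Fin n) {ξ : Fin l → Dual ℝ V} (hξ : ∀ r, ξ r = f.coord (K r))
    (σ : Equiv.Perm (Fin (k + l))) {c : ℤˣ} (hc : Equiv.Perm.sign σ = c)
    (hI : ∀ s, v (σ (Fin.castAdd l s)) = f (I s)) (hK : ∀ r, v (σ (Fin.natAdd k r)) = f (K r))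
    (hinj : Function.Injective K) (hIK : ∀ s r, I s ≠ K r) :
    wedge α (covectorWedge ξ) v = ((c : ℤ) : ℝ) • α (f ∘ I) := by
  rw [wedge_covectorWedge_apply α ξ v σ, hc]
  · rw [show (fun i => v (σ (Fin.castAdd l i))) = f ∘ I from funext hI]
    rcases Int.units_eq_one_or c with h | h <;> simp [h]
  · intro r s
    rw [hξ, hI, Basis.coord_self_apply, if_neg (hIK s r)]
  · intro r s
    rw [hξ, hK, Basis.coord_self_apply]
    simp [hinj.eq_iff]

/-- The dual basis in `V` of a basis of the dual space. -/
theorem exists_basis_coord_eq (e : Basis (Fin 7) ℝ (Dual ℝ V)) :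
    ∃ f : Basis (Fin 7) ℝ V, f.coord = e := by
  have : FiniteDimensional ℝ V := (Module.finite_dual_iff ℝ).mp (Module.Finite.of_basis e)
  refine ⟨e.dualBasis.map (Module.evalEquiv ℝ V).symm, ?_⟩
  funext i
  refine (e.dualBasis.map (Module.evalEquiv ℝ V).symm).ext fun j => ?_
  rw [Basis.coord_self_apply]
  have h : ∀ ξ : Dual ℝ (Dual ℝ V), e i ((Module.evalEquiv ℝ V).symm ξ) = ξ (e i) := fun ξ => by
    obtain ⟨x, rfl⟩ := (Module.evalEquiv ℝ V).surjective ξ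
    simp
  rw [Basis.map_apply, h]
  simp [Finsupp.single_apply, eq_comm]

/-- The wedge product of a `4`-form with the model `3`-form, contracted with the basis; the signs
are the coefficients of the dual `4`-form. -/
theorem wedge_stdForm_apply (f : Basis (Fin 7) ℝ V) (α : AltForm V 4) (w : Fin (4 + 3) → V)
    (hw : w = f) :
    wedge α (stdForm f.coord) w = α ![f 0, f 1, f 2, f 3] + α ![f 0, f 1, f 4, f 5]
      + α ![f 0, f 2, f 5, f 6] + α ![f 0, f 3, f 4, f 6] + α ![f 1, f 2, f 4, f 6]
      - α ![f 1, f 3, f 5, f 6] + α ![f 2, f 3, f 4, f 5] := by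
  have aux : ∀ (σ : Equiv.Perm (Fin 7)) (ε : ℤˣ), Equiv.Perm.sign σ = ε →
      wedge α (covectorWedge ![f.coord (σ 4), f.coord (σ 5), f.coord (σ 6)]) w =
        ((ε : ℤ) : ℝ) * α ![f (σ 0), f (σ 1), f (σ 2), f (σ 3)] := by
    intro σ ε hε
    have h := wedge_coord_apply (k := 4) (l := 3) f α w (fun i => σ (Fin.castAdd 3 i))
      (fun i => σ (Fin.natAdd 4 i)) (ξ := ![f.coord (σ 4), f.coord (σ 5), f.coord (σ 6)])
      (fun r => by fin_cases r <;> rfl) σ hε (fun _ => by rw [hw])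
      (fun _ => by rw [hw])
      (σ.injective.comp (Fin.natAdd_injective 3 4)) (fun s r h => by
        have := congrArg Fin.val (σ.injective h)
        simp at this
        omega)
    have h2 : (f ∘ fun i => σ (Fin.castAdd 3 i)) = ![f (σ 0), f (σ 1), f (σ 2), f (σ 3)] := by
      ext i
      fin_cases i <;> rfl
    rw [h2] at h
    rw [h, smul_eq_mul]
  have h1 := aux ⟨![2, 3, 4, 5, 0, 1, 6], ![4, 5, 0, 1, 2, 3, 6], by decide,
      by decide⟩ 1 (by decide)
  have h2 := aux ⟨![0, 1, 4, 5, 2, 3, 6], ![0, 1, 4, 5, 2, 3, 6], by decide,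
      by decide⟩ 1 (by decide)
  have h3 := aux ⟨![0, 1, 2, 3, 4, 5, 6], ![0, 1, 2, 3, 4, 5, 6], by decide,
      by decide⟩ 1 (by decide)
  have h4 := aux ⟨![1, 3, 5, 6, 0, 2, 4], ![4, 0, 5, 1, 6, 2, 3], by decide, by decide⟩ (-1)
    (by decide)
  have h5 := aux ⟨![1, 2, 4, 6, 0, 3, 5], ![4, 0, 1, 5, 2, 6, 3], by decide, by decide⟩ (-1)
    (by decide)
  have h6 := aux ⟨![0, 3, 4, 6, 1, 2, 5], ![0, 4, 5, 1, 2, 6, 3], by decide, by decide⟩ (-1)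
    (by decide)
  have h7 := aux ⟨![0, 2, 5, 6, 1, 3, 4], ![0, 4, 1, 5, 6, 2, 3], by decide, by decide⟩ (-1)
    (by decide)
  simp at h1 h2 h3 h4 h5 h6 h7
  rw [stdForm, wedge_sub, wedge_sub, wedge_sub, wedge_add, wedge_add, wedge_add]
  simp only [AlternatingMap.add_apply, AlternatingMap.sub_apply, h1, h2, h3, h4, h5, h6, h7]
  ring

/-- The algebraic identity behind the metric of a `G₂`-structure:
`(x ⌟ φ) ∧ (y ⌟ φ) ∧ φ` is `6 ⟨x, y⟩` times the volume form, for the inner product in which the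
basis is orthonormal. -/
theorem wedge_curryLeft_stdForm_apply (f : Basis (Fin 7) ℝ V) (x y : V) (w : Fin (2 + 2 + 3) → V)
    (hw : w = f) :
    wedge (wedge ((stdForm f.coord).curryLeft x) ((stdForm f.coord).curryLeft y)) (stdForm f.coord)
      w = 6 * ∑ i, f.coord i x * f.coord i y := by
  have aux : ∀ (a b c d : Fin 7) (_ : Function.Injective ![a, b, c, d]),
      wedge ((stdForm f.coord).curryLeft x) ((stdForm f.coord).curryLeft y) ![f a, f b, f c, f d]
        = stdForm f.coord ![x, f a, f b] * stdForm f.coord ![y, f c, f d]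
          - stdForm f.coord ![x, f a, f c] * stdForm f.coord ![y, f b, f d]
          + stdForm f.coord ![x, f a, f d] * stdForm f.coord ![y, f b, f c]
          + stdForm f.coord ![x, f b, f c] * stdForm f.coord ![y, f a, f d]
          - stdForm f.coord ![x, f b, f d] * stdForm f.coord ![y, f a, f c]
          + stdForm f.coord ![x, f c, f d] * stdForm f.coord ![y, f a, f b] := by
    intro a b c d h
    rw [wedge_two_two_apply _ _ _ (fun p => f.coord (![a, b, c, d] p))]
    · rfl
    · intro p q
      have : ![f a, f b, f c, f d] q = f (![a, b, c, d] q) := by fin_cases q <;> rfl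
      rw [this, Basis.coord_self_apply]
      simp [h.eq_iff]
  rw [wedge_stdForm_apply f _ w hw]
  rw [aux _ _ _ _ (by decide), aux _ _ _ _ (by decide), aux _ _ _ _ (by decide),
    aux _ _ _ _ (by decide), aux _ _ _ _ (by decide), aux _ _ _ _ (by decide),
    aux _ _ _ _ (by decide)]
  simp [stdForm_apply, Fin.sum_univ_seven]
  ring

end ModelForm

/-! ### `G₂`-frames -/

namespace G2Structure

section Frames

variable {V : Type*} [AddCommGroup V] [Module ℝ V] {S : G2Structure V}

/-- A basis of `V` is a `G₂`-frame if the `3`-form takes the model form in its dual basis. -/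
def IsFrame (S : G2Structure V) (f : Basis (Fin 7) ℝ V) : Prop :=
  S.φ = stdForm f.coord

theorem exists_isFrame (S : G2Structure V) : ∃ f, S.IsFrame f := by
  obtain ⟨e, he⟩ := S.positive
  obtain ⟨f, hf⟩ := exists_basis_coord_eq e
  exact ⟨f, by rw [IsFrame, he, hf]⟩

theorem IsFrame.metric_mul_vol {f : Basis (Fin 7) ℝ V} (hf : S.IsFrame f) (x y : V) :
    S.metric x y * S.vol f = ∑ i, f.coord i x * f.coord i y := by
  have h1 := congrArg (fun ω => ω f) (S.induced x y)
  have h2 := wedge_curryLeft_stdForm_apply f x y f rfl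
  simp only [AlternatingMap.smul_apply, smul_eq_mul] at h1
  rw [IsFrame] at hf
  rw [hf] at h1
  linarith [h1.symm.trans h2]

/-- The volume form of a `G₂`-structure is determined by the `3`-form: with `t = vol f`, the
defining equation gives `g = t⁻¹ ⟨·,·⟩`, and then `t² = det g = t⁻⁷`. -/
theorem IsFrame.vol_eq_one {f : Basis (Fin 7) ℝ V} (hf : S.IsFrame f) : S.vol f = 1 := by
  set t := S.vol f with ht
  have hg : ∀ i j, S.metric (f i) (f j) * t = if i = j then 1 else 0 := fun i j => by
    rw [hf.metric_mul_vol]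
    simp only [Basis.coord_self_apply, ite_mul, one_mul, zero_mul, Finset.sum_ite_eq,
      Finset.mem_univ, if_true]
    simp [eq_comm]
  have ht0 : t ≠ 0 := fun h => by simpa [h] using hg 0 0
  have hm : (Matrix.of fun i j => S.metric (f i) (f j)) = t⁻¹ • (1 : Matrix (Fin 7) (Fin 7) ℝ) := by
    ext i j
    have := hg i j
    rw [Matrix.smul_apply, Matrix.one_apply, Matrix.of_apply, ← this, smul_eq_mul]
    field_simp
  have h := S.vol_sq f
  rw [hm, Matrix.det_smul, Matrix.det_one, ← ht, Fintype.card_fin, mul_one] at h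
  have h9 : t ^ 9 = 1 := by
    field_simp at h
    linarith
  have hodd : Odd 9 := by decide
  exact hodd.strictMono_pow.injective (by simpa using h9)

theorem IsFrame.metric_apply {f : Basis (Fin 7) ℝ V} (hf : S.IsFrame f) (x y : V) :
    S.metric x y = ∑ i, f.coord i x * f.coord i y := by
  rw [← hf.metric_mul_vol, hf.vol_eq_one, mul_one]

theorem IsFrame.metric_left {f : Basis (Fin 7) ℝ V} (hf : S.IsFrame f) (i : Fin 7) :
    S.metric (f i) = f.coord i := by
  ext y
  rw [hf.metric_apply]
  simp only [Basis.coord_self_apply, ite_mul, one_mul, zero_mul, Finset.sum_ite_eq,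
    Finset.mem_univ, if_true]

theorem IsFrame.metric_right {f : Basis (Fin 7) ℝ V} (hf : S.IsFrame f) (i : Fin 7) (x : V) :
    S.metric x (f i) = f.coord i x := by
  rw [S.metric_symm, hf.metric_left]

/-- The Hodge star of a form in a `G₂`-frame: `(⋆β)(f_K)` is the sign of the permutation `(I, K)`
times `β(f_I)`. -/
theorem IsFrame.star_apply {f : Basis (Fin 7) ℝ V} (hf : S.IsFrame f) {k m : ℕ} (h : k + m = 7)
    (β : AltForm V k) (σ : Equiv.Perm (Fin 7)) {c : ℤˣ} (hc : Equiv.Perm.sign σ = c)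
    (I : Fin k → Fin 7) (K : Fin m → Fin 7)
    (hI : ∀ s, σ (Fin.cast h (Fin.castAdd m s)) = I s)
    (hK : ∀ r, σ (Fin.cast h (Fin.natAdd k r)) = K r) :
    S.star h β (f ∘ K) = ((c : ℤ) : ℝ) * β (f ∘ I) := by
  have h1 := congrArg (fun ω => ω f) (S.star_apply_smul_vol h β (f ∘ K))
  simp only [AlternatingMap.smul_apply, hf.vol_eq_one, smul_eq_mul, mul_one] at h1
  rw [h1, AlternatingMap.domDomCongr_apply]
  refine wedge_coord_apply f β (f ∘ finCongr h) I K (fun r => hf.metric_left _)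
    (((finCongr h).permCongr).symm σ) ?_ ?_ ?_ ?_ ?_
  · rw [← hc]
    simp [Equiv.Perm.sign_permCongr]
  · intro s
    simp [← hI]
  · intro s
    simp [← hK]
  · intro a b hab
    rw [← hK, ← hK] at hab
    simpa using hab
  · intro s r h
    rw [← hI, ← hK] at h
    have := congrArg Fin.val (σ.injective h)
    simp at this
    omega

end Frames

end G2Structure

/-! ### The differential of `3`- and `4`-forms -/

section Signs

/-- The sign of a self-map of `Fin n`, computed by counting inversions. -/
def inversionSign {n : ℕ} (v : Fin n → Fin n) : ℤˣ :=
  ∏ i, ∏ j ∈ Finset.Ioi i, if v i < v j then 1 else -1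

theorem exists_perm_of_injective {n : ℕ} {v : Fin n → Fin n} (hv : Function.Injective v) :
    ∃ σ : Equiv.Perm (Fin n), ⇑σ = v ∧ Equiv.Perm.sign σ = inversionSign v :=
  ⟨Equiv.ofBijective v (Finite.injective_iff_bijective.mp hv), rfl,
    Equiv.Perm.sign_eq_prod_prod_Ioi _⟩

end Signs

section Differential

variable {𝔤 : Type*} [LieRing 𝔤] [LieAlgebra ℝ 𝔤]

theorem ceDiff_three_apply (ω : AltForm 𝔤 3) (x y z w : 𝔤) :
    ceDiff ω ![x, y, z, w] = -ω ![⁅x, y⁆, z, w] + ω ![⁅x, z⁆, y, w] - ω ![⁅x, w⁆, y, z]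
      - ω ![⁅y, z⁆, x, w] + ω ![⁅y, w⁆, x, z] - ω ![⁅z, w⁆, x, y] := by
  obtain ⟨F, hF⟩ : ∃ F : 𝔤 → 𝔤 → 𝔤 → ℝ, ∀ a (u : Fin 2 → 𝔤), ω (Matrix.vecCons a u) =
      F a (u 0) (u 1) :=
    ⟨fun a b c => ω ![a, b, c], fun a u => by
      congr 2
      ext i
      fin_cases i <;> rfl⟩
  have hneg : ∀ a b p q, F ⁅b, a⁆ p q = -F ⁅a, b⁆ p q := fun a b p q => by
    have h := G2Structure.apply_smul₀ ω (-1) ⁅a, b⁆ p q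
    rw [neg_one_smul, lie_skew, hF, hF] at h
    simpa using h
  rw [ceDiff_apply]
  simp [Fin.sum_univ_succ, Fin.removeNth, Fin.succAbove, hF]
  simp only [hneg x y, hneg x z, hneg x w, hneg y z, hneg y w, hneg z w]
  ring

theorem ceDiff_four_apply (ω : AltForm 𝔤 4) (x y z w u : 𝔤) :
    ceDiff ω ![x, y, z, w, u] = -ω ![⁅x, y⁆, z, w, u] + ω ![⁅x, z⁆, y, w, u]
      - ω ![⁅x, w⁆, y, z, u] + ω ![⁅x, u⁆, y, z, w] - ω ![⁅y, z⁆, x, w, u]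
      + ω ![⁅y, w⁆, x, z, u] - ω ![⁅y, u⁆, x, z, w] - ω ![⁅z, w⁆, x, y, u]
      + ω ![⁅z, u⁆, x, y, w] - ω ![⁅w, u⁆, x, y, z] := by
  obtain ⟨F, hF⟩ : ∃ F : 𝔤 → 𝔤 → 𝔤 → 𝔤 → ℝ, ∀ a (u : Fin 3 → 𝔤), ω (Matrix.vecCons a u) =
      F a (u 0) (u 1) (u 2) :=
    ⟨fun a b c d => ω ![a, b, c, d], fun a u => by
      congr 2
      ext i
      fin_cases i <;> rfl⟩
  have hneg : ∀ a b p q r, F ⁅b, a⁆ p q r = -F ⁅a, b⁆ p q r := fun a b p q r => by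
    have hu : ∀ u, Function.update ![⁅a, b⁆, p, q, r] 0 u = ![u, p, q, r] := fun u => by
      ext i
      fin_cases i <;> rfl
    have h := ω.map_update_smul ![⁅a, b⁆, p, q, r] 0 (-1) ⁅a, b⁆
    rw [neg_one_smul, lie_skew, hu, hu, hF, hF] at h
    simpa using h
  rw [ceDiff_apply]
  simp [Fin.sum_univ_succ, Fin.removeNth, Fin.succAbove, hF]
  simp only [hneg x y, hneg x z, hneg x w, hneg x u, hneg y z, hneg y w, hneg y u, hneg z w,
    hneg z u, hneg w u]
  ring

end Differential

/-! ### The `4`-form `ψ` -/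

section DualForm

variable {V : Type*} [AddCommGroup V] [Module ℝ V]

/-- The `4`-form `e¹²³⁴ + e¹²⁵⁶ + e¹³⁶⁷ + e¹⁴⁵⁷ + e²³⁵⁷ - e²⁴⁶⁷ + e³⁴⁵⁶` dual to the model
`3`-form. -/
def stdDualForm (e : Fin 7 → Dual ℝ V) : AltForm V 4 :=
  covectorWedge ![e 0, e 1, e 2, e 3] + covectorWedge ![e 0, e 1, e 4, e 5]
    + covectorWedge ![e 0, e 2, e 5, e 6] + covectorWedge ![e 0, e 3, e 4, e 6]
    + covectorWedge ![e 1, e 2, e 4, e 6] - covectorWedge ![e 1, e 3, e 5, e 6]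
    + covectorWedge ![e 2, e 3, e 4, e 5]

theorem covectorWedge_four_apply (a b c d : Dual ℝ V) (x y z w : V) :
    covectorWedge ![a, b, c, d] ![x, y, z, w] =
      a x * covectorWedge ![b, c, d] ![y, z, w] - b x * covectorWedge ![a, c, d] ![y, z, w]
        + c x * covectorWedge ![a, b, d] ![y, z, w]
        - d x * covectorWedge ![a, b, c] ![y, z, w] := by
  simp [covectorWedge_apply, Matrix.det_succ_row_zero, Fin.sum_univ_succ, Fin.succAbove]
  ring

/-- The covectors `ψ(·, f_i, f_j, f_k)` for the dual `4`-form `ψ`. -/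
theorem stdDualForm_basis_apply (f : Basis (Fin 7) ℝ V) (w : V) :
    stdDualForm f.coord ![w, f 0, f 1, f 2] = -f.coord 3 w ∧
    stdDualForm f.coord ![w, f 0, f 1, f 3] = f.coord 2 w ∧
    stdDualForm f.coord ![w, f 0, f 1, f 4] = -f.coord 5 w ∧
    stdDualForm f.coord ![w, f 0, f 1, f 5] = f.coord 4 w ∧
    stdDualForm f.coord ![w, f 0, f 1, f 6] = 0 ∧
    stdDualForm f.coord ![w, f 0, f 2, f 3] = -f.coord 1 w ∧
    stdDualForm f.coord ![w, f 0, f 2, f 4] = 0 ∧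
    stdDualForm f.coord ![w, f 0, f 2, f 5] = -f.coord 6 w ∧
    stdDualForm f.coord ![w, f 0, f 2, f 6] = f.coord 5 w ∧
    stdDualForm f.coord ![w, f 0, f 3, f 4] = -f.coord 6 w ∧
    stdDualForm f.coord ![w, f 0, f 3, f 5] = 0 ∧
    stdDualForm f.coord ![w, f 0, f 3, f 6] = f.coord 4 w ∧
    stdDualForm f.coord ![w, f 0, f 4, f 5] = -f.coord 1 w ∧
    stdDualForm f.coord ![w, f 0, f 4, f 6] = -f.coord 3 w ∧
    stdDualForm f.coord ![w, f 0, f 5, f 6] = -f.coord 2 w ∧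
    stdDualForm f.coord ![w, f 1, f 2, f 3] = f.coord 0 w ∧
    stdDualForm f.coord ![w, f 1, f 2, f 4] = -f.coord 6 w ∧
    stdDualForm f.coord ![w, f 1, f 2, f 5] = 0 ∧
    stdDualForm f.coord ![w, f 1, f 2, f 6] = f.coord 4 w ∧
    stdDualForm f.coord ![w, f 1, f 3, f 4] = 0 ∧
    stdDualForm f.coord ![w, f 1, f 3, f 5] = f.coord 6 w ∧
    stdDualForm f.coord ![w, f 1, f 3, f 6] = -f.coord 5 w ∧
    stdDualForm f.coord ![w, f 1, f 4, f 5] = f.coord 0 w ∧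
    stdDualForm f.coord ![w, f 1, f 4, f 6] = -f.coord 2 w ∧
    stdDualForm f.coord ![w, f 1, f 5, f 6] = f.coord 3 w ∧
    stdDualForm f.coord ![w, f 2, f 3, f 4] = -f.coord 5 w ∧
    stdDualForm f.coord ![w, f 2, f 3, f 5] = f.coord 4 w ∧
    stdDualForm f.coord ![w, f 2, f 3, f 6] = 0 ∧
    stdDualForm f.coord ![w, f 2, f 4, f 5] = -f.coord 3 w ∧
    stdDualForm f.coord ![w, f 2, f 4, f 6] = f.coord 1 w ∧
    stdDualForm f.coord ![w, f 2, f 5, f 6] = f.coord 0 w ∧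
    stdDualForm f.coord ![w, f 3, f 4, f 5] = f.coord 2 w ∧
    stdDualForm f.coord ![w, f 3, f 4, f 6] = f.coord 0 w ∧
    stdDualForm f.coord ![w, f 3, f 5, f 6] = -f.coord 1 w ∧
    stdDualForm f.coord ![w, f 4, f 5, f 6] = 0 := by
  refine ⟨?_, ?_, ?_, ?_, ?_, ?_, ?_, ?_, ?_, ?_, ?_, ?_, ?_, ?_, ?_, ?_, ?_, ?_,
    ?_, ?_, ?_, ?_, ?_, ?_, ?_, ?_, ?_, ?_, ?_, ?_, ?_, ?_, ?_, ?_, ?_⟩ <;>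
    simp [stdDualForm, covectorWedge_four_apply, covectorWedge_three_apply]

namespace G2Structure

variable {S : G2Structure V} {f : Basis (Fin 7) ℝ V}

theorem IsFrame.star_three_apply (hf : S.IsFrame f) (β : AltForm V 3) (v : Fin 7 → Fin 7)
    (hv : Function.Injective v) {c : ℤˣ} (hc : inversionSign v = c) :
    S.star (m := 4) rfl β ![f (v 3), f (v 4), f (v 5), f (v 6)] =
      ((c : ℤ) : ℝ) * β ![f (v 0), f (v 1), f (v 2)] := by
  obtain ⟨σ, hσ, hs⟩ := exists_perm_of_injective hv
  have h := hf.star_apply (k := 3) (m := 4) rfl β σ (hs.trans hc) ![v 0, v 1, v 2]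
    ![v 3, v 4, v 5, v 6] (fun s => by rw [hσ]; fin_cases s <;> rfl)
    (fun s => by rw [hσ]; fin_cases s <;> rfl)
  have h1 : f ∘ ![v 0, v 1, v 2] = ![f (v 0), f (v 1), f (v 2)] := by
    ext i
    fin_cases i <;> rfl
  have h2 : f ∘ ![v 3, v 4, v 5, v 6] = ![f (v 3), f (v 4), f (v 5), f (v 6)] := by
    ext i
    fin_cases i <;> rfl
  rwa [h1, h2] at h

theorem IsFrame.star_four_apply (hf : S.IsFrame f) (β : AltForm V 4) (v : Fin 7 → Fin 7)
    (hv : Function.Injective v) {c : ℤˣ} (hc : inversionSign v = c) :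
    S.star (m := 3) rfl β ![f (v 4), f (v 5), f (v 6)] =
      ((c : ℤ) : ℝ) * β ![f (v 0), f (v 1), f (v 2), f (v 3)] := by
  obtain ⟨σ, hσ, hs⟩ := exists_perm_of_injective hv
  have h := hf.star_apply (k := 4) (m := 3) rfl β σ (hs.trans hc) ![v 0, v 1, v 2, v 3]
    ![v 4, v 5, v 6] (fun s => by rw [hσ]; fin_cases s <;> rfl)
    (fun s => by rw [hσ]; fin_cases s <;> rfl)
  have h1 : f ∘ ![v 4, v 5, v 6] = ![f (v 4), f (v 5), f (v 6)] := by
    ext i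
    fin_cases i <;> rfl
  have h2 : f ∘ ![v 0, v 1, v 2, v 3] = ![f (v 0), f (v 1), f (v 2), f (v 3)] := by
    ext i
    fin_cases i <;> rfl
  rwa [h1, h2] at h

theorem IsFrame.star_seven_apply (hf : S.IsFrame f) (β : AltForm V 7) :
    S.star (m := 0) rfl β ![] = β f := by
  have h := hf.star_apply (k := 7) (m := 0) rfl β 1 Equiv.Perm.sign_one id ![]
    (fun s => rfl) (fun r => r.elim0)
  rw [show f ∘ ![] = ![] from Subsingleton.elim _ _] at h
  simpa using h

/-- The complement of four indices in increasing order, followed by these indices. -/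
def complementList (a b c d : Fin 7) : Fin 7 → Fin 7 := fun i =>
  ((List.finRange 7).filter (fun j => j ∉ [a, b, c, d]) ++ [a, b, c, d]).getD i 0

set_option maxHeartbeats 1000000 in
theorem IsFrame.ψ_eq (hf : S.IsFrame f) : S.ψ = stdDualForm f.coord := by
  refine AlternatingMap.ext_of_strictMono f fun K hK => ?_
  have h01 : K 0 < K 1 := hK (by decide)
  have h12 : K 1 < K 2 := hK (by decide)
  have h23 : K 2 < K 3 := hK (by decide)
  have hK4 : f ∘ K = ![f (K 0), f (K 1), f (K 2), f (K 3)] := by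
    ext i
    fin_cases i <;> rfl
  rw [hK4]
  generalize K 0 = a, K 1 = b, K 2 = c, K 3 = d at *
  clear hK4 hK K
  have key : ∀ (v : Fin 7 → Fin 7) (hv : Function.Injective v) (ε : ℤˣ)
      (_ : inversionSign v = ε) (_ : v 3 = a) (_ : v 4 = b) (_ : v 5 = c) (_ : v 6 = d),
      S.ψ ![f a, f b, f c, f d] = ((ε : ℤ) : ℝ) * stdForm f.coord ![f (v 0), f (v 1), f (v 2)] := by
    rintro v hv ε hε rfl rfl rfl rfl
    rw [← hf]
    exact hf.star_three_apply S.φ v hv hε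
  have key2 := key (complementList a b c d)
  clear key
  fin_cases a <;> fin_cases b <;> first | exact absurd h01 (by decide) | skip
  all_goals fin_cases c <;> first | exact absurd h12 (by decide) | skip
  all_goals fin_cases d <;> first | exact absurd h23 (by decide) | skip
  all_goals first
    | rw [key2 (by decide) 1 (by decide) rfl rfl rfl rfl]
    | rw [key2 (by decide) (-1) (by decide) rfl rfl rfl rfl]
  all_goals simp [complementList, List.finRange, stdForm_basis_apply, stdDualForm_basis_apply]

end G2Structure

end DualForm

/-! ### Components of the torsion and the condition `R ∧ ψ = 0` -/

namespace G2Structure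

variable {𝔤 : Type*} [LieRing 𝔤] [LieAlgebra ℝ 𝔤] {S : G2Structure 𝔤} {f : Basis (Fin 7) ℝ 𝔤}

/-- The coefficient `(1/6) ⋆(dφ ∧ φ)` of `φ` in the torsion form. -/
def torsionScalar (S : G2Structure 𝔤) : ℝ :=
  1 / 6 * S.star (m := 0) rfl (wedge (ceDiff S.φ) S.φ) ![]

theorem IsFrame.torsionScalar_eq (hf : S.IsFrame f) : S.torsionScalar =
    1 / 6 * (ceDiff S.φ ![f 0, f 1, f 2, f 3] + ceDiff S.φ ![f 0, f 1, f 4, f 5]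
      + ceDiff S.φ ![f 0, f 2, f 5, f 6] + ceDiff S.φ ![f 0, f 3, f 4, f 6]
      + ceDiff S.φ ![f 1, f 2, f 4, f 6] - ceDiff S.φ ![f 1, f 3, f 5, f 6]
      + ceDiff S.φ ![f 2, f 3, f 4, f 5]) := by
  have h := wedge_stdForm_apply f (ceDiff S.φ) f rfl
  rw [← hf] at h
  rw [torsionScalar, hf.star_seven_apply, ← h]

theorem IsFrame.torsion_apply (hf : S.IsFrame f) (v : Fin 7 → Fin 7)
    (hv : Function.Injective v) {c : ℤˣ} (hc : inversionSign v = c) :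
    S.torsion ![f (v 4), f (v 5), f (v 6)] =
      S.torsionScalar * S.φ ![f (v 4), f (v 5), f (v 6)]
        - ((c : ℤ) : ℝ) * ceDiff S.φ ![f (v 0), f (v 1), f (v 2), f (v 3)] := by
  rw [← hf.star_four_apply _ v hv hc]
  rfl

/-- The wedge product with a decomposable `4`-form in coordinates, evaluated on all basis vectors
except `f u`. -/
theorem wedge_coord_skip (f : Basis (Fin 7) ℝ 𝔤) {N : Type*} [AddCommGroup N] [Module ℝ N]
    (α : 𝔤 [⋀^Fin 2]→ₗ[ℝ] N) (w : Fin (2 + 4) → 𝔤) (u : Fin 7) (hw : w = f ∘ u.succAbove)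
    (p : Fin 6 → Fin 6) (hp : Function.Injective p) {c : ℤˣ} (hc : inversionSign p = c)
    {i j k l m n : Fin 7} (hi : u.succAbove (p 0) = i) (hj : u.succAbove (p 1) = j)
    (hk : u.succAbove (p 2) = k) (hl : u.succAbove (p 3) = l) (hm : u.succAbove (p 4) = m)
    (hn : u.succAbove (p 5) = n) :
    wedge α (covectorWedge ![f.coord k, f.coord l, f.coord m, f.coord n]) w =
      ((c : ℤ) : ℝ) • α ![f i, f j] := by
  obtain ⟨σ, hσ, hs⟩ := exists_perm_of_injective hp
  subst hi hj hk hl hm hn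
  have h := wedge_coord_apply (k := 2) (l := 4) f α w (fun s => u.succAbove (p (Fin.castAdd 4 s)))
    (fun r => u.succAbove (p (Fin.natAdd 2 r))) (ξ := ![f.coord (u.succAbove (p 2)),
      f.coord (u.succAbove (p 3)), f.coord (u.succAbove (p 4)), f.coord (u.succAbove (p 5))])
    (fun r => by fin_cases r <;> rfl) σ (hs.trans hc) (fun s => by rw [hw, hσ]; rfl)
    (fun s => by rw [hw, hσ]; rfl)
    (Fin.succAbove_right_injective.comp (hp.comp (Fin.natAdd_injective 4 2)))
    (fun s r h => by
      have := congrArg Fin.val (hp (Fin.succAbove_right_injective h))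
      simp at this
      omega)
  have h2 : (f ∘ fun s => u.succAbove (p (Fin.castAdd 4 s))) =
      ![f (u.succAbove (p 0)), f (u.succAbove (p 1))] := by
    ext i
    fin_cases i <;> rfl
  rw [h2] at h
  rw [h]

theorem wedge_coord_skip_eq_zero (f : Basis (Fin 7) ℝ 𝔤) {N : Type*} [AddCommGroup N]
    [Module ℝ N] (α : 𝔤 [⋀^Fin 2]→ₗ[ℝ] N) (w : Fin (2 + 4) → 𝔤) (u : Fin 7)
    (hw : w = f ∘ u.succAbove) (ξ : Fin 4 → Dual ℝ 𝔤) (r : Fin 4) (hr : ξ r = f.coord u) :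
    wedge α (covectorWedge ξ) w = 0 := by
  have h0 : wedge α (0 : AltForm 𝔤 4) w = 0 := by rw [wedge_zero]; rfl
  rw [← h0]
  refine wedge_apply_congr α w fun g _ => ?_
  rw [covectorWedge_apply]
  refine Matrix.det_eq_zero_of_column_eq_zero r fun s => ?_
  rw [Matrix.of_apply, hr, hw]
  simp only [Function.comp_apply]
  rw [Basis.coord_self_apply, if_neg (Fin.succAbove_ne u _)]

/-- A vector-valued `2`-form wedges to zero with `ψ` if and only if its contractions with
all `u ⌟ φ` vanish. -/
theorem wedge_stdDualForm_eq_zero_iff (f : Basis (Fin 7) ℝ 𝔤) {N : Type*} [AddCommGroup N]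
    [Module ℝ N] (α : 𝔤 [⋀^Fin 2]→ₗ[ℝ] N) :
    wedge α (stdDualForm f.coord) = 0 ↔
      (α ![f 1, f 6] + α ![f 2, f 4] - α ![f 3, f 5] = 0 ∧
      α ![f 0, f 6] + α ![f 2, f 5] + α ![f 3, f 4] = 0 ∧
      α ![f 3, f 6] - α ![f 0, f 4] + α ![f 1, f 5] = 0 ∧
      α ![f 0, f 5] - α ![f 2, f 6] + α ![f 1, f 4] = 0 ∧
      α ![f 5, f 6] + α ![f 0, f 2] - α ![f 1, f 3] = 0 ∧
      α ![f 4, f 6] + α ![f 0, f 3] + α ![f 1, f 2] = 0 ∧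
      α ![f 0, f 1] + α ![f 2, f 3] + α ![f 4, f 5] = 0) := by
  have skip0 : ∀ (u : Fin 7) (w : Fin (2 + 4) → 𝔤) (_ : w = f ∘ u.succAbove) (i j k l : Fin 7)
      (_ : i = u ∨ j = u ∨ k = u ∨ l = u),
      wedge α (covectorWedge ![f.coord i, f.coord j, f.coord k, f.coord l]) w = 0 := by
    intro u w hw i j k l h
    have hz := wedge_coord_skip_eq_zero f α w u hw
      ![f.coord i, f.coord j, f.coord k, f.coord l]
    rcases h with rfl | rfl | rfl | rfl
    · rw [hz 0 rfl]
    · rw [hz 1 rfl]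
    · rw [hz 2 rfl]
    · rw [hz 3 rfl]
  have skip : ∀ {u : Fin 7} (w : Fin (2 + 4) → 𝔤) (_ : w = f ∘ u.succAbove)
      (p : Fin 6 → Fin 6) (c : ℤˣ) {v : Fin 6 → Fin 7}
      (_ : Function.Injective p ∧ inversionSign p = c ∧ ∀ q, u.succAbove (p q) = v q),
      wedge α (covectorWedge ![f.coord (v 2), f.coord (v 3), f.coord (v 4), f.coord (v 5)]) w =
        ((c : ℤ) : ℝ) • α ![f (v 0), f (v 1)] := by
    rintro u w hw p c v ⟨hp, hc, h⟩
    rw [wedge_coord_skip f α w u hw p hp hc (h 0) (h 1) (h 2) (h 3) (h 4) (h 5)]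
  have key : ∀ w : Fin (2 + 4) → 𝔤, wedge α (stdDualForm f.coord) w =
      wedge α (covectorWedge ![f.coord 0, f.coord 1, f.coord 2, f.coord 3]) w
      + wedge α (covectorWedge ![f.coord 0, f.coord 1, f.coord 4, f.coord 5]) w
      + wedge α (covectorWedge ![f.coord 0, f.coord 2, f.coord 5, f.coord 6]) w
      + wedge α (covectorWedge ![f.coord 0, f.coord 3, f.coord 4, f.coord 6]) w
      + wedge α (covectorWedge ![f.coord 1, f.coord 2, f.coord 4, f.coord 6]) w
      - wedge α (covectorWedge ![f.coord 1, f.coord 3, f.coord 5, f.coord 6]) w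
      + wedge α (covectorWedge ![f.coord 2, f.coord 3, f.coord 4, f.coord 5]) w := by
    intro w
    simp only [stdDualForm, wedge_add, wedge_sub, AlternatingMap.add_apply,
      AlternatingMap.sub_apply]
  have val0 : ∀ w : Fin (2 + 4) → 𝔤, w = f ∘ (0 : Fin 7).succAbove →
      wedge α (stdDualForm f.coord) w =
        α ![f 1, f 6] + α ![f 2, f 4] - α ![f 3, f 5] := by
    intro w hw
    have h1 := skip w hw ![2, 4, 0, 1, 3, 5] (-1) (v := ![3, 5, 1, 2, 4, 6]) (by decide)
    have h2 := skip w hw ![1, 3, 0, 2, 4, 5] (-1) (v := ![2, 4, 1, 3, 5, 6]) (by decide)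
    have h3 := skip w hw ![0, 5, 1, 2, 3, 4] 1 (v := ![1, 6, 2, 3, 4, 5]) (by decide)
    simp at h1 h2 h3
    simp [key, h1, h2, h3, skip0 0 w hw]
    try abel
  have val1 : ∀ w : Fin (2 + 4) → 𝔤, w = f ∘ (1 : Fin 7).succAbove →
      wedge α (stdDualForm f.coord) w =
        α ![f 0, f 6] + α ![f 2, f 5] + α ![f 3, f 4] := by
    intro w hw
    have h1 := skip w hw ![2, 3, 0, 1, 4, 5] 1 (v := ![3, 4, 0, 2, 5, 6]) (by decide)
    have h2 := skip w hw ![1, 4, 0, 2, 3, 5] 1 (v := ![2, 5, 0, 3, 4, 6]) (by decide)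
    have h3 := skip w hw ![0, 5, 1, 2, 3, 4] 1 (v := ![0, 6, 2, 3, 4, 5]) (by decide)
    simp at h1 h2 h3
    simp [key, h1, h2, h3, skip0 1 w hw]
    try abel
  have val2 : ∀ w : Fin (2 + 4) → 𝔤, w = f ∘ (2 : Fin 7).succAbove →
      wedge α (stdDualForm f.coord) w =
        α ![f 3, f 6] - α ![f 0, f 4] + α ![f 1, f 5] := by
    intro w hw
    have h1 := skip w hw ![2, 5, 0, 1, 3, 4] 1 (v := ![3, 6, 0, 1, 4, 5]) (by decide)
    have h2 := skip w hw ![1, 4, 0, 2, 3, 5] 1 (v := ![1, 5, 0, 3, 4, 6]) (by decide)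
    have h3 := skip w hw ![0, 3, 1, 2, 4, 5] 1 (v := ![0, 4, 1, 3, 5, 6]) (by decide)
    simp at h1 h2 h3
    simp [key, h1, h2, h3, skip0 2 w hw]
    try abel
  have val3 : ∀ w : Fin (2 + 4) → 𝔤, w = f ∘ (3 : Fin 7).succAbove →
      wedge α (stdDualForm f.coord) w =
        -(α ![f 0, f 5] - α ![f 2, f 6] + α ![f 1, f 4]) := by
    intro w hw
    have h1 := skip w hw ![2, 5, 0, 1, 3, 4] 1 (v := ![2, 6, 0, 1, 4, 5]) (by decide)
    have h2 := skip w hw ![1, 3, 0, 2, 4, 5] (-1) (v := ![1, 4, 0, 2, 5, 6]) (by decide)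
    have h3 := skip w hw ![0, 4, 1, 2, 3, 5] (-1) (v := ![0, 5, 1, 2, 4, 6]) (by decide)
    simp at h1 h2 h3
    simp [key, h1, h2, h3, skip0 3 w hw]
    try abel
  have val4 : ∀ w : Fin (2 + 4) → 𝔤, w = f ∘ (4 : Fin 7).succAbove →
      wedge α (stdDualForm f.coord) w =
        α ![f 5, f 6] + α ![f 0, f 2] - α ![f 1, f 3] := by
    intro w hw
    have h1 := skip w hw ![4, 5, 0, 1, 2, 3] 1 (v := ![5, 6, 0, 1, 2, 3]) (by decide)
    have h2 := skip w hw ![1, 3, 0, 2, 4, 5] (-1) (v := ![1, 3, 0, 2, 5, 6]) (by decide)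
    have h3 := skip w hw ![0, 2, 1, 3, 4, 5] (-1) (v := ![0, 2, 1, 3, 5, 6]) (by decide)
    simp at h1 h2 h3
    simp [key, h1, h2, h3, skip0 4 w hw]
    try abel
  have val5 : ∀ w : Fin (2 + 4) → 𝔤, w = f ∘ (5 : Fin 7).succAbove →
      wedge α (stdDualForm f.coord) w =
        α ![f 4, f 6] + α ![f 0, f 3] + α ![f 1, f 2] := by
    intro w hw
    have h1 := skip w hw ![4, 5, 0, 1, 2, 3] 1 (v := ![4, 6, 0, 1, 2, 3]) (by decide)
    have h2 := skip w hw ![1, 2, 0, 3, 4, 5] 1 (v := ![1, 2, 0, 3, 4, 6]) (by decide)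
    have h3 := skip w hw ![0, 3, 1, 2, 4, 5] 1 (v := ![0, 3, 1, 2, 4, 6]) (by decide)
    simp at h1 h2 h3
    simp [key, h1, h2, h3, skip0 5 w hw]
    try abel
  have val6 : ∀ w : Fin (2 + 4) → 𝔤, w = f ∘ (6 : Fin 7).succAbove →
      wedge α (stdDualForm f.coord) w =
        α ![f 0, f 1] + α ![f 2, f 3] + α ![f 4, f 5] := by
    intro w hw
    have h1 := skip w hw ![4, 5, 0, 1, 2, 3] 1 (v := ![4, 5, 0, 1, 2, 3]) (by decide)
    have h2 := skip w hw ![2, 3, 0, 1, 4, 5] 1 (v := ![2, 3, 0, 1, 4, 5]) (by decide)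
    have h3 := skip w hw ![0, 1, 2, 3, 4, 5] 1 (v := ![0, 1, 2, 3, 4, 5]) (by decide)
    simp at h1 h2 h3
    simp [key, h1, h2, h3, skip0 6 w hw]
    try abel
  constructor
  · intro h
    rw [h] at val0 val1 val2 val3 val4 val5 val6
    refine ⟨(val0 _ rfl).symm, (val1 _ rfl).symm, (val2 _ rfl).symm, ?_, (val4 _ rfl).symm,
      (val5 _ rfl).symm, (val6 _ rfl).symm⟩
    exact neg_eq_zero.mp (val3 _ rfl).symm
  · rintro ⟨h0, h1, h2, h3, h4, h5, h6⟩
    refine AlternatingMap.ext_of_strictMono f fun K hK => ?_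
    -- an increasing family of six indices omits exactly one index `u`
    obtain ⟨u, hKu⟩ : ∃ u : Fin 7, K = u.succAbove := by
      obtain ⟨u, hu⟩ : ∃ u, u ∉ Set.range K := by
        by_contra hcon
        push Not at hcon
        simpa using Fintype.card_le_of_surjective K hcon
      refine ⟨u, (StrictMono.range_inj hK (Fin.strictMono_succAbove u)).mp ?_⟩
      rw [Fin.range_succAbove]
      refine Set.eq_of_subset_of_ncard_le (fun x hx hxu => hu (hxu ▸ hx)) ?_
      rw [Set.ncard_compl, ← Set.image_univ, Set.ncard_image_of_injective _ hK.injective]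
      simp
    rw [AlternatingMap.zero_apply]
    have hu : u = 0 ∨ u = 1 ∨ u = 2 ∨ u = 3 ∨ u = 4 ∨ u = 5 ∨ u = 6 := by
      fin_cases u <;> simp
    rcases hu with rfl | rfl | rfl | rfl | rfl | rfl | rfl
    · rw [val0 _ (by rw [hKu]), h0]
    · rw [val1 _ (by rw [hKu]), h1]
    · rw [val2 _ (by rw [hKu]), h2]
    · rw [val3 _ (by rw [hKu]), h3, neg_zero]
    · rw [val4 _ (by rw [hKu]), h4]
    · rw [val5 _ (by rw [hKu]), h5]
    · rw [val6 _ (by rw [hKu]), h6]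

end G2Structure

/-! ### Torsion, connection and curvature in terms of structure constants -/

/-- The linear relations expressing the components `t` of the torsion form of a `G₂`-structure in a
`G₂`-frame through the structure constants `c i j k = eᵏ([eᵢ, eⱼ])`; the number `κ` is the
coefficient `(1/6) ⋆(dφ ∧ φ)`. -/
structure TorsionRelations (c t : Fin 7 → Fin 7 → Fin 7 → ℝ) (κ : ℝ) : Prop where
  swap_left : ∀ i j k, t i j k = -t j i k
  swap_right : ∀ i j k, t i j k = -t i k j
  scalar : κ = 1 / 3 * (c 0 6 1 - c 1 6 0 - c 2 4 0 + c 3 5 0 + c 2 5 1 + c 3 4 1 + c 0 4 2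
    - c 1 5 2 - c 3 6 2 - c 0 5 3 - c 1 4 3 + c 2 6 3 - c 0 2 4 + c 1 3 4 - c 5 6 4 + c 0 3 5
    + c 1 2 5 + c 4 6 5 - c 0 1 6 - c 2 3 6 - c 4 5 6)
  t012 : t 0 1 2 = c 3 4 4 + c 3 5 5 + c 3 6 6 + c 4 5 2 + c 4 6 0 - c 5 6 1
  t013 : t 0 1 3 = -c 2 4 4 - c 2 5 5 - c 2 6 6 + c 4 5 3 - c 4 6 1 - c 5 6 0
  t014 : t 0 1 4 = c 2 3 4 - c 2 5 2 - c 2 6 0 - c 3 5 3 + c 3 6 1 + c 5 6 6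
  t015 : t 0 1 5 = c 2 3 5 + c 2 4 2 + c 2 6 1 + c 3 4 3 + c 3 6 0 - c 4 6 6
  t016 : t 0 1 6 = κ + c 2 3 6 + c 2 4 0 - c 2 5 1 - c 3 4 1 - c 3 5 0 + c 4 5 6
  t023 : t 0 2 3 = c 1 4 4 + c 1 5 5 + c 1 6 6 + c 4 5 0 - c 4 6 2 + c 5 6 3
  t024 : t 0 2 4 = κ - c 1 3 4 + c 1 5 2 + c 1 6 0 - c 3 5 0 + c 3 6 2 + c 5 6 4
  t025 : t 0 2 5 = -c 1 3 5 - c 1 4 2 - c 1 6 1 + c 3 4 0 - c 3 6 3 - c 4 6 4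
  t026 : t 0 2 6 = -c 1 3 6 - c 1 4 0 + c 1 5 1 - c 3 4 2 + c 3 5 3 + c 4 5 4
  t034 : t 0 3 4 = c 1 2 4 + c 1 5 3 - c 1 6 1 + c 2 5 0 - c 2 6 2 - c 5 6 5
  t035 : t 0 3 5 = -κ + c 1 2 5 - c 1 4 3 - c 1 6 0 - c 2 4 0 + c 2 6 3 + c 4 6 5
  t036 : t 0 3 6 = c 1 2 6 + c 1 4 1 + c 1 5 0 + c 2 4 2 - c 2 5 3 - c 4 5 5
  t045 : t 0 4 5 = c 1 2 2 + c 1 3 3 + c 1 6 6 + c 2 3 0 + c 2 6 4 - c 3 6 5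
  t046 : t 0 4 6 = c 1 2 0 - c 1 3 1 - c 1 5 6 - c 2 3 2 - c 2 5 4 + c 3 5 5
  t056 : t 0 5 6 = -c 1 2 1 - c 1 3 0 + c 1 4 6 + c 2 3 3 + c 2 4 4 - c 3 4 5
  t123 : t 1 2 3 = -c 0 4 4 - c 0 5 5 - c 0 6 6 + c 4 5 1 + c 4 6 3 + c 5 6 2
  t124 : t 1 2 4 = c 0 3 4 - c 0 5 2 - c 0 6 0 - c 3 5 1 - c 3 6 3 - c 5 6 5
  t125 : t 1 2 5 = -κ + c 0 3 5 + c 0 4 2 + c 0 6 1 + c 3 4 1 - c 3 6 2 + c 4 6 5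
  t126 : t 1 2 6 = c 0 3 6 + c 0 4 0 - c 0 5 1 + c 3 4 3 + c 3 5 2 - c 4 5 5
  t134 : t 1 3 4 = -κ - c 0 2 4 - c 0 5 3 + c 0 6 1 + c 2 5 1 + c 2 6 3 - c 5 6 4
  t135 : t 1 3 5 = -c 0 2 5 + c 0 4 3 + c 0 6 0 - c 2 4 1 + c 2 6 2 + c 4 6 4
  t136 : t 1 3 6 = -c 0 2 6 - c 0 4 1 - c 0 5 0 - c 2 4 3 - c 2 5 2 - c 4 5 4
  t145 : t 1 4 5 = -c 0 2 2 - c 0 3 3 - c 0 6 6 + c 2 3 1 - c 2 6 5 - c 3 6 4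
  t146 : t 1 4 6 = -c 0 2 0 + c 0 3 1 + c 0 5 6 + c 2 3 3 + c 2 5 5 + c 3 5 4
  t156 : t 1 5 6 = c 0 2 1 + c 0 3 0 - c 0 4 6 + c 2 3 2 - c 2 4 5 - c 3 4 4
  t234 : t 2 3 4 = c 0 1 4 - c 0 5 0 + c 0 6 2 - c 1 5 1 - c 1 6 3 + c 5 6 6
  t235 : t 2 3 5 = c 0 1 5 + c 0 4 0 - c 0 6 3 + c 1 4 1 - c 1 6 2 - c 4 6 6
  t236 : t 2 3 6 = κ + c 0 1 6 - c 0 4 2 + c 0 5 3 + c 1 4 3 + c 1 5 2 + c 4 5 6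
  t245 : t 2 4 5 = c 0 1 2 - c 0 3 0 - c 0 6 4 - c 1 3 1 + c 1 6 5 + c 3 6 6
  t246 : t 2 4 6 = c 0 1 0 + c 0 3 2 + c 0 5 4 - c 1 3 3 - c 1 5 5 - c 3 5 6
  t256 : t 2 5 6 = -c 0 1 1 - c 0 3 3 - c 0 4 4 - c 1 3 2 + c 1 4 5 + c 3 4 6
  t345 : t 3 4 5 = c 0 1 3 + c 0 2 0 + c 0 6 5 + c 1 2 1 + c 1 6 4 - c 2 6 6
  t346 : t 3 4 6 = -c 0 1 1 - c 0 2 2 - c 0 5 5 + c 1 2 3 - c 1 5 4 + c 2 5 6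
  t356 : t 3 5 6 = -c 0 1 0 + c 0 2 3 + c 0 4 5 + c 1 2 2 + c 1 4 4 - c 2 4 6
  t456 : t 4 5 6 = κ + c 0 1 6 + c 0 2 4 - c 0 3 5 - c 1 2 5 - c 1 3 4 + c 2 3 6

/-- The components `g(∇¹_{f_i} f_j, f_k)` of the connection in an orthonormal frame. -/
def connCoeff (c t : Fin 7 → Fin 7 → Fin 7 → ℝ) (i j k : Fin 7) : ℝ :=
  1 / 2 * (c i j k + c k i j + c k j i) + 1 / 2 * t i j k

/-- The components `g(R(f_i, f_j) f_k, f_l)` of the curvature of `∇¹` in an orthonormal frame. -/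
def curvCoeff (c t : Fin 7 → Fin 7 → Fin 7 → ℝ) (i j k l : Fin 7) : ℝ :=
  ∑ m, (connCoeff c t j k m * connCoeff c t i m l - connCoeff c t i k m * connCoeff c t j m l
    - c i j m * connCoeff c t m k l)

/-- The `G₂`-instanton equations in terms of the components of the curvature: the contraction
of `R` with each of the seven forms `u ⌟ φ` vanishes. -/
def InstantonEquations (R : Fin 7 → Fin 7 → Fin 7 → Fin 7 → ℝ) : Prop :=
  ∀ k l, R 1 6 k l + R 2 4 k l - R 3 5 k l = 0 ∧ R 0 6 k l + R 2 5 k l + R 3 4 k l = 0 ∧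
    R 3 6 k l - R 0 4 k l + R 1 5 k l = 0 ∧ R 0 5 k l - R 2 6 k l + R 1 4 k l = 0 ∧
    R 5 6 k l + R 0 2 k l - R 1 3 k l = 0 ∧ R 4 6 k l + R 0 3 k l + R 1 2 k l = 0 ∧
    R 0 1 k l + R 2 3 k l + R 4 5 k l = 0

namespace G2Structure

variable {𝔤 : Type*} [LieRing 𝔤] [LieAlgebra ℝ 𝔤] {S : G2Structure 𝔤} {f : Basis (Fin 7) ℝ 𝔤}

/-- The structure constants of a Lie algebra in a basis. -/
def structConst (f : Basis (Fin 7) ℝ 𝔤) (i j k : Fin 7) : ℝ := f.coord k ⁅f i, f j⁆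

set_option maxHeartbeats 2000000 in
theorem IsFrame.torsionRelations (hf : S.IsFrame f) :
    TorsionRelations (structConst f) (fun i j k => S.torsion ![f i, f j, f k])
      S.torsionScalar := by
  have h1 : ∀ i j k, S.torsion ![f i, f j, f k] = -S.torsion ![f j, f i, f k] := fun i j k => by
    have := S.torsion.map_swap ![f j, f i, f k] (i := 0) (j := 1) (by decide)
    rw [← this]
    congr 1
    ext i
    fin_cases i <;> rfl
  have h2 : ∀ i j k, S.torsion ![f i, f j, f k] = -S.torsion ![f i, f k, f j] := fun i j k => by
    have := S.torsion.map_swap ![f i, f k, f j] (i := 1) (j := 2) (by decide)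
    rw [← this]
    congr 1
    ext i
    fin_cases i <;> rfl
  have hd : ∀ a b p q, ceDiff S.φ ![f a, f b, f p, f q] = _ := fun a b p q => by
    rw [hf, ceDiff_three_apply]
  have key : ∀ (a b p q i j k : Fin 7) (ε : ℤˣ)
      (_ : Function.Injective ![a, b, p, q, i, j, k] ∧ inversionSign ![a, b, p, q, i, j, k] = ε),
      S.torsion ![f i, f j, f k] = S.torsionScalar * stdForm f.coord ![f i, f j, f k]
        - ((ε : ℤ) : ℝ) * ceDiff S.φ ![f a, f b, f p, f q] := fun a b p q i j k ε h => by
    rw [← show S.φ = stdForm f.coord from hf]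
    exact hf.torsion_apply ![a, b, p, q, i, j, k] h.1 h.2
  have hc : ∀ i j l, f.coord l ⁅f i, f j⁆ = structConst f i j l := fun _ _ _ => rfl
  refine ⟨h1, h2, ?_,
    (key 3 4 5 6 0 1 2 1 (by decide)).trans ?_,
    (key 2 4 5 6 0 1 3 (-1) (by decide)).trans ?_,
    (key 2 3 5 6 0 1 4 1 (by decide)).trans ?_,
    (key 2 3 4 6 0 1 5 (-1) (by decide)).trans ?_,
    (key 2 3 4 5 0 1 6 1 (by decide)).trans ?_,
    (key 1 4 5 6 0 2 3 1 (by decide)).trans ?_,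
    (key 1 3 5 6 0 2 4 (-1) (by decide)).trans ?_,
    (key 1 3 4 6 0 2 5 1 (by decide)).trans ?_,
    (key 1 3 4 5 0 2 6 (-1) (by decide)).trans ?_,
    (key 1 2 5 6 0 3 4 1 (by decide)).trans ?_,
    (key 1 2 4 6 0 3 5 (-1) (by decide)).trans ?_,
    (key 1 2 4 5 0 3 6 1 (by decide)).trans ?_,
    (key 1 2 3 6 0 4 5 1 (by decide)).trans ?_,
    (key 1 2 3 5 0 4 6 (-1) (by decide)).trans ?_,
    (key 1 2 3 4 0 5 6 1 (by decide)).trans ?_,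
    (key 0 4 5 6 1 2 3 (-1) (by decide)).trans ?_,
    (key 0 3 5 6 1 2 4 1 (by decide)).trans ?_,
    (key 0 3 4 6 1 2 5 (-1) (by decide)).trans ?_,
    (key 0 3 4 5 1 2 6 1 (by decide)).trans ?_,
    (key 0 2 5 6 1 3 4 (-1) (by decide)).trans ?_,
    (key 0 2 4 6 1 3 5 1 (by decide)).trans ?_,
    (key 0 2 4 5 1 3 6 (-1) (by decide)).trans ?_,
    (key 0 2 3 6 1 4 5 (-1) (by decide)).trans ?_,
    (key 0 2 3 5 1 4 6 1 (by decide)).trans ?_,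
    (key 0 2 3 4 1 5 6 (-1) (by decide)).trans ?_,
    (key 0 1 5 6 2 3 4 1 (by decide)).trans ?_,
    (key 0 1 4 6 2 3 5 (-1) (by decide)).trans ?_,
    (key 0 1 4 5 2 3 6 1 (by decide)).trans ?_,
    (key 0 1 3 6 2 4 5 1 (by decide)).trans ?_,
    (key 0 1 3 5 2 4 6 (-1) (by decide)).trans ?_,
    (key 0 1 3 4 2 5 6 1 (by decide)).trans ?_,
    (key 0 1 2 6 3 4 5 (-1) (by decide)).trans ?_,
    (key 0 1 2 5 3 4 6 1 (by decide)).trans ?_,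
    (key 0 1 2 4 3 5 6 (-1) (by decide)).trans ?_,
    (key 0 1 2 3 4 5 6 1 (by decide)).trans ?_⟩
  · rw [hf.torsionScalar_eq, hd, hd, hd, hd, hd, hd, hd]
    simp only [stdForm_basis_apply, hc]
    ring
  all_goals
    simp only [hd, stdForm_basis_apply, hc, Basis.coord_self_apply]
    simp
    try ring

theorem IsFrame.coord_connection (hf : S.IsFrame f) (i j k : Fin 7) :
    f.coord k (S.connection 1 (f i) (f j)) =
      connCoeff (structConst f) (fun i j k => S.torsion ![f i, f j, f k]) i j k := by
  rw [← hf.metric_right, metric_connection]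
  simp only [hf.metric_right]
  rfl

theorem IsFrame.coord_curvature (hf : S.IsFrame f) (i j k l : Fin 7) :
    f.coord l (curvature (S.connection 1) ![f i, f j] (f k)) =
      curvCoeff (structConst f) (fun i j k => S.torsion ![f i, f j, f k]) i j k l := by
  have h : ∀ (A : Module.End ℝ 𝔤) (x : 𝔤), f.coord l (A x) =
      ∑ m, f.coord m x * f.coord l (A (f m)) := fun A x => by
    conv_lhs => rw [← f.sum_repr x, map_sum, map_sum]
    simp only [map_smul, smul_eq_mul, Basis.coord_apply]
  have h' : ∀ x : 𝔤, f.coord l (S.connection 1 x (f k)) =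
      ∑ m, f.coord m x * f.coord l (S.connection 1 (f m) (f k)) := fun x => by
    conv_lhs => rw [← f.sum_repr x, map_sum, LinearMap.sum_apply, map_sum]
    simp only [map_smul, LinearMap.smul_apply, smul_eq_mul, Basis.coord_apply]
  have h0 : curvature (S.connection 1) ![f i, f j] (f k) =
      S.connection 1 (f i) (S.connection 1 (f j) (f k))
        - S.connection 1 (f j) (S.connection 1 (f i) (f k)) - S.connection 1 ⁅f i, f j⁆ (f k) := rfl
  rw [h0, map_sub, map_sub, h, h, h', curvCoeff, ← Finset.sum_sub_distrib,
    ← Finset.sum_sub_distrib]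
  simp only [hf.coord_connection]
  rfl

theorem IsFrame.isInstanton_iff (hf : S.IsFrame f) : S.IsInstanton (S.connection 1) ↔
    InstantonEquations
      (curvCoeff (structConst f) (fun i j k => S.torsion ![f i, f j, f k])) := by
  have h : ∀ A : Module.End ℝ 𝔤, A = 0 ↔ ∀ k l, f.coord l (A (f k)) = 0 := by
    refine fun A => ⟨fun h => by simp [h], fun h => f.ext fun k => f.ext_elem fun l => ?_⟩
    simpa using h k l
  rw [IsInstanton, hf.ψ_eq, wedge_stdDualForm_eq_zero_iff]
  simp only [h, LinearMap.add_apply, LinearMap.sub_apply, map_add, map_sub, hf.coord_curvature]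
  simp only [InstantonEquations, forall_and]

end G2Structure

/-! ### Coclosedness in terms of structure constants -/

/-- The relations between the structure constants of a Lie algebra in a `G₂`-frame that express
`dψ = 0`. -/
structure CoclosedRelations (c : Fin 7 → Fin 7 → Fin 7 → ℝ) : Prop where
  d01234 : c 0 1 5 + c 0 3 6 + c 0 4 0 + c 1 2 6 + c 1 4 1 + c 2 3 5 + c 2 4 2 + c 3 4 3 = 0
  d01235 : -c 0 1 4 + c 0 2 6 + c 0 5 0 - c 1 3 6 + c 1 5 1 - c 2 3 4 + c 2 5 2 + c 3 5 3 = 0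
  d01236 : -c 0 2 5 - c 0 3 4 + c 0 6 0 - c 1 2 4 + c 1 3 5 + c 1 6 1 + c 2 6 2 + c 3 6 3 = 0
  d01245 : c 0 1 3 + c 0 2 0 - c 0 5 6 + c 1 2 1 - c 1 4 6 - c 2 4 4 - c 2 5 5 + c 4 5 3 = 0
  d01246 : -c 0 1 1 - c 0 2 2 - c 0 4 4 - c 0 6 6 + c 1 2 3 + c 1 4 5 - c 2 6 5 + c 4 6 3 = 0
  d01256 : -c 0 1 0 + c 0 2 3 - c 0 5 4 + c 1 2 2 + c 1 5 5 + c 1 6 6 + c 2 6 4 + c 5 6 3 = 0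
  d01345 : -c 0 1 2 + c 0 3 0 - c 0 4 6 + c 1 3 1 + c 1 5 6 - c 3 4 4 - c 3 5 5 - c 4 5 2 = 0
  d01346 : -c 0 1 0 - c 0 3 2 + c 0 4 5 + c 1 3 3 + c 1 4 4 + c 1 6 6 - c 3 6 5 - c 4 6 2 = 0
  d01356 : c 0 1 1 + c 0 3 3 + c 0 5 5 + c 0 6 6 + c 1 3 2 + c 1 5 4 + c 3 6 4 - c 5 6 2 = 0
  d01456 : c 0 4 3 + c 0 5 2 + c 0 6 0 + c 1 4 2 - c 1 5 3 + c 1 6 1 + c 4 6 4 + c 5 6 5 = 0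
  d02345 : -c 0 2 2 - c 0 3 3 - c 0 4 4 - c 0 5 5 + c 2 3 1 + c 2 5 6 + c 3 4 6 + c 4 5 1 = 0
  d02346 : -c 0 2 0 + c 0 3 1 - c 0 6 5 + c 2 3 3 + c 2 4 4 + c 2 6 6 - c 3 4 5 + c 4 6 1 = 0
  d02356 : c 0 2 1 + c 0 3 0 + c 0 6 4 + c 2 3 2 + c 2 5 4 - c 3 5 5 - c 3 6 6 + c 5 6 1 = 0
  d02456 : c 0 4 0 - c 0 5 1 - c 0 6 3 + c 2 4 2 - c 2 5 3 + c 2 6 1 - c 4 5 5 - c 4 6 6 = 0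
  d03456 : -c 0 4 1 - c 0 5 0 + c 0 6 2 + c 3 4 2 - c 3 5 3 + c 3 6 1 - c 4 5 4 + c 5 6 6 = 0
  d12345 : -c 1 2 2 - c 1 3 3 - c 1 4 4 - c 1 5 5 - c 2 3 0 + c 2 4 6 - c 3 5 6 - c 4 5 0 = 0
  d12346 : -c 1 2 0 + c 1 3 1 - c 1 6 5 + c 2 3 2 - c 2 4 5 - c 3 4 4 - c 3 6 6 - c 4 6 0 = 0
  d12356 : c 1 2 1 + c 1 3 0 + c 1 6 4 - c 2 3 3 - c 2 5 5 - c 2 6 6 - c 3 5 4 - c 5 6 0 = 0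
  d12456 : c 1 4 0 - c 1 5 1 - c 1 6 3 - c 2 4 3 - c 2 5 2 - c 2 6 0 - c 4 5 4 + c 5 6 6 = 0
  d13456 : -c 1 4 1 - c 1 5 0 + c 1 6 2 - c 3 4 3 - c 3 5 2 - c 3 6 0 + c 4 5 5 + c 4 6 6 = 0
  d23456 : -c 2 4 1 - c 2 5 0 + c 2 6 2 - c 3 4 0 + c 3 5 1 + c 3 6 3 + c 4 6 4 + c 5 6 5 = 0

namespace G2Structure

variable {𝔤 : Type*} [LieRing 𝔤] [LieAlgebra ℝ 𝔤] {S : G2Structure 𝔤} {f : Basis (Fin 7) ℝ 𝔤}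

set_option maxHeartbeats 2000000 in
theorem IsFrame.isCoclosed_iff (hf : S.IsFrame f) :
    S.IsCoclosed ↔ CoclosedRelations (structConst f) := by
  rw [IsCoclosed, hf.ψ_eq]
  obtain ⟨D, hD⟩ : ∃ D : Fin 7 → Fin 7 → Fin 7 → Fin 7 → Fin 7 → ℝ, ∀ a b p q r, D a b p q r =
      ceDiff (stdDualForm f.coord) ![f a, f b, f p, f q, f r] := ⟨_, fun _ _ _ _ _ => rfl⟩
  obtain ⟨k, hk⟩ : ∃ k, k = structConst f := ⟨_, rfl⟩
  have hc : ∀ i j l, f.coord l ⁅f i, f j⁆ = k i j l := fun i j l => by rw [hk, structConst]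
  rw [← hk]
  have val01234 : D 0 1 2 3 4 = k 0 1 5 + k 0 3 6 + k 0 4 0 + k 1 2 6 + k 1 4 1 + k 2 3 5 + k 2 4 2
      + k 3 4 3 := by
    simp only [hD, ceDiff_four_apply, stdDualForm_basis_apply, hc]
    ring
  have val01235 : D 0 1 2 3 5 = -k 0 1 4 + k 0 2 6 + k 0 5 0 - k 1 3 6 + k 1 5 1 - k 2 3 4 + k 2 5 2
      + k 3 5 3 := by
    simp only [hD, ceDiff_four_apply, stdDualForm_basis_apply, hc]
    ring
  have val01236 : D 0 1 2 3 6 = -k 0 2 5 - k 0 3 4 + k 0 6 0 - k 1 2 4 + k 1 3 5 + k 1 6 1 + k 2 6 2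
      + k 3 6 3 := by
    simp only [hD, ceDiff_four_apply, stdDualForm_basis_apply, hc]
    ring
  have val01245 : D 0 1 2 4 5 = k 0 1 3 + k 0 2 0 - k 0 5 6 + k 1 2 1 - k 1 4 6 - k 2 4 4 - k 2 5 5
      + k 4 5 3 := by
    simp only [hD, ceDiff_four_apply, stdDualForm_basis_apply, hc]
    ring
  have val01246 : D 0 1 2 4 6 = -k 0 1 1 - k 0 2 2 - k 0 4 4 - k 0 6 6 + k 1 2 3 + k 1 4 5 - k 2 6 5
      + k 4 6 3 := by
    simp only [hD, ceDiff_four_apply, stdDualForm_basis_apply, hc]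
    ring
  have val01256 : D 0 1 2 5 6 = -k 0 1 0 + k 0 2 3 - k 0 5 4 + k 1 2 2 + k 1 5 5 + k 1 6 6 + k 2 6 4
      + k 5 6 3 := by
    simp only [hD, ceDiff_four_apply, stdDualForm_basis_apply, hc]
    ring
  have val01345 : D 0 1 3 4 5 = -k 0 1 2 + k 0 3 0 - k 0 4 6 + k 1 3 1 + k 1 5 6 - k 3 4 4 - k 3 5 5
      - k 4 5 2 := by
    simp only [hD, ceDiff_four_apply, stdDualForm_basis_apply, hc]
    ring
  have val01346 : D 0 1 3 4 6 = -k 0 1 0 - k 0 3 2 + k 0 4 5 + k 1 3 3 + k 1 4 4 + k 1 6 6 - k 3 6 5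
      - k 4 6 2 := by
    simp only [hD, ceDiff_four_apply, stdDualForm_basis_apply, hc]
    ring
  have val01356 : D 0 1 3 5 6 = k 0 1 1 + k 0 3 3 + k 0 5 5 + k 0 6 6 + k 1 3 2 + k 1 5 4 + k 3 6 4
      - k 5 6 2 := by
    simp only [hD, ceDiff_four_apply, stdDualForm_basis_apply, hc]
    ring
  have val01456 : D 0 1 4 5 6 = k 0 4 3 + k 0 5 2 + k 0 6 0 + k 1 4 2 - k 1 5 3 + k 1 6 1 + k 4 6 4
      + k 5 6 5 := by
    simp only [hD, ceDiff_four_apply, stdDualForm_basis_apply, hc]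
    ring
  have val02345 : D 0 2 3 4 5 = -k 0 2 2 - k 0 3 3 - k 0 4 4 - k 0 5 5 + k 2 3 1 + k 2 5 6 + k 3 4 6
      + k 4 5 1 := by
    simp only [hD, ceDiff_four_apply, stdDualForm_basis_apply, hc]
    ring
  have val02346 : D 0 2 3 4 6 = -k 0 2 0 + k 0 3 1 - k 0 6 5 + k 2 3 3 + k 2 4 4 + k 2 6 6 - k 3 4 5
      + k 4 6 1 := by
    simp only [hD, ceDiff_four_apply, stdDualForm_basis_apply, hc]
    ring
  have val02356 : D 0 2 3 5 6 = k 0 2 1 + k 0 3 0 + k 0 6 4 + k 2 3 2 + k 2 5 4 - k 3 5 5 - k 3 6 6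
      + k 5 6 1 := by
    simp only [hD, ceDiff_four_apply, stdDualForm_basis_apply, hc]
    ring
  have val02456 : D 0 2 4 5 6 = k 0 4 0 - k 0 5 1 - k 0 6 3 + k 2 4 2 - k 2 5 3 + k 2 6 1 - k 4 5 5
      - k 4 6 6 := by
    simp only [hD, ceDiff_four_apply, stdDualForm_basis_apply, hc]
    ring
  have val03456 : D 0 3 4 5 6 = -k 0 4 1 - k 0 5 0 + k 0 6 2 + k 3 4 2 - k 3 5 3 + k 3 6 1 - k 4 5 4
      + k 5 6 6 := by
    simp only [hD, ceDiff_four_apply, stdDualForm_basis_apply, hc]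
    ring
  have val12345 : D 1 2 3 4 5 = -k 1 2 2 - k 1 3 3 - k 1 4 4 - k 1 5 5 - k 2 3 0 + k 2 4 6 - k 3 5 6
      - k 4 5 0 := by
    simp only [hD, ceDiff_four_apply, stdDualForm_basis_apply, hc]
    ring
  have val12346 : D 1 2 3 4 6 = -k 1 2 0 + k 1 3 1 - k 1 6 5 + k 2 3 2 - k 2 4 5 - k 3 4 4 - k 3 6 6
      - k 4 6 0 := by
    simp only [hD, ceDiff_four_apply, stdDualForm_basis_apply, hc]
    ring
  have val12356 : D 1 2 3 5 6 = k 1 2 1 + k 1 3 0 + k 1 6 4 - k 2 3 3 - k 2 5 5 - k 2 6 6 - k 3 5 4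
      - k 5 6 0 := by
    simp only [hD, ceDiff_four_apply, stdDualForm_basis_apply, hc]
    ring
  have val12456 : D 1 2 4 5 6 = k 1 4 0 - k 1 5 1 - k 1 6 3 - k 2 4 3 - k 2 5 2 - k 2 6 0 - k 4 5 4
      + k 5 6 6 := by
    simp only [hD, ceDiff_four_apply, stdDualForm_basis_apply, hc]
    ring
  have val13456 : D 1 3 4 5 6 = -k 1 4 1 - k 1 5 0 + k 1 6 2 - k 3 4 3 - k 3 5 2 - k 3 6 0 + k 4 5 5
      + k 4 6 6 := by
    simp only [hD, ceDiff_four_apply, stdDualForm_basis_apply, hc]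
    ring
  have val23456 : D 2 3 4 5 6 = -k 2 4 1 - k 2 5 0 + k 2 6 2 - k 3 4 0 + k 3 5 1 + k 3 6 3 + k 4 6 4
      + k 5 6 5 := by
    simp only [hD, ceDiff_four_apply, stdDualForm_basis_apply, hc]
    ring
  constructor
  · intro h
    have hD : ∀ a b p q r, D a b p q r = 0 := fun a b p q r => by rw [hD, h]; rfl
    constructor
    · rw [← val01234, hD]
    · rw [← val01235, hD]
    · rw [← val01236, hD]
    · rw [← val01245, hD]
    · rw [← val01246, hD]
    · rw [← val01256, hD]
    · rw [← val01345, hD]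
    · rw [← val01346, hD]
    · rw [← val01356, hD]
    · rw [← val01456, hD]
    · rw [← val02345, hD]
    · rw [← val02346, hD]
    · rw [← val02356, hD]
    · rw [← val02456, hD]
    · rw [← val03456, hD]
    · rw [← val12345, hD]
    · rw [← val12346, hD]
    · rw [← val12356, hD]
    · rw [← val12456, hD]
    · rw [← val13456, hD]
    · rw [← val23456, hD]
  · intro h
    refine AlternatingMap.ext_of_strictMono f fun K hK => ?_
    have h01 : K 0 < K 1 := hK (by decide)
    have h12 : K 1 < K 2 := hK (by decide)
    have h23 : K 2 < K 3 := hK (by decide)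
    have h34 : K 3 < K 4 := hK (by decide)
    have hK5 : f ∘ K = ![f (K 0), f (K 1), f (K 2), f (K 3), f (K 4)] := by
      ext i
      fin_cases i <;> rfl
    rw [hK5, ← hD, AlternatingMap.zero_apply]
    generalize K 0 = a, K 1 = b, K 2 = p, K 3 = q, K 4 = r at *
    clear hK5 hK K hD
    have key : [a, b, p, q, r] ∈ ([[0, 1, 2, 3, 4], [0, 1, 2, 3, 5], [0, 1, 2, 3, 6], [0, 1, 2, 4,
        5], [0, 1, 2, 4, 6], [0, 1, 2, 5, 6], [0, 1, 3, 4, 5], [0, 1, 3, 4, 6], [0, 1, 3, 5, 6], [0,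
        1, 4, 5, 6], [0, 2, 3, 4, 5], [0, 2, 3, 4, 6], [0, 2, 3, 5, 6], [0, 2, 4, 5, 6], [0, 3, 4,
        5, 6], [1, 2, 3, 4, 5], [1, 2, 3, 4, 6], [1, 2, 3, 5, 6], [1, 2, 4, 5, 6], [1, 3, 4, 5, 6],
        [2, 3, 4, 5, 6]] : List (List (Fin 7))) := by
      clear * - h01 h12 h23 h34
      revert a b p q r
      decide +kernel
    simp only [List.mem_cons, List.cons.injEq, and_true, List.not_mem_nil, or_false] at key
    rcases key with ⟨rfl, rfl, rfl, rfl, rfl⟩ | ⟨rfl, rfl, rfl, rfl, rfl⟩ | ⟨rfl, rfl, rfl, rfl,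
      rfl⟩ | ⟨rfl, rfl, rfl, rfl, rfl⟩ | ⟨rfl, rfl, rfl, rfl, rfl⟩ | ⟨rfl, rfl, rfl, rfl, rfl⟩
      | ⟨rfl, rfl, rfl, rfl, rfl⟩ | ⟨rfl, rfl, rfl, rfl, rfl⟩ | ⟨rfl, rfl, rfl, rfl, rfl⟩ | ⟨rfl,
      rfl, rfl, rfl, rfl⟩ | ⟨rfl, rfl, rfl, rfl, rfl⟩ | ⟨rfl, rfl, rfl, rfl, rfl⟩ | ⟨rfl, rfl, rfl,
      rfl, rfl⟩ | ⟨rfl, rfl, rfl, rfl, rfl⟩ | ⟨rfl, rfl, rfl, rfl, rfl⟩ | ⟨rfl, rfl, rfl, rfl, rfl⟩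
      | ⟨rfl, rfl, rfl, rfl, rfl⟩ | ⟨rfl, rfl, rfl, rfl, rfl⟩ | ⟨rfl, rfl, rfl, rfl, rfl⟩ | ⟨rfl,
      rfl, rfl, rfl, rfl⟩ | ⟨rfl, rfl, rfl, rfl, rfl⟩
    exacts [val01234.trans h.d01234,
      val01235.trans h.d01235,
      val01236.trans h.d01236,
      val01245.trans h.d01245,
      val01246.trans h.d01246,
      val01256.trans h.d01256,
      val01345.trans h.d01345,
      val01346.trans h.d01346,
      val01356.trans h.d01356,
      val01456.trans h.d01456,
      val02345.trans h.d02345,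
      val02346.trans h.d02346,
      val02356.trans h.d02356,
      val02456.trans h.d02456,
      val03456.trans h.d03456,
      val12345.trans h.d12345,
      val12346.trans h.d12346,
      val12356.trans h.d12356,
      val12456.trans h.d12456,
      val13456.trans h.d13456,
      val23456.trans h.d23456]

end G2Structure

/-! ### Uniqueness of the torsion -/

section TorsionComponents

variable {c t t' : Fin 7 → Fin 7 → Fin 7 → ℝ} {κ κ' : ℝ}

theorem TorsionRelations.self_left (h : TorsionRelations c t κ) (i k : Fin 7) : t i i k = 0 := by
  linarith [h.swap_left i i k]

theorem TorsionRelations.self_right (h : TorsionRelations c t κ) (i k : Fin 7) : t i k k = 0 := by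
  linarith [h.swap_right i k k]

/-- Oriented form of skew-symmetry, usable as a terminating rewrite rule. -/
theorem TorsionRelations.sort_left (h : TorsionRelations c t κ) (i j k : Fin 7) (_ : j < i) :
    t i j k = -t j i k :=
  h.swap_left i j k

/-- Oriented form of skew-symmetry, usable as a terminating rewrite rule. -/
theorem TorsionRelations.sort_right (h : TorsionRelations c t κ) (i j k : Fin 7) (_ : k < j) :
    t i j k = -t i k j :=
  h.swap_right i j k

theorem eq_of_eq_of_strictMono {t t' : Fin 7 → Fin 7 → Fin 7 → ℝ}
    (hl : ∀ i j k, t i j k = -t j i k) (hr : ∀ i j k, t i j k = -t i k j)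
    (hl' : ∀ i j k, t' i j k = -t' j i k) (hr' : ∀ i j k, t' i j k = -t' i k j)
    (h : ∀ i j k, i < j → j < k → t i j k = t' i j k) : t = t' := by
  have h2 : ∀ i j k, i < j → t i j k = t' i j k := fun i j k hij => by
    rcases lt_trichotomy j k with hk | rfl | hk
    · exact h i j k hij hk
    · linarith [hr i j j, hr' i j j]
    · rcases lt_trichotomy i k with hk' | rfl | hk'
      · rw [hr, hr', h i k j hk' hk]
      · linarith [hr i j i, hr' i j i, hl i i j, hl' i i j]
      · rw [hr, hr', hl, hl', h k i j hk' hij]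
  funext i j k
  rcases lt_trichotomy i j with hij | rfl | hij
  · exact h2 i j k hij
  · linarith [hl i i k, hl' i i k]
  · rw [hl, hl', h2 j i k hij]

theorem TorsionRelations.unique (h : TorsionRelations c t κ) (h' : TorsionRelations c t' κ') :
    t = t' := by
  have hk : κ = κ' := h.scalar.trans h'.scalar.symm
  subst hk
  refine eq_of_eq_of_strictMono h.swap_left h.swap_right h'.swap_left h'.swap_right ?_
  intro i j k hij hjk
  have key : [i, j, k] ∈ ([[0, 1, 2], [0, 1, 3], [0, 1, 4], [0, 1, 5], [0, 1, 6], [0, 2, 3], [0, 2,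
      4], [0, 2, 5], [0, 2, 6], [0, 3, 4], [0, 3, 5], [0, 3, 6], [0, 4, 5], [0, 4, 6], [0, 5, 6],
      [1, 2, 3], [1, 2, 4], [1, 2, 5], [1, 2, 6], [1, 3, 4], [1, 3, 5], [1, 3, 6], [1, 4, 5], [1, 4,
      6], [1, 5, 6], [2, 3, 4], [2, 3, 5], [2, 3, 6], [2, 4, 5], [2, 4, 6], [2, 5, 6], [3, 4, 5],
      [3, 4, 6], [3, 5, 6], [4, 5, 6]] : List (List (Fin 7))) := by
    revert i j k
    decide
  simp only [List.mem_cons, List.cons.injEq, and_true, List.not_mem_nil, or_false] at key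
  rcases key with ⟨rfl, rfl, rfl⟩ | ⟨rfl, rfl, rfl⟩ | ⟨rfl, rfl, rfl⟩ | ⟨rfl, rfl, rfl⟩ | ⟨rfl, rfl,
    rfl⟩ | ⟨rfl, rfl, rfl⟩ | ⟨rfl, rfl, rfl⟩ | ⟨rfl, rfl, rfl⟩ | ⟨rfl, rfl, rfl⟩ | ⟨rfl, rfl, rfl⟩
    | ⟨rfl, rfl, rfl⟩ | ⟨rfl, rfl, rfl⟩ | ⟨rfl, rfl, rfl⟩ | ⟨rfl, rfl, rfl⟩ | ⟨rfl, rfl, rfl⟩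
    | ⟨rfl, rfl, rfl⟩ | ⟨rfl, rfl, rfl⟩ | ⟨rfl, rfl, rfl⟩ | ⟨rfl, rfl, rfl⟩ | ⟨rfl, rfl, rfl⟩
    | ⟨rfl, rfl, rfl⟩ | ⟨rfl, rfl, rfl⟩ | ⟨rfl, rfl, rfl⟩ | ⟨rfl, rfl, rfl⟩ | ⟨rfl, rfl, rfl⟩
    | ⟨rfl, rfl, rfl⟩ | ⟨rfl, rfl, rfl⟩ | ⟨rfl, rfl, rfl⟩ | ⟨rfl, rfl, rfl⟩ | ⟨rfl, rfl, rfl⟩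
    | ⟨rfl, rfl, rfl⟩ | ⟨rfl, rfl, rfl⟩ | ⟨rfl, rfl, rfl⟩ | ⟨rfl, rfl, rfl⟩ | ⟨rfl, rfl, rfl⟩
  · rw [h.t012, h'.t012]
  · rw [h.t013, h'.t013]
  · rw [h.t014, h'.t014]
  · rw [h.t015, h'.t015]
  · rw [h.t016, h'.t016]
  · rw [h.t023, h'.t023]
  · rw [h.t024, h'.t024]
  · rw [h.t025, h'.t025]
  · rw [h.t026, h'.t026]
  · rw [h.t034, h'.t034]
  · rw [h.t035, h'.t035]
  · rw [h.t036, h'.t036]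
  · rw [h.t045, h'.t045]
  · rw [h.t046, h'.t046]
  · rw [h.t056, h'.t056]
  · rw [h.t123, h'.t123]
  · rw [h.t124, h'.t124]
  · rw [h.t125, h'.t125]
  · rw [h.t126, h'.t126]
  · rw [h.t134, h'.t134]
  · rw [h.t135, h'.t135]
  · rw [h.t136, h'.t136]
  · rw [h.t145, h'.t145]
  · rw [h.t146, h'.t146]
  · rw [h.t156, h'.t156]
  · rw [h.t234, h'.t234]
  · rw [h.t235, h'.t235]
  · rw [h.t236, h'.t236]
  · rw [h.t245, h'.t245]
  · rw [h.t246, h'.t246]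
  · rw [h.t256, h'.t256]
  · rw [h.t345, h'.t345]
  · rw [h.t346, h'.t346]
  · rw [h.t356, h'.t356]
  · rw [h.t456, h'.t456]

end TorsionComponents

/-! ### The three families are instantons -/

section Families

/-- The components of the `2`-form `e^p ∧ e^q`. -/
def planeForm (p q i j : Fin 7) : ℤ :=
  if i = p ∧ j = q then 1 else if i = q ∧ j = p then -1 else 0

theorem planeForm_swap {p q : Fin 7} (h : p ≠ q) (i j : Fin 7) :
    planeForm p q i j = -planeForm p q j i := by
  unfold planeForm
  grind

/-- The structure constants of a Lie algebra with `de⁷ = a e¹² + b e³⁴ + d e⁵⁶` and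
`de¹ = ⋯ = de⁶ = 0`. -/
def heisenbergConst (a b d : ℝ) (i j k : Fin 7) : ℝ :=
  if k = 6 then -(a * planeForm 0 1 i j + b * planeForm 2 3 i j + d * planeForm 4 5 i j) else 0

theorem heisenbergConst_swap (a b d : ℝ) (i j k : Fin 7) :
    heisenbergConst a b d i j k = -heisenbergConst a b d j i k := by
  unfold heisenbergConst
  rw [planeForm_swap (by decide) i j, planeForm_swap (by decide) i j,
    planeForm_swap (by decide) i j]
  split_ifs
  · push_cast
    ring
  · simp

/-- The structure constants of the quaternionic Heisenberg algebra (for `ν = 1`). -/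
def quaternionicConst (i j k : Fin 7) : ℤ :=
  if k = 4 then planeForm 1 3 i j - planeForm 0 2 i j
  else if k = 5 then planeForm 0 3 i j + planeForm 1 2 i j
  else if k = 6 then -planeForm 0 1 i j - planeForm 2 3 i j else 0

/-- The structure constants of the sum of the free `2`-step nilpotent Lie algebra of rank three and
a line (for `ν = 1`). -/
def freeConst (i j k : Fin 7) : ℤ :=
  if k = 4 then 2 * planeForm 1 3 i j else if k = 5 then 2 * planeForm 1 2 i j
  else if k = 6 then -2 * planeForm 2 3 i j else 0

/-- The totally skew symbol supported on the indices `4, 5, 6`. -/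
def verticalSymbol (i j k : Fin 7) : ℤ :=
  if k = 4 then planeForm 5 6 i j else if k = 5 then planeForm 6 4 i j
  else if k = 6 then planeForm 4 5 i j else 0

/-- The torsion of the quaternionic and of the free family (for `ν = 1`), in terms of their
structure constants `n`: minus the cyclic sum of `n`, corrected by a multiple of `e⁵⁶⁷`. -/
def verticalTorsion (n : Fin 7 → Fin 7 → Fin 7 → ℤ) (i j k : Fin 7) : ℤ :=
  -(n i j k + n j k i + n k i j) - 4 * verticalSymbol i j k

theorem verticalSymbol_swap_left : ∀ i j k, verticalSymbol i j k = -verticalSymbol j i k := by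
  decide +kernel

theorem verticalSymbol_swap_right : ∀ i j k, verticalSymbol i j k = -verticalSymbol i k j := by
  decide +kernel

theorem quaternionicConst_swap : ∀ i j k, quaternionicConst i j k = -quaternionicConst j i k := by
  decide +kernel

theorem freeConst_swap : ∀ i j k, freeConst i j k = -freeConst j i k := by
  decide +kernel

theorem heisenberg_torsionRelations {a b d : ℝ} (h : a + b + d = 0) :
    TorsionRelations (heisenbergConst a b d) (fun i j k => -(heisenbergConst a b d i j k
      + heisenbergConst a b d j k i + heisenbergConst a b d k i j)) 0 := by
  have hd : d = -a - b := by linarith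
  have hs := heisenbergConst_swap a b d
  constructor
  case swap_left => exact fun i j k => by linarith [hs i j k, hs j k i, hs k i j]
  case swap_right => exact fun i j k => by linarith [hs i j k, hs j k i, hs k i j]
  all_goals
    subst hd
    simp [heisenbergConst, planeForm]
  all_goals ring

theorem heisenberg_coclosedRelations (a b d : ℝ) : CoclosedRelations (heisenbergConst a b d) := by
  constructor <;> simp [heisenbergConst, planeForm]

theorem curvCoeff_eq_of_connCoeff {c t Γ : Fin 7 → Fin 7 → Fin 7 → ℝ}
    (h : ∀ i j k, connCoeff c t i j k = Γ i j k) (i j k l : Fin 7) : curvCoeff c t i j k l =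
      ∑ m, (Γ j k m * Γ i m l - Γ i k m * Γ j m l - c i j m * Γ m k l) := by
  simp only [curvCoeff, h]

theorem heisenberg_instantonEquations {a b d : ℝ} (h : a + b + d = 0) :
    InstantonEquations (curvCoeff (heisenbergConst a b d) fun i j k =>
      -(heisenbergConst a b d i j k + heisenbergConst a b d j k i
        + heisenbergConst a b d k i j)) := by
  have hd : d = -a - b := by linarith
  have hs := heisenbergConst_swap a b d
  have hc : ∀ i j k, connCoeff (heisenbergConst a b d) (fun i j k =>
      -(heisenbergConst a b d i j k + heisenbergConst a b d j k i
        + heisenbergConst a b d k i j)) i j k = heisenbergConst a b d k j i := fun i j k => by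
    rw [connCoeff]
    linarith [hs i j k, hs j k i, hs k i j]
  intro k l
  simp only [curvCoeff_eq_of_connCoeff hc]
  clear hs hc
  subst hd
  refine ⟨?_, ?_, ?_, ?_, ?_, ?_, ?_⟩ <;> simp [heisenbergConst, planeForm]
  ring

theorem vertical_torsionRelations_of_swap {n : Fin 7 → Fin 7 → Fin 7 → ℤ} {ν : ℝ}
    (hn : ∀ i j k, n i j k = -n j i k) :
    (∀ i j k, ν * (verticalTorsion n i j k : ℝ) = -(ν * (verticalTorsion n j i k : ℝ))) ∧
    (∀ i j k, ν * (verticalTorsion n i j k : ℝ) = -(ν * (verticalTorsion n i k j : ℝ))) := by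
  constructor <;> intro i j k <;> rw [← mul_neg] <;> congr 1 <;> norm_cast <;>
    simp only [verticalTorsion]
  · linarith [hn i j k, hn j k i, hn k i j, verticalSymbol_swap_left i j k]
  · linarith [hn i j k, hn j k i, hn k i j, verticalSymbol_swap_right i j k]

theorem quaternionic_torsionRelations (ν : ℝ) :
    TorsionRelations (fun i j k => ν * (quaternionicConst i j k : ℝ))
      (fun i j k => ν * (verticalTorsion quaternionicConst i j k : ℝ)) (2 * ν) := by
  have hs := vertical_torsionRelations_of_swap (ν := ν) quaternionicConst_swap
  constructor
  case swap_left => exact hs.1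
  case swap_right => exact hs.2
  all_goals
    simp [quaternionicConst, planeForm, verticalTorsion, verticalSymbol]
  all_goals ring

theorem free_torsionRelations (ν : ℝ) :
    TorsionRelations (fun i j k => ν * (freeConst i j k : ℝ))
      (fun i j k => ν * (verticalTorsion freeConst i j k : ℝ)) (2 * ν) := by
  have hs := vertical_torsionRelations_of_swap (ν := ν) freeConst_swap
  constructor
  case swap_left => exact hs.1
  case swap_right => exact hs.2
  all_goals
    simp [freeConst, planeForm, verticalTorsion, verticalSymbol]
  all_goals ring

theorem quaternionic_coclosedRelations (ν : ℝ) :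
    CoclosedRelations fun i j k => ν * (quaternionicConst i j k : ℝ) := by
  constructor <;> simp [quaternionicConst, planeForm]

theorem free_coclosedRelations (ν : ℝ) :
    CoclosedRelations fun i j k => ν * (freeConst i j k : ℝ) := by
  constructor <;> simp [freeConst, planeForm]

/-- The curvature of `∇¹` for the integral structure constants `n` and the torsion
`verticalTorsion n`. Being integral, it can be evaluated by the kernel. -/
def verticalCurv (n : Fin 7 → Fin 7 → Fin 7 → ℤ) (i j k l : Fin 7) : ℤ :=
  let Γ := fun i j k => n k j i - 2 * verticalSymbol i j k
  let F := fun m => Γ j k m * Γ i m l - Γ i k m * Γ j m l - n i j m * Γ m k l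
  F 0 + F 1 + F 2 + F 3 + F 4 + F 5 + F 6

theorem curvCoeff_vertical {n : Fin 7 → Fin 7 → Fin 7 → ℤ} (hn : ∀ i j k, n i j k = -n j i k)
    (ν : ℝ) (i j k l : Fin 7) :
    curvCoeff (fun i j k => ν * (n i j k : ℝ)) (fun i j k => ν * (verticalTorsion n i j k : ℝ))
      i j k l = ν ^ 2 * (verticalCurv n i j k l : ℝ) := by
  have hn' : ∀ i j k, (n i j k : ℝ) = -n j i k := fun i j k => by exact_mod_cast hn i j k
  rw [curvCoeff_eq_of_connCoeff
    (Γ := fun i j k => ν * ((n k j i - 2 * verticalSymbol i j k : ℤ) : ℝ)) fun i j k => by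
      simp only [connCoeff, verticalTorsion]
      push_cast
      rw [hn' j k i, hn' k i j]
      ring]
  rw [Fin.sum_univ_seven, verticalCurv]
  push_cast
  ring

theorem vertical_instantonEquations {n : Fin 7 → Fin 7 → Fin 7 → ℤ}
    (hn : ∀ i j k, n i j k = -n j i k) (ν : ℝ)
    (h : ∀ k l, verticalCurv n 1 6 k l + verticalCurv n 2 4 k l - verticalCurv n 3 5 k l = 0 ∧
      verticalCurv n 0 6 k l + verticalCurv n 2 5 k l + verticalCurv n 3 4 k l = 0 ∧
      verticalCurv n 3 6 k l - verticalCurv n 0 4 k l + verticalCurv n 1 5 k l = 0 ∧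
      verticalCurv n 0 5 k l - verticalCurv n 2 6 k l + verticalCurv n 1 4 k l = 0 ∧
      verticalCurv n 5 6 k l + verticalCurv n 0 2 k l - verticalCurv n 1 3 k l = 0 ∧
      verticalCurv n 4 6 k l + verticalCurv n 0 3 k l + verticalCurv n 1 2 k l = 0 ∧
      verticalCurv n 0 1 k l + verticalCurv n 2 3 k l + verticalCurv n 4 5 k l = 0) :
    InstantonEquations (curvCoeff (fun i j k => ν * (n i j k : ℝ))
      (fun i j k => ν * (verticalTorsion n i j k : ℝ))) := by
  intro k l
  simp only [curvCoeff_vertical hn, ← mul_add, ← mul_sub]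
  obtain ⟨h1, h2, h3, h4, h5, h6, h7⟩ := h k l
  refine ⟨?_, ?_, ?_, ?_, ?_, ?_, ?_⟩ <;> rw [mul_eq_zero] <;> right
  · exact_mod_cast h1
  · exact_mod_cast h2
  · exact_mod_cast h3
  · exact_mod_cast h4
  · exact_mod_cast h5
  · exact_mod_cast h6
  · exact_mod_cast h7

set_option maxRecDepth 4000 in
theorem quaternionic_instantonEquations (ν : ℝ) : InstantonEquations
    (curvCoeff (fun i j k => ν * (quaternionicConst i j k : ℝ))
      (fun i j k => ν * (verticalTorsion quaternionicConst i j k : ℝ))) :=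
  vertical_instantonEquations quaternionicConst_swap ν (by decide +kernel)

set_option maxRecDepth 4000 in
theorem free_instantonEquations (ν : ℝ) : InstantonEquations
    (curvCoeff (fun i j k => ν * (freeConst i j k : ℝ))
      (fun i j k => ν * (verticalTorsion freeConst i j k : ℝ))) :=
  vertical_instantonEquations freeConst_swap ν (by decide +kernel)

end Families

/-! ### Consequences of the instanton equations -/

set_option linter.unusedSimpArgs false

section Necessity

variable {c t : Fin 7 → Fin 7 → Fin 7 → ℝ} {κ : ℝ}

theorem eq_of_swap {a b : Fin 7 → Fin 7 → ℝ} (ha : ∀ i j, a i j = -a j i)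
    (hb : ∀ i j, b i j = -b j i) (h : ∀ i j, i < j → a i j = b i j) : a = b := by
  funext i j
  rcases lt_trichotomy i j with hij | rfl | hij
  · exact h i j hij
  · linarith [ha i i, hb i i]
  · rw [ha, hb, h j i hij]

/-- If the bracket takes values in the central line spanned by `f₆`, and certain components of `de⁷`
related by `f₆ × ·` agree, the condition `dψ = 0` leaves only multiples of `e¹²`, `e³⁴`, `e⁵⁶`. -/
theorem eq_heisenbergConst (hs : ∀ i j k, c i j k = -c j i k) (hz : ∀ j k, c 6 j k = 0)
    (hi : ∀ i j k, k ≠ 6 → c i j k = 0) (hd : CoclosedRelations c)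
    (h1 : c 0 3 6 = c 1 2 6) (h2 : c 0 2 6 = -c 1 3 6) (h3 : c 0 5 6 = c 1 4 6)
    (h4 : c 0 4 6 = -c 1 5 6) (h5 : c 2 5 6 = c 3 4 6) (h6 : c 2 4 6 = -c 3 5 6) :
    c = heisenbergConst (-c 0 1 6) (-c 2 3 6) (-c 4 5 6) := by
  have hz' : ∀ i k, c i 6 k = 0 := fun i k => by rw [hs, hz, neg_zero]
  have d1 := hd.d01234
  have d2 := hd.d01235
  have d3 := hd.d01245
  have d4 := hd.d01345
  have d5 := hd.d02345
  have d6 := hd.d12345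
  simp [hi] at d1 d2 d3 d4 d5 d6
  have key : (fun i j => c i j 6) =
      fun i j => heisenbergConst (-c 0 1 6) (-c 2 3 6) (-c 4 5 6) i j 6 := by
    refine eq_of_swap (fun i j => hs i j 6) (fun i j => heisenbergConst_swap _ _ _ i j 6) ?_
    intro i j hij
    fin_cases i <;> fin_cases j <;> simp at hij <;>
      simp [heisenbergConst, planeForm, hz'] <;> linarith
  funext i j k
  by_cases hk : k = 6
  · subst hk
    exact congrFun (congrFun key i) j
  · rw [hi i j k hk, heisenbergConst, if_neg hk]

set_option maxHeartbeats 1000000 in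
/-- Three of the components of `R ∧ ψ` add up to a multiple of `(a + b + d)²`. -/
theorem heisenberg_trace_eq_zero {a b d : ℝ} (h : TorsionRelations (heisenbergConst a b d) t κ)
    (hI : InstantonEquations (curvCoeff (heisenbergConst a b d) t)) : a + b + d = 0 := by
  have h01 := (hI 1 6).1
  have h23 := (hI 3 6).2.2.1
  have h45 := (hI 5 6).2.2.2.2.1
  have hdl := h.self_left
  have hdr := h.self_right
  have hsl := h.sort_left
  have hsr := h.sort_right
  obtain ⟨-, -, hκ, t012, t013, t014, t015, t016, t023, t024, t025, t026, t034, t035, t036, t045,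
    t046, t056, t123, t124, t125, t126, t134, t135, t136, t145, t146, t156, t234, t235, t236, t245,
    t246, t256, t345, t346, t356, t456⟩ := h
  simp [heisenbergConst, planeForm]
    at hκ t012 t013 t014 t015 t016 t023 t024 t025 t026 t034 t035 t036 t045 t046 t056 t123 t124 t125 t126 t134 t135 t136 t145 t146 t156 t234 t235 t236 t245 t246 t256 t345 t346 t356 t456
  simp [curvCoeff, connCoeff, heisenbergConst, planeForm, Fin.sum_univ_seven, hdl, hdr, hsl, hsr,
    t012, t013, t014, t015, t016, t023, t024, t025, t026, t034, t035, t036, t045, t046, t056, t123,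
      t124, t125, t126, t134, t135, t136, t145, t146, t156, t234, t235, t236, t245, t246, t256,
      t345, t346, t356, t456] at h01 h23 h45
  have key : (a + b + d) ^ 2 = 0 := by
    rw [hκ] at h01 h23 h45
    linear_combination 3 / 2 * (h01 + h23 + h45)
  exact pow_eq_zero_iff two_ne_zero |>.mp key

/-- The structure constants of a Lie algebra whose bracket takes `span (f₀, …, f₃)` to the central
subspace `span (f₄, f₅, f₆)`. The rows of `X` and `Y` are the coefficients of `de⁵, de⁶, de⁷` in the
bases of self-dual and anti-self-dual `2`-forms of `span (f₀, …, f₃)`, namely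
`e¹³ ∓ e²⁴`, `-e¹⁴ ∓ e²³`, `e¹² ± e³⁴`. -/
structure IsSpinConst (c : Fin 7 → Fin 7 → Fin 7 → ℝ) (X Y : Fin 3 → Fin 3 → ℝ) : Prop where
  swap : ∀ i j k, c i j k = -c j i k
  central : ∀ i j k, 3 < i → c i j k = 0
  range : ∀ i j k, k < 4 → c i j k = 0
  c014 : c 0 1 4 = -(X 0 2 + Y 0 2)
  c024 : c 0 2 4 = -(X 0 0 + Y 0 0)
  c034 : c 0 3 4 = X 0 1 + Y 0 1
  c124 : c 1 2 4 = X 0 1 - Y 0 1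
  c134 : c 1 3 4 = X 0 0 - Y 0 0
  c234 : c 2 3 4 = Y 0 2 - X 0 2
  c015 : c 0 1 5 = -(X 1 2 + Y 1 2)
  c025 : c 0 2 5 = -(X 1 0 + Y 1 0)
  c035 : c 0 3 5 = X 1 1 + Y 1 1
  c125 : c 1 2 5 = X 1 1 - Y 1 1
  c135 : c 1 3 5 = X 1 0 - Y 1 0
  c235 : c 2 3 5 = Y 1 2 - X 1 2
  c016 : c 0 1 6 = -(X 2 2 + Y 2 2)
  c026 : c 0 2 6 = -(X 2 0 + Y 2 0)
  c036 : c 0 3 6 = X 2 1 + Y 2 1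
  c126 : c 1 2 6 = X 2 1 - Y 2 1
  c136 : c 1 3 6 = X 2 0 - Y 2 0
  c236 : c 2 3 6 = Y 2 2 - X 2 2

theorem exists_isSpinConst (hs : ∀ i j k, c i j k = -c j i k)
    (hz : ∀ i j k, 3 < i → c i j k = 0) (hi : ∀ i j k, k < 4 → c i j k = 0) :
    ∃ X Y, IsSpinConst c X Y := by
  refine ⟨fun a => let k := ![4, 5, 6] a
      ![(c 1 3 k - c 0 2 k) / 2, (c 0 3 k + c 1 2 k) / 2, -(c 0 1 k + c 2 3 k) / 2],
    fun a => let k := ![4, 5, 6] a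
      ![-(c 1 3 k + c 0 2 k) / 2, (c 0 3 k - c 1 2 k) / 2, (c 2 3 k - c 0 1 k) / 2],
    hs, hz, hi, ?_, ?_, ?_, ?_, ?_, ?_, ?_, ?_, ?_, ?_, ?_, ?_, ?_, ?_, ?_, ?_, ?_, ?_⟩ <;>
  · simp
    ring

variable {X Y : Fin 3 → Fin 3 → ℝ}

theorem IsSpinConst.coeff_comm (h : IsSpinConst c X Y) (hd : CoclosedRelations c) :
    X 0 1 = X 1 0 ∧ X 0 2 = X 2 0 ∧ X 1 2 = X 2 1 := by
  have hz := h.central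
  have hz' : ∀ i j k, 3 < j → c i j k = 0 := fun i j k hj => by
    rw [h.swap, hz j i k hj, neg_zero]
  have hi := h.range
  obtain ⟨-, -, -, c014, c024, c034, c124, c134, c234, c015, c025, c035, c125, c135, c235, c016,
    c026, c036, c126, c136, c236⟩ := h
  have d1 := hd.d01236
  have d2 := hd.d01234
  have d3 := hd.d01235
  simp [hi, hz, hz', c014, c024, c034, c124, c134, c234, c015, c025, c035, c125, c135, c235, c016,
    c026, c036, c126, c136, c236] at d1 d2 d3
  refine ⟨?_, ?_, ?_⟩ <;> linarith

theorem eq_zero_of_sum_sq_eq_zero {a b d x y z : ℝ}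
    (h : (a - b) ^ 2 + (a - d) ^ 2 + (b - d) ^ 2 + 6 * (x ^ 2 + y ^ 2 + z ^ 2) = 0) :
    x = 0 ∧ y = 0 ∧ z = 0 ∧ b = a ∧ d = a := by
  have e1 : x ^ 2 = 0 := by nlinarith
  have e2 : y ^ 2 = 0 := by nlinarith
  have e3 : z ^ 2 = 0 := by nlinarith
  have e4 : (a - b) ^ 2 = 0 := by nlinarith
  have e5 : (a - d) ^ 2 = 0 := by nlinarith
  rw [pow_eq_zero_iff two_ne_zero] at e1 e2 e3 e4 e5
  exact ⟨e1, e2, e3, by linarith, by linarith⟩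

set_option maxHeartbeats 4000000 in
/-- The self-dual parts of `de⁵, de⁶, de⁷` are a multiple of the identity: `X` is
symmetric since `dψ = 0`, and a combination of three components of `R ∧ ψ` is a positive definite
form in its trace-free part. -/
theorem IsSpinConst.coeff_eq (h : IsSpinConst c X Y) (hd : CoclosedRelations c)
    (ht : TorsionRelations c t κ) (hI : InstantonEquations (curvCoeff c t)) :
    X 1 1 = X 0 0 ∧ X 2 2 = X 0 0 ∧ X 0 1 = 0 ∧ X 0 2 = 0 ∧ X 1 2 = 0 ∧ X 1 0 = 0 ∧ X 2 0 = 0 ∧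
      X 2 1 = 0 := by
  obtain ⟨hx1, hx2, hx3⟩ := h.coeff_comm hd
  have hs := h.swap
  have hss : ∀ i k, c i i k = 0 := fun i k => by linarith [hs i i k]
  have hst : ∀ i j k, j < i → c i j k = -c j i k := fun i j k _ => hs i j k
  have hz := h.central
  have hz' : ∀ i j k, 3 < j → c i j k = 0 := fun i j k hj => by
    rw [h.swap, hz j i k hj, neg_zero]
  have hi := h.range
  have h456 := (hI 5 6).2.2.2.2.1
  have h564 := (hI 6 4).2.2.2.2.2.1
  have h645 := (hI 4 5).2.2.2.2.2.2
  have hdl := ht.self_left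
  have hdr := ht.self_right
  have hsl := ht.sort_left
  have hsr := ht.sort_right
  obtain ⟨-, -, -, c014, c024, c034, c124, c134, c234, c015, c025, c035, c125, c135, c235, c016,
    c026, c036, c126, c136, c236⟩ := h
  obtain ⟨-, -, hκ, t012, t013, t014, t015, t016, t023, t024, t025, t026, t034, t035, t036, t045,
    t046, t056, t123, t124, t125, t126, t134, t135, t136, t145, t146, t156, t234, t235, t236, t245,
    t246, t256, t345, t346, t356, t456⟩ := ht
  simp [hi, hz, hz', c014, c024, c034, c124, c134, c234, c015, c025, c035, c125, c135, c235, c016,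
    c026, c036, c126, c136, c236]
    at hκ t012 t013 t014 t015 t016 t023 t024 t025 t026 t034 t035 t036 t045 t046 t056 t123 t124 t125 t126 t134 t135 t136 t145 t146 t156 t234 t235 t236 t245 t246 t256 t345 t346 t356 t456
  simp [curvCoeff, connCoeff, Fin.sum_univ_seven, hss, hi, hz, hz', hst, hdl, hdr, hsl, hsr,
    c014, c024, c034, c124, c134, c234, c015, c025, c035, c125, c135, c235, c016, c026, c036, c126,
      c136, c236,
    t012, t013, t014, t015, t016, t023, t024, t025, t026, t034, t035, t036, t045, t046, t056, t123,
      t124, t125, t126, t134, t135, t136, t145, t146, t156, t234, t235, t236, t245, t246, t256,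
      t345, t346, t356, t456] at h456 h564 h645
  have key : (X 0 0 - X 1 1) ^ 2 + (X 0 0 - X 2 2) ^ 2 + (X 1 1 - X 2 2) ^ 2
      + 6 * (X 0 1 ^ 2 + X 0 2 ^ 2 + X 1 2 ^ 2) = 0 := by
    simp only [← hx1, ← hx2, ← hx3, hκ] at h456 h564 h645
    linear_combination 3 / 2 * (h456 - h564 + h645)
  obtain ⟨e1, e2, e3, e4, e5⟩ := eq_zero_of_sum_sq_eq_zero key
  exact ⟨e4, e5, e1, e2, e3, hx1.symm.trans e1, hx2.symm.trans e2, hx3.symm.trans e3⟩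

set_option maxHeartbeats 4000000 in
/-- If `y₁, y₂, y₃` are the rows of `Y` and `m` is the multiple of the identity of
`IsSpinConst.coeff_eq`, then `y₂ × y₃ = -m y₁` and cyclically. -/
theorem IsSpinConst.cross (h : IsSpinConst c X Y) (hd : CoclosedRelations c)
    (ht : TorsionRelations c t κ) (hI : InstantonEquations (curvCoeff c t)) :
    (Y 1 1 * Y 2 2 - Y 1 2 * Y 2 1 = -X 0 0 * Y 0 0 ∧
      Y 1 2 * Y 2 0 - Y 1 0 * Y 2 2 = -X 0 0 * Y 0 1 ∧
      Y 1 0 * Y 2 1 - Y 1 1 * Y 2 0 = -X 0 0 * Y 0 2) ∧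
    (Y 2 1 * Y 0 2 - Y 2 2 * Y 0 1 = -X 0 0 * Y 1 0 ∧
      Y 2 2 * Y 0 0 - Y 2 0 * Y 0 2 = -X 0 0 * Y 1 1 ∧
      Y 2 0 * Y 0 1 - Y 2 1 * Y 0 0 = -X 0 0 * Y 1 2) ∧
    Y 0 1 * Y 1 2 - Y 0 2 * Y 1 1 = -X 0 0 * Y 2 0 ∧
      Y 0 2 * Y 1 0 - Y 0 0 * Y 1 2 = -X 0 0 * Y 2 1 ∧
      Y 0 0 * Y 1 1 - Y 0 1 * Y 1 0 = -X 0 0 * Y 2 2 := by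
  obtain ⟨hx1, hx2, hx3, hx4, hx5, hx6, hx7, hx8⟩ := h.coeff_eq hd ht hI
  have hs := h.swap
  have hss : ∀ i k, c i i k = 0 := fun i k => by linarith [hs i i k]
  have hst : ∀ i j k, j < i → c i j k = -c j i k := fun i j k _ => hs i j k
  have hz := h.central
  have hz' : ∀ i j k, 3 < j → c i j k = 0 := fun i j k hj => by
    rw [h.swap, hz j i k hj, neg_zero]
  have hi := h.range
  have h401 := (hI 0 1).2.2.2.2.1
  have h402 := (hI 0 2).2.2.2.2.1
  have h403 := (hI 0 3).2.2.2.2.1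
  have h501 := (hI 0 1).2.2.2.2.2.1
  have h502 := (hI 0 2).2.2.2.2.2.1
  have h503 := (hI 0 3).2.2.2.2.2.1
  have h601 := (hI 0 1).2.2.2.2.2.2
  have h602 := (hI 0 2).2.2.2.2.2.2
  have h603 := (hI 0 3).2.2.2.2.2.2
  have hdl := ht.self_left
  have hdr := ht.self_right
  have hsl := ht.sort_left
  have hsr := ht.sort_right
  obtain ⟨-, -, -, c014, c024, c034, c124, c134, c234, c015, c025, c035, c125, c135, c235, c016,
    c026, c036, c126, c136, c236⟩ := h
  simp only [hx1, hx2, hx3, hx4, hx5, hx6, hx7, hx8]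
    at c014 c024 c034 c124 c134 c234 c015 c025 c035 c125 c135 c235 c016 c026 c036 c126 c136 c236
  obtain ⟨-, -, hκ, t012, t013, t014, t015, t016, t023, t024, t025, t026, t034, t035, t036, t045,
    t046, t056, t123, t124, t125, t126, t134, t135, t136, t145, t146, t156, t234, t235, t236, t245,
    t246, t256, t345, t346, t356, t456⟩ := ht
  simp [hi, hz, hz', c014, c024, c034, c124, c134, c234, c015, c025, c035, c125, c135, c235, c016,
    c026, c036, c126, c136, c236] at hκ
  ring_nf at hκ
  subst hκ
  simp [hi, hz, hz', c014, c024, c034, c124, c134, c234, c015, c025, c035, c125, c135, c235, c016,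
    c026, c036, c126, c136, c236]
    at t012 t013 t014 t015 t016 t023 t024 t025 t026 t034 t035 t036 t045 t046 t056 t123 t124 t125 t126 t134 t135 t136 t145 t146 t156 t234 t235 t236 t245 t246 t256 t345 t346 t356 t456
  simp [curvCoeff, connCoeff, Fin.sum_univ_seven, hss, hi, hz, hz', hst, hdl, hdr, hsl, hsr,
    c014, c024, c034, c124, c134, c234, c015, c025, c035, c125, c135, c235, c016, c026, c036, c126,
      c136, c236,
    t012, t013, t014, t015, t016, t023, t024, t025, t026, t034, t035, t036, t045, t046, t056, t123,
      t124, t125, t126, t134, t135, t136, t145, t146, t156, t234, t235, t236, t245, t246, t256,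
      t345, t346, t356, t456] at h401 h402 h403 h501 h502 h503 h601 h602 h603
  ring_nf at h401 h402 h403 h501 h502 h503 h601 h602 h603
  refine ⟨⟨?_, ?_, ?_⟩, ⟨?_, ?_, ?_⟩, ?_, ?_, ?_⟩
  · linear_combination 1 / 2 * h402
  · linear_combination -1 / 2 * h403
  · linear_combination 1 / 2 * h401
  · linear_combination -1 / 2 * h502
  · linear_combination 1 / 2 * h503
  · linear_combination -1 / 2 * h501
  · linear_combination 1 / 2 * h602
  · linear_combination -1 / 2 * h603
  · linear_combination 1 / 2 * h601

end Necessity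

/-! ### Brackets in a slanted central subspace -/

section Slant

variable {c t : Fin 7 → Fin 7 → Fin 7 → ℝ} {κ : ℝ}

/-- The skew form with kernel containing `f₅`, `f₆` and `s f₃ + C f₄`, given by its values on pairs
of the vectors `f₀`, `f₁`, `f₂`, `u = C f₃ - s f₄`, in the order `01, 02, 12, 0u, 1u, 2u`. -/
def slantForm (C s : ℝ) (a : Fin 6 → ℝ) (i j : Fin 7) : ℝ :=
  a 0 * planeForm 0 1 i j + a 1 * planeForm 0 2 i j + a 2 * planeForm 1 2 i j
    + a 3 * (C * planeForm 0 3 i j - s * planeForm 0 4 i j)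
    + a 4 * (C * planeForm 1 3 i j - s * planeForm 1 4 i j)
    + a 5 * (C * planeForm 2 3 i j - s * planeForm 2 4 i j)

theorem slantForm_swap (C s : ℝ) (a : Fin 6 → ℝ) (i j : Fin 7) :
    slantForm C s a i j = -slantForm C s a j i := by
  have h01 := planeForm_swap (show (0 : Fin 7) ≠ 1 by decide) i j
  have h02 := planeForm_swap (show (0 : Fin 7) ≠ 2 by decide) i j
  have h12 := planeForm_swap (show (1 : Fin 7) ≠ 2 by decide) i j
  have h03 := planeForm_swap (show (0 : Fin 7) ≠ 3 by decide) i j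
  have h04 := planeForm_swap (show (0 : Fin 7) ≠ 4 by decide) i j
  have h13 := planeForm_swap (show (1 : Fin 7) ≠ 3 by decide) i j
  have h14 := planeForm_swap (show (1 : Fin 7) ≠ 4 by decide) i j
  have h23 := planeForm_swap (show (2 : Fin 7) ≠ 3 by decide) i j
  have h24 := planeForm_swap (show (2 : Fin 7) ≠ 4 by decide) i j
  simp only [slantForm, h01, h02, h12, h03, h04, h13, h14, h23, h24]
  push_cast
  ring

/-- The structure constants of a Lie algebra whose bracket takes values in the central subspace
spanned by `f₅`, `f₆` and `s f₃ + C f₄`. -/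
def slantConst (C s : ℝ) (p q h : Fin 6 → ℝ) (i j k : Fin 7) : ℝ :=
  if k = 3 then s * slantForm C s h i j else if k = 4 then C * slantForm C s h i j
  else if k = 5 then slantForm C s p i j else if k = 6 then slantForm C s q i j else 0

/-- If `dψ = 0`, only brackets with `f₁` survive. -/
theorem eq_slantConst_of_coclosed {C s : ℝ} (hs : s ≠ 0) {p q h : Fin 6 → ℝ}
    (hd : CoclosedRelations (slantConst C s p q h)) :
    slantConst C s p q h = slantConst C s ![-q 2, 0, p 2, 0, p 4, 0] ![q 0, 0, q 2, 0, q 4, 0]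
      ![-q 4, 0, p 4, 0, h 4, 0] := by
  have d1 := hd.d01234
  have d2 := hd.d01235
  have d3 := hd.d01236
  have d4 := hd.d01245
  have d5 := hd.d01246
  have d6 := hd.d01256
  have d7 := hd.d01345
  have d8 := hd.d01346
  have d10 := hd.d01456
  have d16 := hd.d12345
  have d17 := hd.d12346
  have d19 := hd.d12456
  simp [slantConst, slantForm, planeForm, hs] at d1 d2 d3 d4 d5 d6 d7 d8 d10 d16 d17 d19
  have e0 : h 0 = -q 4 := mul_left_cancel₀ hs (by rw [d19] at d4; linear_combination d4)
  have e2 : h 2 = p 4 := mul_left_cancel₀ hs (by rw [d10] at d5; linear_combination d5)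
  have e3 : p 3 = 0 := by simpa [hs] using show p 3 * s = 0 by linear_combination -d8
  have e4 : q 5 = 0 := by simpa [hs] using show q 5 * s = 0 by linear_combination -d16
  have f0 : p 0 = -q 2 := by rw [d7, d17] at d1; linear_combination d1
  have f1 : q 1 = 0 := by rw [d19, e0] at d2; linear_combination d2
  have f2 : p 1 = 0 := by rw [d10, e2] at d3; linear_combination -d3
  funext i j k
  simp [slantConst, slantForm, d6, d7, d10, d17, d19, e0, e2, e3, e4, f0, f1, f2]

set_option maxHeartbeats 4000000 in
/-- The difference of two components of `R ∧ ψ` is a positive definite form in all parameters except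
`z`; once these vanish, a third component is a multiple of `s² z²`. -/
theorem slant_eq_zero {C s : ℝ} (hCs : C ^ 2 + s ^ 2 = 1) (hs : s ≠ 0) {a b d x y z : ℝ}
    (ht : TorsionRelations
      (slantConst C s ![-a, 0, d, 0, x, 0] ![b, 0, a, 0, y, 0] ![-y, 0, x, 0, z, 0]) t κ)
    (hI : InstantonEquations (curvCoeff
      (slantConst C s ![-a, 0, d, 0, x, 0] ![b, 0, a, 0, y, 0] ![-y, 0, x, 0, z, 0]) t)) :
    a = 0 ∧ b = 0 ∧ d = 0 ∧ x = 0 ∧ y = 0 ∧ z = 0 := by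
  have h456 := (hI 5 6).2.2.2.2.1
  have h402 := (hI 0 2).2.2.2.2.1
  have h305 := (hI 0 5).2.2.2.1
  have hdl := ht.self_left
  have hdr := ht.self_right
  have hsl := ht.sort_left
  have hsr := ht.sort_right
  obtain ⟨-, -, hκ, t012, t013, t014, t015, t016, t023, t024, t025, t026, t034, t035, t036, t045,
    t046, t056, t123, t124, t125, t126, t134, t135, t136, t145, t146, t156, t234, t235, t236, t245,
    t246, t256, t345, t346, t356, t456⟩ := ht
  simp [slantConst, slantForm, planeForm]
    at hκ t012 t013 t014 t015 t016 t023 t024 t025 t026 t034 t035 t036 t045 t046 t056 t123 t124 t125 t126 t134 t135 t136 t145 t146 t156 t234 t235 t236 t245 t246 t256 t345 t346 t356 t456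
  simp [curvCoeff, connCoeff, Fin.sum_univ_seven, slantConst, slantForm, planeForm, hdl, hdr, hsl,
    hsr, t012, t013, t014, t015, t016, t023, t024, t025, t026, t034, t035, t036, t045, t046, t056,
      t123, t124, t125, t126, t134, t135, t136, t145, t146, t156, t234, t235, t236, t245, t246,
      t256, t345, t346, t356, t456] at h456 h402 h305
  have hκ' : κ = (d - b + z) / 3 := by linear_combination hκ + z / 3 * hCs
  have key : a ^ 2 + (b ^ 2 + d ^ 2 + x ^ 2 + y ^ 2) / 2 = 0 := by
    rw [hκ'] at h456 h402
    linear_combination h456 - h402 - (x ^ 2 + y ^ 2) / 2 * hCs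
  obtain ⟨ha, hb, hd, hx, hy⟩ : a = 0 ∧ b = 0 ∧ d = 0 ∧ x = 0 ∧ y = 0 := by
    clear h456 h402 h305
    refine ⟨?_, ?_, ?_, ?_, ?_⟩ <;> rw [← pow_eq_zero_iff two_ne_zero] <;>
      linarith only [key, sq_nonneg a, sq_nonneg b, sq_nonneg d, sq_nonneg x, sq_nonneg y]
  subst ha hb hd hx hy
  refine ⟨rfl, rfl, rfl, rfl, rfl, ?_⟩
  have hz : (s * z) ^ 2 = 0 := by
    rw [hκ'] at h305
    linear_combination -3 * h305 + (-3 / 4 * (C ^ 2 * z ^ 2 + s ^ 2 * z ^ 2) + z ^ 2 / 4) * hCs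
  simpa [hs] using hz

end Slant

/-! ### Normal forms for brackets in `span (f₄, f₅, f₆)` -/

section SpinNormalForms

variable {c c' : Fin 7 → Fin 7 → Fin 7 → ℝ} {X Y : Fin 3 → Fin 3 → ℝ}

theorem IsSpinConst.eq (h : IsSpinConst c X Y) (h' : IsSpinConst c' X Y) : c = c' := by
  funext i j k
  refine congrFun (congrFun (?_ : (fun i j => c i j k) = fun i j => c' i j k) i) j
  refine eq_of_swap (fun i j => h.swap i j k) (fun i j => h'.swap i j k) fun i j hij => ?_
  by_cases hk : k < 4
  · rw [h.range i j k hk, h'.range i j k hk]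
  by_cases hj : 3 < j
  · rw [h.swap, h'.swap, h.central j i k hj, h'.central j i k hj]
  obtain ⟨-, -, -, h1, h2, h3, h4, h5, h6, h7, h8, h9, h10, h11, h12, h13, h14, h15, h16, h17,
    h18⟩ := h
  obtain ⟨-, -, -, e1, e2, e3, e4, e5, e6, e7, e8, e9, e10, e11, e12, e13, e14, e15, e16, e17,
    e18⟩ := h'
  have hij' : (i = 0 ∧ j = 1) ∨ (i = 0 ∧ j = 2) ∨ (i = 0 ∧ j = 3) ∨ (i = 1 ∧ j = 2) ∨
      (i = 1 ∧ j = 3) ∨ (i = 2 ∧ j = 3) := by omega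
  have hk' : k = 4 ∨ k = 5 ∨ k = 6 := by omega
  rcases hk' with rfl | rfl | rfl <;>
    rcases hij' with ⟨rfl, rfl⟩ | ⟨rfl, rfl⟩ | ⟨rfl, rfl⟩ | ⟨rfl, rfl⟩ | ⟨rfl, rfl⟩ | ⟨rfl, rfl⟩
  · rw [h1, e1]
  · rw [h2, e2]
  · rw [h3, e3]
  · rw [h4, e4]
  · rw [h5, e5]
  · rw [h6, e6]
  · rw [h7, e7]
  · rw [h8, e8]
  · rw [h9, e9]
  · rw [h10, e10]
  · rw [h11, e11]
  · rw [h12, e12]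
  · rw [h13, e13]
  · rw [h14, e14]
  · rw [h15, e15]
  · rw [h16, e16]
  · rw [h17, e17]
  · rw [h18, e18]

theorem isSpinConst_quaternionic (ν : ℝ) : IsSpinConst
    (fun i j k => ν * (quaternionicConst i j k : ℝ)) (fun a b => if a = b then ν else 0) 0 := by
  have hz : ∀ i j k, 3 < i → quaternionicConst i j k = 0 := by decide +kernel
  have hi : ∀ i j k, k < 4 → quaternionicConst i j k = 0 := by decide +kernel
  constructor
  case swap =>
    intro i j k
    rw [quaternionicConst_swap i j k]
    push_cast
    ring
  case central => exact fun i j k h => by simp [hz i j k h]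
  case range => exact fun i j k h => by simp [hi i j k h]
  all_goals simp [quaternionicConst, planeForm]

theorem isSpinConst_free (ν : ℝ) : IsSpinConst (fun i j k => ν * (freeConst i j k : ℝ))
    (fun a b => if a = b then ν else 0) (fun a b => if a = b then -ν else 0) := by
  have hz : ∀ i j k, 3 < i → freeConst i j k = 0 := by decide +kernel
  have hi : ∀ i j k, k < 4 → freeConst i j k = 0 := by decide +kernel
  constructor
  case swap =>
    intro i j k
    rw [freeConst_swap i j k]
    push_cast
    ring
  case central => exact fun i j k h => by simp [hz i j k h]
  case range => exact fun i j k h => by simp [hi i j k h]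
  all_goals simp [freeConst, planeForm]
  all_goals ring

variable {m : ℝ}

/-- If moreover `f₀` is central, then `Y = -m`, which is the free `2`-step nilpotent algebra. -/
theorem IsSpinConst.eq_free (h : IsSpinConst c (fun a b => if a = b then m else 0) Y)
    (h0 : ∀ j k, c 0 j k = 0) : c = fun i j k => m * (freeConst i j k : ℝ) := by
  have hY : Y = fun a b => if a = b then -m else 0 := by
    have h14 := h.c014
    have h24 := h.c024
    have h34 := h.c034
    have h15 := h.c015
    have h25 := h.c025
    have h35 := h.c035
    have h16 := h.c016
    have h26 := h.c026
    have h36 := h.c036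
    simp [h0] at h14 h24 h34 h15 h25 h35 h16 h26 h36
    funext a b
    fin_cases a <;> fin_cases b <;> simp <;> linarith
  subst hY
  exact h.eq (isSpinConst_free m)

/-- The relations `y₂ × y₃ = -m y₁` (and cyclically) between the rows of a matrix. -/
def CrossRelations (m : ℝ) (Y : Fin 3 → Fin 3 → ℝ) : Prop :=
  (Y 1 1 * Y 2 2 - Y 1 2 * Y 2 1 = -m * Y 0 0 ∧ Y 1 2 * Y 2 0 - Y 1 0 * Y 2 2 = -m * Y 0 1 ∧
    Y 1 0 * Y 2 1 - Y 1 1 * Y 2 0 = -m * Y 0 2) ∧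
  (Y 2 1 * Y 0 2 - Y 2 2 * Y 0 1 = -m * Y 1 0 ∧ Y 2 2 * Y 0 0 - Y 2 0 * Y 0 2 = -m * Y 1 1 ∧
    Y 2 0 * Y 0 1 - Y 2 1 * Y 0 0 = -m * Y 1 2) ∧
  Y 0 1 * Y 1 2 - Y 0 2 * Y 1 1 = -m * Y 2 0 ∧ Y 0 2 * Y 1 0 - Y 0 0 * Y 1 2 = -m * Y 2 1 ∧
    Y 0 0 * Y 1 1 - Y 0 1 * Y 1 0 = -m * Y 2 2

theorem IsSpinConst.exists_crossRelations {t : Fin 7 → Fin 7 → Fin 7 → ℝ} {κ : ℝ}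
    (h : IsSpinConst c X Y) (hd : CoclosedRelations c) (ht : TorsionRelations c t κ)
    (hI : InstantonEquations (curvCoeff c t)) :
    ∃ m, X = (fun a b => if a = b then m else 0) ∧ CrossRelations m Y := by
  refine ⟨X 0 0, ?_, h.cross hd ht hI⟩
  obtain ⟨h1, h2, h3, h4, h5, h6, h7, h8⟩ := h.coeff_eq hd ht hI
  funext a b
  fin_cases a <;> fin_cases b <;> simp [*]

/-- A nonzero matrix with `y₂ × y₃ = -m y₁` (and cyclically), `m ≠ 0`, is `|m|` times an orthogonal
matrix. -/
theorem CrossRelations.orthogonal (h : CrossRelations m Y) (hm : m ≠ 0) (hY : Y ≠ 0) :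
    (Y 0 0 ^ 2 + Y 0 1 ^ 2 + Y 0 2 ^ 2 = m ^ 2 ∧ Y 1 0 ^ 2 + Y 1 1 ^ 2 + Y 1 2 ^ 2 = m ^ 2 ∧
      Y 2 0 ^ 2 + Y 2 1 ^ 2 + Y 2 2 ^ 2 = m ^ 2) ∧
    Y 0 0 * Y 1 0 + Y 0 1 * Y 1 1 + Y 0 2 * Y 1 2 = 0 ∧
    Y 0 0 * Y 2 0 + Y 0 1 * Y 2 1 + Y 0 2 * Y 2 2 = 0 ∧
    Y 1 0 * Y 2 0 + Y 1 1 * Y 2 1 + Y 1 2 * Y 2 2 = 0 := by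
  obtain ⟨⟨a1, a2, a3⟩, ⟨b1, b2, b3⟩, d1, d2, d3⟩ := h
  have e1 : Y 0 0 * Y 1 0 + Y 0 1 * Y 1 1 + Y 0 2 * Y 1 2 = 0 :=
    mul_left_cancel₀ hm (by linear_combination Y 1 0 * a1 + Y 1 1 * a2 + Y 1 2 * a3)
  have e2 : Y 0 0 * Y 2 0 + Y 0 1 * Y 2 1 + Y 0 2 * Y 2 2 = 0 :=
    mul_left_cancel₀ hm (by linear_combination Y 2 0 * a1 + Y 2 1 * a2 + Y 2 2 * a3)
  have e3 : Y 1 0 * Y 2 0 + Y 1 1 * Y 2 1 + Y 1 2 * Y 2 2 = 0 :=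
    mul_left_cancel₀ hm (by linear_combination Y 2 0 * b1 + Y 2 1 * b2 + Y 2 2 * b3)
  -- all rows have the same length, since each `-m |yᵢ|²` is the determinant
  have n1 : Y 0 0 ^ 2 + Y 0 1 ^ 2 + Y 0 2 ^ 2 = Y 1 0 ^ 2 + Y 1 1 ^ 2 + Y 1 2 ^ 2 := by
    apply mul_left_cancel₀ hm
    linear_combination Y 0 0 * a1 + Y 0 1 * a2 + Y 0 2 * a3 - Y 1 0 * b1 - Y 1 1 * b2 - Y 1 2 * b3
  have n2 : Y 0 0 ^ 2 + Y 0 1 ^ 2 + Y 0 2 ^ 2 = Y 2 0 ^ 2 + Y 2 1 ^ 2 + Y 2 2 ^ 2 := by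
    apply mul_left_cancel₀ hm
    linear_combination Y 0 0 * a1 + Y 0 1 * a2 + Y 0 2 * a3 - Y 2 0 * d1 - Y 2 1 * d2 - Y 2 2 * d3
  have n3 : Y 0 0 ^ 2 + Y 0 1 ^ 2 + Y 0 2 ^ 2 ≠ 0 := by
    intro h0
    have key : ∀ x y z : ℝ, x ^ 2 + y ^ 2 + z ^ 2 = 0 → x = 0 ∧ y = 0 ∧ z = 0 := by
      intro x y z h
      refine ⟨?_, ?_, ?_⟩ <;> rw [← pow_eq_zero_iff two_ne_zero] <;>
        linarith only [h, sq_nonneg x, sq_nonneg y, sq_nonneg z]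
    obtain ⟨p1, p2, p3⟩ := key _ _ _ h0
    obtain ⟨q1, q2, q3⟩ := key _ _ _ (n1.symm.trans h0)
    obtain ⟨r1, r2, r3⟩ := key _ _ _ (n2.symm.trans h0)
    apply hY
    funext a b
    fin_cases a <;> fin_cases b <;> assumption
  -- Lagrange's identity `|y₂ × y₃|² = |y₂|² |y₃|² - ⟨y₂, y₃⟩²`
  have n4 : Y 0 0 ^ 2 + Y 0 1 ^ 2 + Y 0 2 ^ 2 = m ^ 2 := by
    have hl : (Y 1 0 ^ 2 + Y 1 1 ^ 2 + Y 1 2 ^ 2) * (Y 2 0 ^ 2 + Y 2 1 ^ 2 + Y 2 2 ^ 2)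
        = m ^ 2 * (Y 0 0 ^ 2 + Y 0 1 ^ 2 + Y 0 2 ^ 2) := by
      linear_combination (Y 1 1 * Y 2 2 - Y 1 2 * Y 2 1 - m * Y 0 0) * a1
        + (Y 1 2 * Y 2 0 - Y 1 0 * Y 2 2 - m * Y 0 1) * a2
        + (Y 1 0 * Y 2 1 - Y 1 1 * Y 2 0 - m * Y 0 2) * a3
        + (Y 1 0 * Y 2 0 + Y 1 1 * Y 2 1 + Y 1 2 * Y 2 2) * e3
    rw [← n1, ← n2] at hl
    exact mul_right_cancel₀ n3 hl
  exact ⟨⟨n4, n1 ▸ n4, n2 ▸ n4⟩, e1, e2, e3⟩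

/-- The Lie algebra has a central vector in `span (f₀, …, f₃)`. Write `m I_a + N_a` for the skew
matrices of `de⁵, de⁶, de⁷`, where `I_a` is the self-dual and `N_a` the anti-self-dual part. The
triples `I_a` and `N_a / m` satisfy quaternion relations and commute with each other, so the matrix
`m + ∑ I_a N_a` is annihilated by all `m I_a + N_a`; it is nonzero, having trace `4 m`. -/
theorem IsSpinConst.exists_central (h : IsSpinConst c (fun a b => if a = b then m else 0) Y)
    (hc : CrossRelations m Y) (hm : m ≠ 0) (hY : Y ≠ 0) :
    ∃ q : Fin 7 → ℝ, q ≠ 0 ∧ (∀ i, 3 < i → q i = 0) ∧ ∀ j k, ∑ i, q i * c i j k = 0 := by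
  obtain ⟨⟨n1, n2, n3⟩, e1, e2, e3⟩ := hc.orthogonal hm hY
  obtain ⟨⟨a1, a2, a3⟩, ⟨b1, b2, b3⟩, d1, d2, d3⟩ := hc
  have hss : ∀ i k, c i i k = 0 := fun i k => by linarith [h.swap i i k]
  have hst : ∀ i j k, j < i → c i j k = -c j i k := fun i j k _ => h.swap i j k
  -- the first four rows of `m + ∑ I_a N_a`
  obtain ⟨Q, hQ⟩ : ∃ Q : Matrix (Fin 4) (Fin 7) ℝ, Q =
      !![m - Y 0 0 - Y 1 1 - Y 2 2, Y 1 0 - Y 0 1, Y 2 1 - Y 1 2, Y 2 0 - Y 0 2, 0, 0, 0;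
        Y 1 0 - Y 0 1, m + Y 0 0 + Y 1 1 - Y 2 2, -Y 0 2 - Y 2 0, Y 1 2 + Y 2 1, 0, 0, 0;
        Y 2 1 - Y 1 2, -Y 0 2 - Y 2 0, m - Y 0 0 + Y 1 1 + Y 2 2, Y 0 1 + Y 1 0, 0, 0, 0;
        Y 2 0 - Y 0 2, Y 1 2 + Y 2 1, Y 0 1 + Y 1 0, m + Y 0 0 - Y 1 1 + Y 2 2, 0, 0, 0] :=
    ⟨_, rfl⟩
  have hker : ∀ r j k, ∑ i, Q r i * c i j k = 0 := by
    intro r j k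
    by_cases hk : k < 4
    · simp [h.range _ _ k hk]
    by_cases hj : 3 < j
    · simp [h.swap _ j, h.central j _ k hj]
    have hj' : j = 0 ∨ j = 1 ∨ j = 2 ∨ j = 3 := by omega
    have hk' : k = 4 ∨ k = 5 ∨ k = 6 := by omega
    obtain ⟨-, -, -, h1, h2, h3, h4, h5, h6, h7, h8, h9, h10, h11, h12, h13, h14, h15, h16, h17,
      h18⟩ := h
    subst hQ
    rcases hk' with rfl | rfl | rfl <;> rcases hj' with rfl | rfl | rfl | rfl <;>
      fin_cases r <;>
      simp [Fin.sum_univ_seven, hss, hst, h1, h2, h3, h4, h5, h6, h7, h8, h9, h10, h11, h12, h13,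
        h14, h15, h16, h17, h18] <;>
      linarith only [a1, a2, a3, b1, b2, b3, d1, d2, d3, e1, e2, e3, n1, n2, n3]
  have htr : Q 0 0 + Q 1 1 + Q 2 2 + Q 3 3 = 4 * m := by
    simp [hQ]
    ring
  obtain ⟨r, i, hr⟩ : ∃ r i, Q r i ≠ 0 := by
    by_contra! h0
    rw [h0, h0, h0, h0] at htr
    exact hm (by linarith)
  refine ⟨Q r, fun h0 => hr (by rw [h0]; rfl), fun i hi => ?_, hker r⟩
  have hi' : i = 4 ∨ i = 5 ∨ i = 6 := by omega
  subst hQ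
  rcases hi' with rfl | rfl | rfl <;> fin_cases r <;> rfl

/-- If `m = 0`, the rows of `Y` are parallel, so that `de⁶` and `de⁷` are linearly dependent. -/
theorem IsSpinConst.exists_dependent (h : IsSpinConst c (fun a b => if a = b then m else 0) Y)
    (hc : CrossRelations m Y) (hm : m = 0) :
    ∃ p q : ℝ, (p ≠ 0 ∨ q ≠ 0) ∧ ∀ i j, p * c i j 5 + q * c i j 6 = 0 := by
  subst hm
  obtain ⟨p, q, hpq, hY⟩ : ∃ p q : ℝ, (p ≠ 0 ∨ q ≠ 0) ∧ ∀ a, p * Y 1 a + q * Y 2 a = 0 := by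
    obtain ⟨⟨a1, a2, a3⟩, -, -⟩ := hc
    by_cases h0 : ∀ a, Y 1 a = 0
    · exact ⟨1, 0, Or.inl one_ne_zero, fun a => by simp [h0]⟩
    · push Not at h0
      obtain ⟨b, hb⟩ := h0
      refine ⟨-Y 2 b, Y 1 b, Or.inr hb, fun a => ?_⟩
      fin_cases a <;> fin_cases b <;> simp <;> linarith only [a1, a2, a3]
  refine ⟨p, q, hpq, fun i j => ?_⟩
  have key : (fun i j => p * c i j 5 + q * c i j 6) = fun _ _ => 0 := by
    refine eq_of_swap (fun i j => ?_) (fun _ _ => by simp) fun i j hij => ?_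
    · rw [h.swap i j 5, h.swap i j 6]
      ring
    by_cases hj : 3 < j
    · rw [h.swap, h.swap i j, h.central j _ _ hj, h.central j _ _ hj]
      ring
    have hij' : (i = 0 ∧ j = 1) ∨ (i = 0 ∧ j = 2) ∨ (i = 0 ∧ j = 3) ∨ (i = 1 ∧ j = 2) ∨
      (i = 1 ∧ j = 3) ∨ (i = 2 ∧ j = 3) := by omega
    have y0 := hY 0
    have y1 := hY 1
    have y2 := hY 2
    rcases hij' with ⟨rfl, rfl⟩ | ⟨rfl, rfl⟩ | ⟨rfl, rfl⟩ | ⟨rfl, rfl⟩ | ⟨rfl, rfl⟩ | ⟨rfl, rfl⟩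
    · rw [h.c015, h.c016]
      simp
      linarith only [y2]
    · rw [h.c025, h.c026]
      simp
      linarith only [y0]
    · rw [h.c035, h.c036]
      simp
      linarith only [y1]
    · rw [h.c125, h.c126]
      simp
      linarith only [y1]
    · rw [h.c135, h.c136]
      simp
      linarith only [y0]
    · rw [h.c235, h.c236]
      simp
      linarith only [y2]
  exact congrFun (congrFun key i) j

end SpinNormalForms

/-! ### The cross product -/

namespace G2Structure

section Cross

variable {V : Type*} [AddCommGroup V] [Module ℝ V] (S : G2Structure V)

/-- The cross product of a `G₂`-structure, `g(x × y, z) = φ(x, y, z)`. -/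
def cross (x y : V) : V :=
  haveI := S.finiteDimensional
  (S.metric.toDual S.nondegenerate).symm
    { toFun := fun z => S.φ ![x, y, z]
      map_add' := fun z w => apply_add₂ S.φ x y z w
      map_smul' := fun c z => apply_smul₂ S.φ c x y z }

theorem metric_cross (x y z : V) : S.metric (S.cross x y) z = S.φ ![x, y, z] := by
  have := S.finiteDimensional
  exact LinearMap.BilinForm.apply_toDual_symm_apply (hB := S.nondegenerate) _ _

theorem ext_metric {x y : V} (h : ∀ z, S.metric x z = S.metric y z) : x = y := by
  have := S.finiteDimensional
  refine (S.metric.toDual S.nondegenerate).injective ?_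
  ext z
  exact h z

theorem φ_swap_left (x y z : V) : S.φ ![y, x, z] = -S.φ ![x, y, z] := by
  have h := S.φ.map_swap ![x, y, z] (i := 0) (j := 1) (by decide)
  rw [← h]
  congr 1
  ext i
  fin_cases i <;> rfl

theorem φ_swap_right (x y z : V) : S.φ ![x, z, y] = -S.φ ![x, y, z] := by
  have h := S.φ.map_swap ![x, y, z] (i := 1) (j := 2) (by decide)
  rw [← h]
  congr 1
  ext i
  fin_cases i <;> rfl

theorem φ_self_left (x y : V) : S.φ ![x, x, y] = 0 := by
  linarith [S.φ_swap_left x x y]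

theorem cross_swap (x y : V) : S.cross y x = -S.cross x y := by
  refine S.ext_metric fun z => ?_
  rw [map_neg, LinearMap.neg_apply, metric_cross, metric_cross, φ_swap_left]

theorem cross_neg (x y : V) : S.cross x (-y) = -S.cross x y := by
  refine S.ext_metric fun z => ?_
  have h := apply_smul₁ S.φ (-1) x y z
  rw [map_neg, LinearMap.neg_apply, metric_cross, metric_cross]
  simpa using h

theorem cross_neg_left (x y : V) : S.cross (-x) y = -S.cross x y := by
  rw [cross_swap, cross_neg, neg_neg, cross_swap]

set_option maxHeartbeats 1000000 in
/-- The polarized form of `x × (x × y) = -|x|² y + ⟨x, y⟩ x`. -/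
theorem metric_cross_cross_add (x y u v : V) :
    S.metric (S.cross x v) (S.cross y u) + S.metric (S.cross y v) (S.cross x u) =
      2 * S.metric x y * S.metric v u - S.metric x u * S.metric y v
        - S.metric x v * S.metric y u := by
  obtain ⟨f, hf⟩ := S.exists_isFrame
  have h : ∀ a b k, f.coord k (S.cross a b) = S.φ ![a, b, f k] := fun a b k => by
    rw [← hf.metric_right, metric_cross]
  have hφ : S.φ = stdForm f.coord := hf
  rw [hf.metric_apply (S.cross x v), hf.metric_apply (S.cross y v)]
  simp only [h, hφ, stdForm_apply, Basis.coord_self_apply, Fin.sum_univ_seven, hf.metric_apply x,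
    hf.metric_apply y, hf.metric_apply v]
  simp
  ring

variable {S}

theorem metric_cross_left (a b v : V) : S.metric (S.cross a b) v = -S.metric (S.cross a v) b := by
  rw [metric_cross, metric_cross, φ_swap_right]

theorem cross_cross_swap {a b c : V} (hab : S.metric a b = 0) (hac : S.metric a c = 0)
    (hbc : S.metric b c = 0) : S.cross a (S.cross b c) = -S.cross b (S.cross a c) := by
  refine S.ext_metric fun v => ?_
  have h := S.metric_cross_cross_add a b c v
  rw [map_neg, LinearMap.neg_apply, metric_cross_left, metric_cross_left b]
  rw [hab, hac, hbc] at h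
  linarith

theorem cross_cross_self {a b : V} (haa : S.metric a a = 1) (hab : S.metric a b = 0) :
    S.cross a (S.cross a b) = -b := by
  refine S.ext_metric fun v => ?_
  have h := S.metric_cross_cross_add a a b v
  rw [map_neg, LinearMap.neg_apply, metric_cross_left, S.metric_symm b v]
  rw [haa, hab] at h
  linarith

theorem metric_cross_self_left (a b : V) : S.metric (S.cross a b) a = 0 := by
  rw [metric_cross, φ_swap_right, φ_self_left, neg_zero]

theorem metric_cross_self_right (a b : V) : S.metric (S.cross a b) b = 0 := by
  rw [cross_swap, map_neg, LinearMap.neg_apply, metric_cross_self_left, neg_zero]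

theorem metric_cross_cross {a b : V} (haa : S.metric a a = 1) (hbb : S.metric b b = 1)
    (hab : S.metric a b = 0) : S.metric (S.cross a b) (S.cross a b) = 1 := by
  have h := S.metric_cross_cross_add a a b b
  rw [haa, hbb, hab] at h
  linarith

end Cross

end G2Structure

/-! ### Frames from orthonormal triples -/

namespace G2Structure

section Frames

variable {V : Type*} [AddCommGroup V] [Module ℝ V] {S : G2Structure V}

theorem exists_basis_of_orthonormal {g : Fin 7 → V}
    (hg : ∀ i j, S.metric (g i) (g j) = if i = j then 1 else 0) :
    ∃ f : Basis (Fin 7) ℝ V, ⇑f = g ∧ ∀ i, f.coord i = S.metric (g i) := by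
  have hli : LinearIndependent ℝ g := by
    rw [Fintype.linearIndependent_iff]
    intro a ha i
    have h := congrArg (S.metric (g i)) ha
    simpa [map_sum, hg] using h
  have := S.finiteDimensional
  let f := basisOfLinearIndependentOfCardEqFinrank hli (by rw [S.finrank_eq, Fintype.card_fin])
  have hf : ⇑f = g := coe_basisOfLinearIndependentOfCardEqFinrank hli _
  refine ⟨f, hf, fun i => f.ext fun j => ?_⟩
  rw [Basis.coord_self_apply, hf, hg]
  simp only [eq_comm]

/-- An orthonormal family with the multiplication table of the cross product of the model form is a
`G₂`-frame. -/
theorem exists_isFrame_of_cross {g : Fin 7 → V}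
    (hg : ∀ i j, S.metric (g i) (g j) = if i = j then 1 else 0)
    (h01 : S.cross (g 0) (g 1) = g 6)
    (h02 : S.cross (g 0) (g 2) = g 4)
    (h03 : S.cross (g 0) (g 3) = -g 5)
    (h04 : S.cross (g 0) (g 4) = -g 2)
    (h05 : S.cross (g 0) (g 5) = g 3)
    (h06 : S.cross (g 0) (g 6) = -g 1)
    (h12 : S.cross (g 1) (g 2) = -g 5)
    (h13 : S.cross (g 1) (g 3) = -g 4)
    (h14 : S.cross (g 1) (g 4) = g 3)
    (h15 : S.cross (g 1) (g 5) = g 2)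
    (h16 : S.cross (g 1) (g 6) = g 0)
    (h23 : S.cross (g 2) (g 3) = g 6)
    (h24 : S.cross (g 2) (g 4) = g 0)
    (h25 : S.cross (g 2) (g 5) = -g 1)
    (h26 : S.cross (g 2) (g 6) = -g 3)
    (h34 : S.cross (g 3) (g 4) = -g 1)
    (h35 : S.cross (g 3) (g 5) = -g 0)
    (h36 : S.cross (g 3) (g 6) = g 2)
    (h45 : S.cross (g 4) (g 5) = g 6)
    (h46 : S.cross (g 4) (g 6) = -g 5)
    (h56 : S.cross (g 5) (g 6) = g 4) :
    ∃ f : Basis (Fin 7) ℝ V, ⇑f = g ∧ S.IsFrame f := by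
  obtain ⟨f, hfg, hf⟩ := exists_basis_of_orthonormal hg
  refine ⟨f, hfg, ?_⟩
  have hφ : ∀ a b c, S.φ ![a, b, c] = S.metric (S.cross b c) a := fun a b c => by
    rw [metric_cross]
    linarith [S.φ_swap_left a b c, S.φ_swap_right b a c]
  refine AlternatingMap.ext_of_strictMono f fun K hK => ?_
  have hK3 : ⇑f ∘ K = ![f (K 0), f (K 1), f (K 2)] := by
    ext i
    fin_cases i <;> rfl
  have hlt : K 1 < K 2 := hK (by decide)
  rw [hK3, hφ]
  generalize f (K 0) = v
  generalize K 1 = i at hlt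
  generalize K 2 = j at hlt
  have key : [i, j] ∈ ([[0, 1], [0, 2], [0, 3], [0, 4], [0, 5], [0, 6], [1, 2], [1, 3], [1, 4], [1,
      5], [1, 6], [2, 3], [2, 4], [2, 5], [2, 6], [3, 4], [3, 5], [3, 6], [4, 5], [4, 6], [5,
      6]] : List (List (Fin 7))) := by
    clear v hK3 hK
    revert i j
    decide
  obtain ⟨e01, e02, e03, e04, e05, e06, e12, e13, e14, e15, e16, e23, e24, e25, e26, e34, e35, e36,
    e45, e46, e56⟩ := stdForm_basis_apply f v
  simp only [List.mem_cons, List.cons.injEq, and_true, List.not_mem_nil, or_false] at key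
  rcases key with ⟨rfl, rfl⟩ | ⟨rfl, rfl⟩ | ⟨rfl, rfl⟩ | ⟨rfl, rfl⟩ | ⟨rfl, rfl⟩ | ⟨rfl, rfl⟩
    | ⟨rfl, rfl⟩ | ⟨rfl, rfl⟩ | ⟨rfl, rfl⟩ | ⟨rfl, rfl⟩ | ⟨rfl, rfl⟩ | ⟨rfl, rfl⟩ | ⟨rfl, rfl⟩
    | ⟨rfl, rfl⟩ | ⟨rfl, rfl⟩ | ⟨rfl, rfl⟩ | ⟨rfl, rfl⟩ | ⟨rfl, rfl⟩ | ⟨rfl, rfl⟩ | ⟨rfl, rfl⟩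
    | ⟨rfl, rfl⟩
  · rw [e01, hfg, h01, hf]
  · rw [e02, hfg, h02, hf]
  · rw [e03, hfg, h03, map_neg, LinearMap.neg_apply, hf]
  · rw [e04, hfg, h04, map_neg, LinearMap.neg_apply, hf]
  · rw [e05, hfg, h05, hf]
  · rw [e06, hfg, h06, map_neg, LinearMap.neg_apply, hf]
  · rw [e12, hfg, h12, map_neg, LinearMap.neg_apply, hf]
  · rw [e13, hfg, h13, map_neg, LinearMap.neg_apply, hf]
  · rw [e14, hfg, h14, hf]
  · rw [e15, hfg, h15, hf]
  · rw [e16, hfg, h16, hf]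
  · rw [e23, hfg, h23, hf]
  · rw [e24, hfg, h24, hf]
  · rw [e25, hfg, h25, map_neg, LinearMap.neg_apply, hf]
  · rw [e26, hfg, h26, map_neg, LinearMap.neg_apply, hf]
  · rw [e34, hfg, h34, map_neg, LinearMap.neg_apply, hf]
  · rw [e35, hfg, h35, map_neg, LinearMap.neg_apply, hf]
  · rw [e36, hfg, h36, hf]
  · rw [e45, hfg, h45, hf]
  · rw [e46, hfg, h46, map_neg, LinearMap.neg_apply, hf]
  · rw [e56, hfg, h56, hf]

/-- Any orthonormal triple `x, y, z` with `φ(x, y, z) = 0` extends to a `G₂`-frame. -/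
theorem exists_isFrame_of_orthonormal {x y z : V} (hx : S.metric x x = 1) (hy : S.metric y y = 1)
    (hz : S.metric z z = 1) (hxy : S.metric x y = 0) (hxz : S.metric x z = 0)
    (hyz : S.metric y z = 0) (hφ : S.φ ![x, y, z] = 0) :
    ∃ f : Basis (Fin 7) ℝ V, S.IsFrame f ∧ f 5 = x ∧ f 6 = y ∧ f 0 = z := by
  have sw : ∀ a b, S.cross b a = -S.cross a b := S.cross_swap
  have sy : ∀ {a b}, S.metric a b = 0 → S.metric b a = 0 := fun {a b} h => by rw [S.metric_symm, h]
  -- the frame consists of `x, y, z`, `w = x × y` and the products of `z` with `x, y, w`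
  obtain ⟨w, hw⟩ : ∃ w, S.cross x y = w := ⟨_, rfl⟩
  have hww : S.metric w w = 1 := by rw [← hw]; exact metric_cross_cross hx hy hxy
  have hxw : S.metric x w = 0 := by rw [← hw]; exact sy (metric_cross_self_left x y)
  have hyw : S.metric y w = 0 := by rw [← hw]; exact sy (metric_cross_self_right x y)
  have hwz : S.metric w z = 0 := by rw [← hw, metric_cross, hφ]
  have hxcw : S.cross x w = -y := by rw [← hw]; exact cross_cross_self hx hxy
  have hycw : S.cross y w = x := by
    rw [← hw, sw y x, cross_neg, cross_cross_self hy (sy hxy), neg_neg]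
  obtain ⟨p, hp⟩ : ∃ p, S.cross x z = p := ⟨_, rfl⟩
  obtain ⟨q, hq⟩ : ∃ q, S.cross y z = q := ⟨_, rfl⟩
  obtain ⟨r, hr⟩ : ∃ r, S.cross w z = r := ⟨_, rfl⟩
  have hpp : S.metric p p = 1 := by rw [← hp]; exact metric_cross_cross hx hz hxz
  have hqq : S.metric q q = 1 := by rw [← hq]; exact metric_cross_cross hy hz hyz
  have hrr : S.metric r r = 1 := by rw [← hr]; exact metric_cross_cross hww hz hwz
  have hpx : S.metric p x = 0 := by rw [← hp]; exact metric_cross_self_left x z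
  have hpz : S.metric p z = 0 := by rw [← hp]; exact metric_cross_self_right x z
  have hqy : S.metric q y = 0 := by rw [← hq]; exact metric_cross_self_left y z
  have hqz : S.metric q z = 0 := by rw [← hq]; exact metric_cross_self_right y z
  have hrw : S.metric r w = 0 := by rw [← hr]; exact metric_cross_self_left w z
  have hrz : S.metric r z = 0 := by rw [← hr]; exact metric_cross_self_right w z
  have hpy : S.metric p y = 0 := by rw [← hp, metric_cross_left, hw, hwz, neg_zero]
  have hqx : S.metric q x = 0 := by
    rw [← hq, metric_cross_left, sw x y, hw, map_neg, LinearMap.neg_apply, hwz, neg_zero, neg_zero]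
  have hpw : S.metric p w = 0 := by
    rw [← hp, metric_cross_left, hxcw, map_neg, LinearMap.neg_apply, hyz, neg_zero, neg_zero]
  have hqw : S.metric q w = 0 := by rw [← hq, metric_cross_left, hycw, hxz, neg_zero]
  have hrx : S.metric r x = 0 := by
    rw [← hr, metric_cross_left, sw x w, hxcw, neg_neg, hyz, neg_zero]
  have hry : S.metric r y = 0 := by
    rw [← hr, metric_cross_left, sw y w, hycw, map_neg, LinearMap.neg_apply, hxz, neg_zero,
      neg_zero]
  have zp : S.cross z p = x := by
    rw [← hp, sw z x, cross_neg, cross_cross_self hz (sy hxz), neg_neg]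
  have zq : S.cross z q = y := by
    rw [← hq, sw z y, cross_neg, cross_cross_self hz (sy hyz), neg_neg]
  have zr : S.cross z r = w := by
    rw [← hr, sw z w, cross_neg, cross_cross_self hz (sy hwz), neg_neg]
  have xp : S.cross x p = -z := by rw [← hp]; exact cross_cross_self hx hxz
  have yq : S.cross y q = -z := by rw [← hq]; exact cross_cross_self hy hyz
  have wr : S.cross w r = -z := by rw [← hr]; exact cross_cross_self hww hwz
  have xq : S.cross x q = -r := by
    rw [← hq, sw z y, cross_neg, cross_cross_swap hxz hxy (sy hyz), hw, neg_neg, sw w z, hr]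
  have yp : S.cross y p = r := by
    rw [← hp, cross_cross_swap (sy hxy) hyz hxz, hq, xq, neg_neg]
  have xr : S.cross x r = q := by
    rw [← hr, sw z w, cross_neg, cross_cross_swap hxz hxw (sy hwz), hxcw, cross_neg, neg_neg,
      sw y z, hq, neg_neg]
  have wp : S.cross w p = -q := by
    rw [← hp, cross_cross_swap (sy hxw) hwz hxz, hr, xr]
  have yr : S.cross y r = -p := by
    rw [← hr, sw z w, cross_neg, cross_cross_swap hyz hyw (sy hwz), hycw, neg_neg, sw x z, hp]
  have wq : S.cross w q = p := by
    rw [← hq, cross_cross_swap (sy hyw) hwz hyz, hr, yr, neg_neg]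
  have pq : S.cross p q = -w := by
    rw [← hq, sw z y, cross_neg, cross_cross_swap hpz hpy (sy hyz), sw y p, yp, cross_neg, zr,
      neg_neg]
  have pr : S.cross p r = y := by
    rw [← hr, sw z w, cross_neg, cross_cross_swap hpz hpw (sy hwz), sw w p, wp, neg_neg, neg_neg,
      zq]
  have qr : S.cross q r = -x := by
    rw [← hr, sw z w, cross_neg, cross_cross_swap hqz hqw (sy hwz), sw w q, wq, cross_neg, zp,
      neg_neg]
  have hpq : S.metric p q = 0 := by
    rw [← hq, sw z y, map_neg, S.metric_symm, metric_cross_left, S.metric_symm, zp]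
    simp [sy hxy, hxy]
  have hpr : S.metric p r = 0 := by
    rw [← hr, sw z w, map_neg, S.metric_symm, metric_cross_left, S.metric_symm, zp]
    simp [sy hxw, hxw]
  have hqr : S.metric q r = 0 := by
    rw [← hr, sw z w, map_neg, S.metric_symm, metric_cross_left, S.metric_symm, zq]
    simp [sy hyw, hyw]
  have hex := exists_isFrame_of_cross (S := S) (g := ![z, q, r, -p, w, x,
      y]) ?_ ?_ ?_ ?_ ?_ ?_ ?_ ?_ ?_ ?_ ?_ ?_ ?_ ?_ ?_ ?_ ?_ ?_ ?_ ?_ ?_ ?_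
  · obtain ⟨f, hf, hS⟩ := hex
    exact ⟨f, hS, by rw [hf]; rfl, by rw [hf]; rfl, by rw [hf]; rfl⟩
  · intro i j
    fin_cases i <;> fin_cases j <;> simp [*]
  · exact zq
  · exact zr
  · exact show S.cross z (-p) = -x by simp [cross_neg, zp]
  · exact show S.cross z w = -r by rw [sw w z]; simp [hr]
  · exact show S.cross z x = (-p) by rw [sw x z]; simp [hp]
  · exact show S.cross z y = -q by rw [sw y z]; simp [hq]
  · exact qr
  · exact show S.cross q (-p) = -w by rw [sw (-p) q]; simp [cross_neg_left, pq]
  · exact show S.cross q w = (-p) by rw [sw w q]; simp [wq]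
  · exact show S.cross q x = r by rw [sw x q]; simp [xq]
  · exact show S.cross q y = z by rw [sw y q]; simp [yq]
  · exact show S.cross r (-p) = y by rw [sw (-p) r]; simp [cross_neg_left, pr]
  · exact show S.cross r w = z by rw [sw w r]; simp [wr]
  · exact show S.cross r x = -q by rw [sw x r]; simp [xr]
  · exact show S.cross r y = -(-p) by rw [sw y r]; simp [yr]
  · exact show S.cross (-p) w = -q by rw [sw w (-p)]; simp [cross_neg, wp]
  · exact show S.cross (-p) x = -z by rw [sw x (-p)]; simp [cross_neg, xp]
  · exact show S.cross (-p) y = r by rw [sw y (-p)]; simp [cross_neg, yp]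
  · exact show S.cross w x = y by rw [sw x w]; simp [hxcw]
  · exact show S.cross w y = -x by rw [sw y w]; simp [hycw]
  · exact hw

end Frames

end G2Structure

/-! ### Principal axes and adapted frames -/

/-- A symmetric bilinear form on a Euclidean space has a unit vector `x` (a principal axis) that is
orthogonal for the form to the complement of `x`. -/
theorem exists_principal_axis {E : Type*} [NormedAddCommGroup E] [InnerProductSpace ℝ E]
    [FiniteDimensional ℝ E] [Nontrivial E] (q : LinearMap.BilinForm ℝ E)
    (hq : ∀ x y, q x y = q y x) :
    ∃ x : E, inner ℝ x x = 1 ∧ ∀ y, inner ℝ x y = 0 → q x y = 0 := by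
  let b := stdOrthonormalBasis ℝ E
  let T : E →ₗ[ℝ] E := ∑ i, (q.flip (b i)).smulRight (b i)
  have hT : ∀ x y, inner ℝ (T x) y = q x y := by
    intro x y
    conv_rhs => rw [← b.sum_repr' y, map_sum]
    simp only [T, LinearMap.sum_apply, LinearMap.smulRight_apply, LinearMap.flip_apply, sum_inner,
      inner_smul_left, map_smul, smul_eq_mul, conj_trivial]
    exact Finset.sum_congr rfl fun i _ => mul_comm _ _
  have hsymm : T.IsSymmetric := fun x y => by
    rw [hT, real_inner_comm, hT, hq]
  -- `x` is a normalised eigenvector of the symmetric operator representing `q`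
  obtain ⟨v, hv, hv0⟩ := hsymm.hasEigenvalue_iSup_of_finiteDimensional.exists_hasEigenvector
  rw [Module.End.mem_eigenspace_iff] at hv
  have hn : ‖v‖ ≠ 0 := norm_ne_zero_iff.mpr hv0
  refine ⟨‖v‖⁻¹ • v, ?_, fun y hy => ?_⟩
  · rw [real_inner_smul_left, real_inner_smul_right, real_inner_self_eq_norm_sq]
    field_simp
  · rw [← hT, map_smul, hv, real_inner_smul_left, real_inner_smul_left]
    rw [real_inner_smul_left] at hy
    rcases mul_eq_zero.mp hy with h | h
    · exact absurd h (inv_ne_zero hn)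
    · rw [h, mul_zero, mul_zero]

namespace G2Structure

section Euclidean

variable {V : Type*} [AddCommGroup V] [Module ℝ V] (S : G2Structure V)

/-- The metric of a `G₂`-structure as an inner product. -/
abbrev innerCore : InnerProductSpace.Core ℝ V where
  inner x y := S.metric x y
  conj_inner_symm x y := by
    rw [S.metric_symm]
    rfl
  re_inner_nonneg x := by
    rcases eq_or_ne x 0 with rfl | h
    · simp
    · exact (S.metric_pos x h).le
  add_left x y z := by simp
  smul_left x y r := by simp
  definite x h := by
    by_contra hx
    exact (S.metric_pos x hx).ne' h

theorem exists_principal_axis_mem (q : LinearMap.BilinForm ℝ V) (hq : ∀ x y, q x y = q y x)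
    (W : Submodule ℝ V) (hW : W ≠ ⊥) :
    ∃ x ∈ W, S.metric x x = 1 ∧ ∀ y ∈ W, S.metric x y = 0 → q x y = 0 := by
  let _ : NormedAddCommGroup V := S.innerCore.toNormedAddCommGroup
  let _ : InnerProductSpace ℝ V := InnerProductSpace.ofCore S.innerCore.toCore
  have := S.finiteDimensional
  have : Nontrivial W := Submodule.nontrivial_iff_ne_bot.mpr hW
  obtain ⟨x, hx, h⟩ := exists_principal_axis (E := W) (q.restrict W) (fun x y => hq x y)
  exact ⟨x, x.2, hx, fun y hy hxy => h ⟨y, hy⟩ hxy⟩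

theorem exists_smul_unit {x : V} (hx : x ≠ 0) :
    ∃ t : ℝ, t ≠ 0 ∧ S.metric (t • x) (t • x) = 1 := by
  have h := S.metric_pos x hx
  refine ⟨(Real.sqrt (S.metric x x))⁻¹, inv_ne_zero (Real.sqrt_pos.mpr h).ne', ?_⟩
  simp only [map_smul, LinearMap.smul_apply, smul_eq_mul]
  rw [← mul_assoc, ← mul_inv, Real.mul_self_sqrt h.le, inv_mul_cancel₀ h.ne']

theorem exists_unit_orthogonal {W : Submodule ℝ V} {n : ℕ} (hn : n < finrank ℝ W)
    (s : Fin n → V) : ∃ z ∈ W, S.metric z z = 1 ∧ ∀ i, S.metric (s i) z = 0 := by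
  have := S.finiteDimensional
  let L : W →ₗ[ℝ] Fin n → ℝ := LinearMap.pi fun i => (S.metric (s i)).comp W.subtype
  have hL : LinearMap.ker L ≠ ⊥ := LinearMap.ker_ne_bot_of_finrank_lt (by simpa using hn)
  obtain ⟨z, hz, hz0⟩ := Submodule.exists_mem_ne_zero_of_ne_bot hL
  have hz1 : (z : V) ≠ 0 := fun h => hz0 (Subtype.ext h)
  obtain ⟨t, -, ht⟩ := S.exists_smul_unit hz1
  refine ⟨t • (z : V), W.smul_mem t z.2, ht, fun i => ?_⟩
  have := congrFun hz i
  rw [map_smul, smul_eq_mul, show S.metric (s i) z = 0 from this, mul_zero]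

theorem exists_unit_orthogonal_top {n : ℕ} (hn : n < 7) (s : Fin n → V) :
    ∃ z, S.metric z z = 1 ∧ ∀ i, S.metric (s i) z = 0 := by
  obtain ⟨z, -, h⟩ := S.exists_unit_orthogonal (W := ⊤) (by rwa [finrank_top, S.finrank_eq]) s
  exact ⟨z, h⟩

variable {S} {f : Basis (Fin 7) ℝ V}

theorem IsFrame.metric_basis (hf : S.IsFrame f) (i j : Fin 7) :
    S.metric (f i) (f j) = if i = j then 1 else 0 := by
  rw [hf.metric_left, Basis.coord_self_apply]
  simp only [eq_comm]

theorem φ_neg_middle (x y z : V) : S.φ ![x, -y, z] = -S.φ ![x, y, z] := by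
  simpa using apply_smul₁ S.φ (-1) x y z

theorem IsFrame.φ_basis (hf : S.IsFrame f) (w : V) :
    S.φ ![w, f 0, f 2] = f.coord 4 w ∧ S.φ ![w, f 0, f 3] = -f.coord 5 w ∧
    S.φ ![w, f 0, f 4] = -f.coord 2 w ∧
    S.φ ![w, f 0, f 5] = f.coord 3 w ∧ S.φ ![w, f 3, f 5] = -f.coord 0 w ∧
    S.φ ![w, f 4, f 5] = f.coord 6 w ∧
    S.φ ![w, f 5, f 6] = f.coord 4 w := by
  have h := stdForm_basis_apply f w
  rw [← show S.φ = stdForm f.coord from hf] at h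
  tauto

theorem exists_isFrame_five_six {x y : V} (hx : S.metric x x = 1) (hy : S.metric y y = 1)
    (hxy : S.metric x y = 0) : ∃ f : Basis (Fin 7) ℝ V, S.IsFrame f ∧ f 5 = x ∧ f 6 = y := by
  obtain ⟨z, hz, h⟩ := S.exists_unit_orthogonal_top (n := 3) (by norm_num) ![x, y, S.cross x y]
  have h2 : S.φ ![x, y, z] = 0 := by rw [← metric_cross]; exact h 2
  obtain ⟨f, hf, h5, h6, -⟩ := exists_isFrame_of_orthonormal hx hy hz hxy (h 0) (h 1) h2
  exact ⟨f, hf, h5, h6⟩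

theorem exists_isFrame_three_five_six {x y z : V} (hx : S.metric x x = 1)
    (hy : S.metric y y = 1) (hz : S.metric z z = 1) (hxy : S.metric x y = 0)
    (hxz : S.metric x z = 0) (hyz : S.metric y z = 0) (hφ : S.φ ![x, y, z] = 0) :
    ∃ f : Basis (Fin 7) ℝ V, S.IsFrame f ∧ f 5 = x ∧ f 6 = y ∧ f 3 = z := by
  obtain ⟨g, hg, h5, h6, h0⟩ := exists_isFrame_of_orthonormal hx hy hz hxy hxz hyz hφ
  obtain ⟨f, hf, k5, k6, k0⟩ := exists_isFrame_of_orthonormal (S := S) (x := g 5) (y := g 6)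
    (z := -g 3) (by simp [hg.metric_basis]) (by simp [hg.metric_basis])
    (by simp [hg.metric_basis]) (by simp [hg.metric_basis]) (by simp [hg.metric_basis])
    (by simp [hg.metric_basis]) (by
      have := (hg.φ_basis (g 3)).2.2.2.2.2.2
      rw [← metric_cross, map_neg, metric_cross, S.φ_swap_right, S.φ_swap_left, this]
      simp)
  refine ⟨f, hf, k5.trans h5, k6.trans h6, ?_⟩
  rw [← h0]
  refine S.ext_metric fun v => ?_
  rw [hf.metric_left, hg.metric_left, ← (hf.φ_basis v).2.2.2.1, k0, k5]
  rw [φ_neg_middle, (hg.φ_basis v).2.2.2.2.1, neg_neg]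

theorem exists_isFrame_zero_two_six {a b c : V} (ha : S.metric a a = 1)
    (hb : S.metric b b = 1) (hc : S.metric c c = 1) (hab : S.metric a b = 0)
    (hac : S.metric a c = 0) (hbc : S.metric b c = 0) (hφ : S.φ ![a, b, c] = 0) :
    ∃ f : Basis (Fin 7) ℝ V, S.IsFrame f ∧ f 0 = a ∧ f 2 = b ∧ f 6 = c := by
  obtain ⟨h, hh, h5, h6, h0⟩ := exists_isFrame_of_orthonormal ha hb hc hab hac hbc hφ
  obtain ⟨g, hg, k5, k6, k0⟩ := exists_isFrame_of_orthonormal (S := S) (x := -h 2) (y := h 0)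
    (z := h 5) (by simp [hh.metric_basis]) (by simp [hh.metric_basis])
    (by simp [hh.metric_basis]) (by simp [hh.metric_basis]) (by simp [hh.metric_basis])
    (by simp [hh.metric_basis]) (by
      have := (hh.φ_basis (h 2)).2.2.2.1
      rw [← metric_cross, cross_neg_left, map_neg, LinearMap.neg_apply, metric_cross, this]
      simp)
  have h4 : g 4 = h 4 := by
    refine S.ext_metric fun v => ?_
    rw [hg.metric_left, hh.metric_left, ← (hg.φ_basis v).2.2.2.2.2.2, k5, k6, φ_neg_middle,
      S.φ_swap_right, neg_neg, (hh.φ_basis v).1]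
  refine ⟨g, hg, k0.trans h5, ?_, k6.trans h0⟩
  rw [← h6]
  refine S.ext_metric fun v => ?_
  rw [hg.metric_left, hh.metric_left, ← (hh.φ_basis v).2.2.2.2.2.1, ← h4, ← k0, S.φ_swap_right,
    (hg.φ_basis v).2.2.1, neg_neg]

end Euclidean

end G2Structure

/-! ### The derived algebra -/

section DerivedSpan

/-- The span of the brackets of a Lie algebra, as a plain subspace. -/
def derivedSpan (𝔤 : Type*) [LieRing 𝔤] [LieAlgebra ℝ 𝔤] : Submodule ℝ 𝔤 :=
  Submodule.span ℝ {v | ∃ x y : 𝔤, ⁅x, y⁆ = v}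

variable {𝔤 : Type*} [LieRing 𝔤] [LieAlgebra ℝ 𝔤]

theorem lie_mem_derivedSpan (x y : 𝔤) : ⁅x, y⁆ ∈ derivedSpan 𝔤 :=
  Submodule.subset_span ⟨x, y, rfl⟩

theorem lie_eq_zero_of_mem_derivedSpan (hz : ∀ x y z : 𝔤, ⁅⁅x, y⁆, z⁆ = 0) {v : 𝔤}
    (hv : v ∈ derivedSpan 𝔤) (z : 𝔤) : ⁅v, z⁆ = 0 := by
  induction hv using Submodule.span_induction with
  | mem x h =>
    obtain ⟨a, b, rfl⟩ := h
    exact hz a b z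
  | zero => simp
  | add x y _ _ hx hy => rw [add_lie, hx, hy, add_zero]
  | smul a x _ hx => rw [smul_lie, hx, smul_zero]

theorem derivedSpan_le_ker (f : Basis (Fin 7) ℝ 𝔤) (ξ : Dual ℝ 𝔤)
    (h : ∀ i j, i < j → ξ ⁅f i, f j⁆ = 0) : derivedSpan 𝔤 ≤ LinearMap.ker ξ := by
  have h' : ∀ i j, ξ ⁅f i, f j⁆ = 0 := fun i j => by
    rcases lt_trichotomy i j with hij | rfl | hij
    · exact h i j hij
    · simp
    · rw [← lie_skew, map_neg, h j i hij, neg_zero]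
  have h0 : (LieModule.toEnd ℝ 𝔤 𝔤 : 𝔤 →ₗ[ℝ] 𝔤 →ₗ[ℝ] 𝔤).compr₂ ξ = 0 :=
    f.ext fun i => f.ext fun j => h' i j
  refine Submodule.span_le.mpr ?_
  rintro _ ⟨x, y, rfl⟩
  exact LinearMap.congr_fun (LinearMap.congr_fun h0 x) y

end DerivedSpan

namespace G2Structure

section Structure

variable {𝔤 : Type*} [LieRing 𝔤] [LieAlgebra ℝ 𝔤] {f : Basis (Fin 7) ℝ 𝔤}

theorem structConst_swap (f : Basis (Fin 7) ℝ 𝔤) (i j k : Fin 7) :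
    structConst f i j k = -structConst f j i k := by
  rw [structConst, structConst, ← lie_skew, map_neg]

theorem structConst_ne_zero (hne : ∃ x y : 𝔤, ⁅x, y⁆ ≠ 0) (f : Basis (Fin 7) ℝ 𝔤) :
    structConst f ≠ 0 := by
  intro h
  obtain ⟨x, y, hxy⟩ := hne
  refine hxy (f.ext_elem fun k => ?_)
  have h1 := derivedSpan_le_ker f (f.coord k)
    (fun i j _ => congrFun (congrFun (congrFun h i) j) k) (lie_mem_derivedSpan x y)
  rw [map_zero]
  exact h1

theorem lie_eq_zero_of_structConst {i : Fin 7} (h : ∀ j k, structConst f i j k = 0) (y : 𝔤) :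
    ⁅f i, y⁆ = 0 := by
  have h0 : (LieModule.toEnd ℝ 𝔤 𝔤 (f i) : 𝔤 →ₗ[ℝ] 𝔤) = 0 := f.ext fun j =>
    f.ext_elem fun k => by simpa [structConst] using h j k
  exact LinearMap.congr_fun h0 y

theorem structConst_eq_zero_of_lie {i : Fin 7} (h : ∀ y : 𝔤, ⁅f i, y⁆ = 0) (j k : Fin 7) :
    structConst f i j k = 0 := by
  rw [structConst, h, map_zero]

end Structure

section Orthonormal

variable {V : Type*} [AddCommGroup V] [Module ℝ V] (S : G2Structure V)

/-- An orthonormal system in a subspace either spans it or extends by a vector of the subspace. -/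
theorem eq_sum_or_exists_unit (W : Submodule ℝ V) {n : ℕ} (b : Fin n → V)
    (hbW : ∀ i, b i ∈ W) (hb : ∀ i j, S.metric (b i) (b j) = if i = j then 1 else 0) :
    (∀ v ∈ W, v = ∑ i, S.metric (b i) v • b i) ∨
      ∃ z ∈ W, S.metric z z = 1 ∧ ∀ i, S.metric (b i) z = 0 := by
  by_cases h : ∀ v ∈ W, v = ∑ i, S.metric (b i) v • b i
  · exact Or.inl h
  push Not at h
  obtain ⟨v, hv, hne⟩ := h
  obtain ⟨t, -, ht⟩ := S.exists_smul_unit (sub_ne_zero.mpr hne)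
  refine Or.inr ⟨_, W.smul_mem t (W.sub_mem hv (W.sum_mem fun i _ => W.smul_mem _ (hbW i))), ht,
    fun i => ?_⟩
  simp [hb]

end Orthonormal

section TwoStep

variable {𝔤 : Type*} [LieRing 𝔤] [LieAlgebra ℝ 𝔤] {S : G2Structure 𝔤} {f : Basis (Fin 7) ℝ 𝔤}

/-- The derived algebra of a `2`-step nilpotent Lie algebra of dimension seven is at most
three-dimensional: otherwise the brackets of the three remaining basis vectors would have to
span a space of dimension four. -/
theorem eq_sum_of_orthonormal_three (hz : ∀ x y z : 𝔤, ⁅⁅x, y⁆, z⁆ = 0) {b : Fin 3 → 𝔤}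
    (hbD : ∀ i, b i ∈ derivedSpan 𝔤) (hb : ∀ i j, S.metric (b i) (b j) = if i = j then 1 else 0) :
    ∀ v ∈ derivedSpan 𝔤, v = ∑ i, S.metric (b i) v • b i := by
  rcases S.eq_sum_or_exists_unit _ b hbD hb with h | ⟨y, hy, hyy, hby⟩
  · exact h
  exfalso
  obtain ⟨z, hzz, hz'⟩ := S.exists_unit_orthogonal_top (n := 4) (by norm_num) ![b 0, b 1, b 2, y]
  obtain ⟨u, huu, hu⟩ := S.exists_unit_orthogonal_top (n := 5) (by norm_num) ![b 0, b 1, b 2, y, z]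
  obtain ⟨w, hww, hw⟩ := S.exists_unit_orthogonal_top (n := 6) (by norm_num)
    ![b 0, b 1, b 2, y, z, u]
  have hlt : ∀ i j, i < j → S.metric (![b 0, b 1, b 2, y, z, u, w] i)
      (![b 0, b 1, b 2, y, z, u, w] j) = 0 := by
    intro i j hij
    have k1 := hz' 0
    have k2 := hz' 1
    have k3 := hz' 2
    have k4 := hz' 3
    have l1 := hu 0
    have l2 := hu 1
    have l3 := hu 2
    have l4 := hu 3
    have l5 := hu 4
    have m1 := hw 0
    have m2 := hw 1
    have m3 := hw 2
    have m4 := hw 3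
    have m5 := hw 4
    have m6 := hw 5
    have n1 := hby 0
    have n2 := hby 1
    have n3 := hby 2
    have o1 := hb 0 1
    have o2 := hb 0 2
    have o3 := hb 1 2
    clear hz' hu hw hby hb
    fin_cases i <;> fin_cases j <;> first | exact absurd hij (by decide) | assumption
  obtain ⟨g, hg, hgc⟩ := exists_basis_of_orthonormal (S := S)
    (g := ![b 0, b 1, b 2, y, z, u, w]) (by
      intro i j
      rcases lt_trichotomy i j with hij | rfl | hij
      · rw [hlt i j hij, if_neg hij.ne]
      · rw [if_pos rfl]
        have o1 := hb 0 0
        have o2 := hb 1 1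
        have o3 := hb 2 2
        fin_cases i <;> assumption
      · rw [S.metric_symm, hlt j i hij, if_neg hij.ne'])
  have hmem : ∀ i : Fin 4, g (Fin.castLE (by norm_num) i) ∈ derivedSpan 𝔤 := by
    intro i
    rw [hg]
    fin_cases i
    exacts [hbD 0, hbD 1, hbD 2, hy]
  have hli : LinearIndependent ℝ
      (fun i : Fin 4 => (⟨g (Fin.castLE (by norm_num) i), hmem i⟩ : derivedSpan 𝔤)) :=
    LinearIndependent.of_comp (derivedSpan 𝔤).subtype
      (g.linearIndependent.comp _ (Fin.castLE_injective (by norm_num)))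
  have := S.finiteDimensional
  have hrank := hli.fintype_card_le_finrank
  rw [Fintype.card_fin] at hrank
  obtain ⟨v, hv, hvv, hvb⟩ := S.exists_unit_orthogonal (W := derivedSpan 𝔤) (n := 3) hrank
    ![⁅g 4, g 5⁆, ⁅g 4, g 6⁆, ⁅g 5, g 6⁆]
  have hker := derivedSpan_le_ker g (S.metric v) (by
    intro i j hij
    by_cases hi : i < 4
    · have hi' : g i ∈ derivedSpan 𝔤 := hmem ⟨i, hi⟩
      rw [lie_eq_zero_of_mem_derivedSpan hz hi', map_zero]
    · rw [S.metric_symm]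
      have h3 : (i = 4 ∧ j = 5) ∨ (i = 4 ∧ j = 6) ∨ (i = 5 ∧ j = 6) := by omega
      rcases h3 with ⟨rfl, rfl⟩ | ⟨rfl, rfl⟩ | ⟨rfl, rfl⟩
      exacts [hvb 0, hvb 1, hvb 2])
  have h0 : S.metric v v = 0 := hker hv
  rw [hvv] at h0
  exact one_ne_zero h0

end TwoStep

end G2Structure

/-! ### Derived algebras of dimension two and three -/

/-- The normal forms of the structure constants in a `G₂`-frame for which the `G₂`-structure is
coclosed and `∇¹` is an instanton. -/
def IsInstantonConst (c : Fin 7 → Fin 7 → Fin 7 → ℝ) : Prop :=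
  (∃ a b : ℝ, ¬(a = 0 ∧ b = 0) ∧ c = heisenbergConst a b (-a - b)) ∨
  (∃ ν : ℝ, ν ≠ 0 ∧ c = fun i j k => ν * (quaternionicConst i j k : ℝ)) ∨
  ∃ ν : ℝ, ν ≠ 0 ∧ c = fun i j k => ν * (freeConst i j k : ℝ)

theorem heisenbergConst_zero : heisenbergConst 0 0 0 = 0 := by
  funext i j k
  simp [heisenbergConst]

/-- If the bracket takes values in the central plane spanned by `f₅` and `f₆`, then `dψ = 0` forces
`f₄ = f₅ × f₆` to be central as well. -/
theorem central_of_coclosed {c : Fin 7 → Fin 7 → Fin 7 → ℝ}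
    (hs : ∀ i j k, c i j k = -c j i k) (hz : ∀ i j k, 4 < i → c i j k = 0)
    (hi : ∀ i j k, k < 5 → c i j k = 0) (hd : CoclosedRelations c) :
    ∀ i j k, 3 < i → c i j k = 0 := by
  have hz' : ∀ i j k, 4 < j → c i j k = 0 := fun i j k h => by rw [hs, hz j i k h, neg_zero]
  have d1 := hd.d01245
  have d2 := hd.d01246
  have d3 := hd.d01345
  have d4 := hd.d01346
  have d5 := hd.d02345
  have d6 := hd.d02346
  have d7 := hd.d12345
  have d8 := hd.d12346
  have h44 : ∀ k, c 4 4 k = 0 := fun k => by linarith [hs 4 4 k]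
  simp [hi, hz'] at d1 d2 d3 d4 d5 d6 d7 d8
  intro i j k hlt
  by_cases hi4 : 4 < i
  · exact hz i j k hi4
  by_cases hk : k < 5
  · exact hi i j k hk
  by_cases hj : 4 < j
  · exact hz' i j k hj
  obtain rfl : i = 4 := by omega
  have hj' : j = 0 ∨ j = 1 ∨ j = 2 ∨ j = 3 ∨ j = 4 := by omega
  have hk' : k = 5 ∨ k = 6 := by omega
  rw [hs]
  rcases hk' with rfl | rfl <;> rcases hj' with rfl | rfl | rfl | rfl | rfl <;>
    linarith only [d1, d2, d3, d4, d5, d6, d7, d8, h44 5, h44 6]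

/-- A skew form with `f₅`, `f₆` and `s f₃ + C f₄` in its kernel is a `slantForm`. -/
theorem eq_slantForm {C s : ℝ} (hCs : C ^ 2 + s ^ 2 = 1) (hs0 : s ≠ 0) {B : Fin 7 → Fin 7 → ℝ}
    (hs : ∀ i j, B i j = -B j i) (h5 : ∀ j, B 5 j = 0) (h6 : ∀ j, B 6 j = 0)
    (h : ∀ j, C * B 4 j + s * B 3 j = 0) :
    B = slantForm C s ![B 0 1, B 0 2, B 1 2, C * B 0 3 - s * B 0 4, C * B 1 3 - s * B 1 4,
      C * B 2 3 - s * B 2 4] := by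
  have h5' : ∀ i, B i 5 = 0 := fun i => by rw [hs, h5, neg_zero]
  have h6' : ∀ i, B i 6 = 0 := fun i => by rw [hs, h6, neg_zero]
  have h34 : B 3 4 = 0 := by
    have h4 := h 4
    rw [show B 4 4 = 0 by linarith [hs 4 4], mul_zero, zero_add] at h4
    exact (mul_eq_zero.mp h4).resolve_left hs0
  have h0 := h 0
  have h1 := h 1
  have h2 := h 2
  rw [hs 4, hs 3] at h0 h1 h2
  refine eq_of_swap hs (slantForm_swap _ _ _) fun i j hij => ?_
  by_cases hj : 4 < j
  · have hj' : j = 5 ∨ j = 6 := by omega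
    rcases hj' with rfl | rfl
    · rw [h5']
      fin_cases i <;> simp [slantForm, planeForm]
    · rw [h6']
      fin_cases i <;> simp [slantForm, planeForm]
  have hij' : (i = 0 ∧ j = 1) ∨ (i = 0 ∧ j = 2) ∨ (i = 0 ∧ j = 3) ∨ (i = 0 ∧ j = 4) ∨
      (i = 1 ∧ j = 2) ∨ (i = 1 ∧ j = 3) ∨ (i = 1 ∧ j = 4) ∨ (i = 2 ∧ j = 3) ∨ (i = 2 ∧ j = 4) ∨
      (i = 3 ∧ j = 4) := by omega
  rcases hij' with ⟨rfl, rfl⟩ | ⟨rfl, rfl⟩ | ⟨rfl, rfl⟩ | ⟨rfl, rfl⟩ | ⟨rfl, rfl⟩ | ⟨rfl, rfl⟩ |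
    ⟨rfl, rfl⟩ | ⟨rfl, rfl⟩ | ⟨rfl, rfl⟩ | ⟨rfl, rfl⟩ <;> simp [slantForm, planeForm]
  · linear_combination -B 0 3 * hCs - s * h0
  · linear_combination -B 0 4 * hCs - C * h0
  · linear_combination -B 1 3 * hCs - s * h1
  · linear_combination -B 1 4 * hCs - C * h1
  · linear_combination -B 2 3 * hCs - s * h2
  · linear_combination -B 2 4 * hCs - C * h2
  · exact h34

namespace G2Structure

section Cases

variable {𝔤 : Type*} [LieRing 𝔤] [LieAlgebra ℝ 𝔤] {S : G2Structure 𝔤} {f : Basis (Fin 7) ℝ 𝔤}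

/-- If the derived algebra is contained in the central span of `f₄`, `f₅`, `f₆` and contains `f₅`
and `f₆`, the second or the third normal form is attained, possibly in a frame with a different
`f₀`. -/
theorem IsFrame.exists_isInstantonConst_of_spin (hf : S.IsFrame f)
    (hA : S.IsCoclosed ∧ S.IsInstanton (S.connection 1)) (hne : ∃ x y : 𝔤, ⁅x, y⁆ ≠ 0)
    (hz : ∀ i j k, 3 < i → structConst f i j k = 0)
    (hi : ∀ i j k, k < 4 → structConst f i j k = 0)
    (h5 : f 5 ∈ derivedSpan 𝔤) (h6 : f 6 ∈ derivedSpan 𝔤) :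
    ∃ g : Basis (Fin 7) ℝ 𝔤, S.IsFrame g ∧ IsInstantonConst (structConst g) := by
  obtain ⟨X, Y, h⟩ := exists_isSpinConst (structConst_swap f) hz hi
  obtain ⟨m, rfl, hc⟩ := h.exists_crossRelations (hf.isCoclosed_iff.mp hA.1) hf.torsionRelations
    (hf.isInstanton_iff.mp hA.2)
  by_cases hm : m = 0
  · -- a functional on `span (f₅, f₆)` would annihilate the derived algebra
    exfalso
    obtain ⟨p, q, hpq, hd⟩ := h.exists_dependent hc hm
    have hker := derivedSpan_le_ker f (p • f.coord 5 + q • f.coord 6) fun i j _ => hd i j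
    have e5 := hker h5
    have e6 := hker h6
    simp at e5 e6
    rcases hpq with hp | hq
    · exact hp e5
    · exact hq e6
  by_cases hY : Y = 0
  · subst hY
    exact ⟨f, hf, Or.inr (Or.inl ⟨m, hm, h.eq (isSpinConst_quaternionic m)⟩)⟩
  -- a new frame in which the additional central vector is a multiple of `f₀`
  obtain ⟨q, hq0, hq, hqc⟩ := h.exists_central hc hm hY
  obtain ⟨x, hx⟩ : ∃ x : 𝔤, x = ∑ i, q i • f i := ⟨_, rfl⟩
  have hcoord : ∀ k, f.coord k x = q k := fun k => by
    rw [hx]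
    simp [Finsupp.single_apply]
  have hx0 : x ≠ 0 := by
    rintro rfl
    exact hq0 (funext fun k => by rw [← hcoord k]; simp)
  have hcent : ∀ y : 𝔤, ⁅x, y⁆ = 0 := by
    intro y
    have h0 : (LieModule.toEnd ℝ 𝔤 𝔤 x : 𝔤 →ₗ[ℝ] 𝔤) = 0 := f.ext fun j => f.ext_elem fun k => by
      have := hqc j k
      simpa [structConst, hx, sum_lie] using this
    exact LinearMap.congr_fun h0 y
  obtain ⟨t, -, ht⟩ := S.exists_smul_unit hx0
  obtain ⟨g, hg, g5, g6, g0⟩ := exists_isFrame_of_orthonormal (S := S) (x := f 5) (y := f 6)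
    (z := t • x) (by simp [hf.metric_basis]) (by simp [hf.metric_basis]) ht
    (by simp [hf.metric_basis])
    (by rw [map_smul, hf.metric_left, hcoord, hq 5 (by decide), smul_zero])
    (by rw [map_smul, hf.metric_left, hcoord, hq 6 (by decide), smul_zero])
    (by
      rw [apply_smul₂, S.φ_swap_right, S.φ_swap_left, (hf.φ_basis x).2.2.2.2.2.2, hcoord,
        hq 4 (by decide)]
      simp)
  have g4 : g 4 = f 4 := S.ext_metric fun v => by
    rw [hg.metric_left, hf.metric_left, ← (hg.φ_basis v).2.2.2.2.2.2,
      ← (hf.φ_basis v).2.2.2.2.2.2, g5, g6]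
  have hgz : ∀ i j k, 3 < i → structConst g i j k = 0 := by
    intro i j k hlt
    have hi' : i = 4 ∨ i = 5 ∨ i = 6 := by omega
    have hgf : g i = f i := by rcases hi' with rfl | rfl | rfl <;> assumption
    exact structConst_eq_zero_of_lie
      (fun y => by rw [hgf]; exact lie_eq_zero_of_structConst (fun j k => hz i j k hlt) y) j k
  have hgi : ∀ i j k, k < 4 → structConst g i j k = 0 := by
    intro i j k hk
    have hv : ∀ l, l < 4 → f.coord l ⁅g i, g j⁆ = 0 := fun l hl =>
      derivedSpan_le_ker f (f.coord l) (fun i j _ => hi i j l hl) (lie_mem_derivedSpan _ _)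
    have hsum := f.sum_repr ⁅g i, g j⁆
    simp only [← Basis.coord_apply] at hsum
    rw [structConst, ← hsum, Fin.sum_univ_seven, hv 0 (by decide), hv 1 (by decide),
      hv 2 (by decide), hv 3 (by decide), ← g4, ← g5, ← g6]
    simp only [zero_smul, zero_add, map_add, map_smul, Basis.coord_self_apply, smul_eq_mul]
    have hk' : 4 ≠ k ∧ 5 ≠ k ∧ 6 ≠ k := by omega
    simp [hk'.1, hk'.2.1, hk'.2.2]
  obtain ⟨X', Y', h'⟩ := exists_isSpinConst (structConst_swap g) hgz hgi
  obtain ⟨m', rfl, -⟩ := h'.exists_crossRelations (hg.isCoclosed_iff.mp hA.1) hg.torsionRelations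
    (hg.isInstanton_iff.mp hA.2)
  have he := h'.eq_free fun j k => structConst_eq_zero_of_lie
    (fun y => by rw [g0, smul_lie, hcent, smul_zero]) j k
  refine ⟨g, hg, Or.inr (Or.inr ⟨m', ?_, he⟩)⟩
  rintro rfl
  refine structConst_ne_zero hne g (he.trans ?_)
  funext i j k
  simp

/-- The derived algebra is a plane, with orthonormal basis `b`. -/
theorem exists_isInstantonConst_of_two (hz : ∀ x y z : 𝔤, ⁅⁅x, y⁆, z⁆ = 0)
    (hA : S.IsCoclosed ∧ S.IsInstanton (S.connection 1)) (hne : ∃ x y : 𝔤, ⁅x, y⁆ ≠ 0)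
    {b : Fin 2 → 𝔤} (hbD : ∀ i, b i ∈ derivedSpan 𝔤)
    (hb : ∀ i j, S.metric (b i) (b j) = if i = j then 1 else 0)
    (hsum : ∀ v ∈ derivedSpan 𝔤, v = ∑ i, S.metric (b i) v • b i) :
    ∃ g : Basis (Fin 7) ℝ 𝔤, S.IsFrame g ∧ IsInstantonConst (structConst g) := by
  obtain ⟨f, hf, h5, h6⟩ := exists_isFrame_five_six (hb 0 0) (hb 1 1) (hb 0 1)
  have hcoord : ∀ i j k, k < 5 → structConst f i j k = 0 := by
    intro i j k hk
    have hk' : 5 ≠ k ∧ 6 ≠ k := by omega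
    rw [structConst, hsum _ (lie_mem_derivedSpan _ _), Fin.sum_univ_two, ← h5, ← h6, map_add,
      map_smul, map_smul, Basis.coord_self_apply, Basis.coord_self_apply, if_neg hk'.1,
      if_neg hk'.2]
    simp
  have hcent : ∀ i j k, 4 < i → structConst f i j k = 0 := by
    intro i j k hlt
    have hi' : i = 5 ∨ i = 6 := by omega
    refine structConst_eq_zero_of_lie (fun y => lie_eq_zero_of_mem_derivedSpan hz ?_ y) j k
    rcases hi' with rfl | rfl
    · exact h5 ▸ hbD 0
    · exact h6 ▸ hbD 1
  refine hf.exists_isInstantonConst_of_spin hA hne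
    (central_of_coclosed (structConst_swap f) hcent hcoord (hf.isCoclosed_iff.mp hA.1))
    (fun i j k hk => hcoord i j k (hk.trans (by decide))) (h5 ▸ hbD 0) (h6 ▸ hbD 1)

/-- The derived algebra is three-dimensional, with orthonormal basis `b`. Write `w = b₀ × b₁` and
`b₂ = C w + s z`. If `s = 0`, the derived algebra is spanned by a pair of vectors and their cross
product; the case `s ≠ 0` is excluded by `slant_eq_zero`. -/
theorem exists_isInstantonConst_of_three (hz : ∀ x y z : 𝔤, ⁅⁅x, y⁆, z⁆ = 0)
    (hA : S.IsCoclosed ∧ S.IsInstanton (S.connection 1)) (hne : ∃ x y : 𝔤, ⁅x, y⁆ ≠ 0)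
    {b : Fin 3 → 𝔤} (hbD : ∀ i, b i ∈ derivedSpan 𝔤)
    (hb : ∀ i j, S.metric (b i) (b j) = if i = j then 1 else 0) :
    ∃ g : Basis (Fin 7) ℝ 𝔤, S.IsFrame g ∧ IsInstantonConst (structConst g) := by
  have hsum := eq_sum_of_orthonormal_three hz hbD hb
  obtain ⟨w, hw⟩ : ∃ w, w = S.cross (b 0) (b 1) := ⟨_, rfl⟩
  have hww : S.metric w w = 1 := by rw [hw]; exact metric_cross_cross (hb 0 0) (hb 1 1) (hb 0 1)
  have hw0 : S.metric w (b 0) = 0 := by rw [hw]; exact metric_cross_self_left _ _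
  have hw1 : S.metric w (b 1) = 0 := by rw [hw]; exact metric_cross_self_right _ _
  have four : ∀ {f : Basis (Fin 7) ℝ 𝔤}, S.IsFrame f → f 5 = b 0 → f 6 = b 1 → f 4 = w :=
    fun {f} hf h5 h6 => S.ext_metric fun v => by
      rw [hf.metric_left, ← (hf.φ_basis v).2.2.2.2.2.2, hw, metric_cross, h5, h6,
        S.φ_swap_left (b 0) v, S.φ_swap_right (b 0) (b 1) v, neg_neg]
  obtain ⟨C, hC⟩ : ∃ C, C = S.metric w (b 2) := ⟨_, rfl⟩
  by_cases hr : b 2 - C • w = 0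
  · have h2 : b 2 = C • w := sub_eq_zero.mp hr
    have hC0 : C ≠ 0 := by
      rintro rfl
      have := hb 2 2
      rw [h2] at this
      simp at this
    obtain ⟨f, hf, h5, h6⟩ := exists_isFrame_five_six (hb 0 0) (hb 1 1) (hb 0 1)
    have h4 := four hf h5 h6
    refine hf.exists_isInstantonConst_of_spin hA hne ?_ ?_ (h5 ▸ hbD 0) (h6 ▸ hbD 1)
    · intro i j k hlt
      have hi' : i = 4 ∨ i = 5 ∨ i = 6 := by omega
      refine structConst_eq_zero_of_lie (fun y => lie_eq_zero_of_mem_derivedSpan hz ?_ y) j k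
      rcases hi' with rfl | rfl | rfl
      · rw [h4, ← inv_smul_smul₀ hC0 w, ← h2]
        exact Submodule.smul_mem _ _ (hbD 2)
      · exact h5 ▸ hbD 0
      · exact h6 ▸ hbD 1
    · intro i j k hk
      have hk' : 4 ≠ k ∧ 5 ≠ k ∧ 6 ≠ k := by omega
      rw [structConst, hsum _ (lie_mem_derivedSpan _ _), Fin.sum_univ_three, h2, ← h4, ← h5, ← h6]
      simp only [map_add, map_smul, Basis.coord_self_apply, if_neg hk'.1, if_neg hk'.2.1,
        if_neg hk'.2.2]
      simp
  · exfalso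
    obtain ⟨t, ht0, ht⟩ := S.exists_smul_unit hr
    obtain ⟨z, hzt⟩ : ∃ z, z = t • (b 2 - C • w) := ⟨_, rfl⟩
    rw [← hzt] at ht
    have h2 : b 2 = C • w + t⁻¹ • z := by
      rw [hzt, inv_smul_smul₀ ht0]
      abel
    have hz0 : S.metric (b 0) z = 0 := by
      rw [hzt]
      simp [hb, S.metric_symm _ w, hw0]
    have hz1 : S.metric (b 1) z = 0 := by
      rw [hzt]
      simp [hb, S.metric_symm _ w, hw1]
    have hzw : S.metric w z = 0 := by
      rw [hzt]
      simp [← hC, hww]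
    obtain ⟨s, hs⟩ : ∃ s, s = t⁻¹ := ⟨_, rfl⟩
    have hs0 : s ≠ 0 := by rw [hs]; exact inv_ne_zero ht0
    rw [← hs] at h2
    have hCs : C ^ 2 + s ^ 2 = 1 := by
      have := hb 2 2
      rw [h2] at this
      simp [hww, hzw, ht, S.metric_symm z w] at this
      linarith
    obtain ⟨f, hf, h5, h6, h3⟩ := exists_isFrame_three_five_six (hb 0 0) (hb 1 1) ht (hb 0 1) hz0
      hz1 (by rw [← metric_cross, ← hw, hzw])
    rw [← four hf h5 h6, ← h3] at h2
    obtain ⟨c, hc⟩ : ∃ c, c = structConst f := ⟨_, rfl⟩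
    obtain ⟨γ, hγ⟩ : ∃ γ : Fin 7 → Fin 7 → ℝ, γ = fun i j => S.metric (b 2) ⁅f i, f j⁆ := ⟨_, rfl⟩
    have hexp : ∀ i j k, c i j k = if k = 3 then s * γ i j else if k = 4 then C * γ i j
        else if k = 5 then c i j 5 else if k = 6 then c i j 6 else 0 := by
      intro i j k
      have e5 : c i j 5 = S.metric (b 0) ⁅f i, f j⁆ := by rw [← h5, hf.metric_left, hc, structConst]
      have e6 : c i j 6 = S.metric (b 1) ⁅f i, f j⁆ := by rw [← h6, hf.metric_left, hc, structConst]
      have e := congrArg (f.coord k) (hsum _ (lie_mem_derivedSpan (f i) (f j)))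
      rw [Fin.sum_univ_three, ← e5, ← e6, ← congrFun (congrFun hγ i) j, h2, ← h5, ← h6] at e
      rw [show c i j k = f.coord k ⁅f i, f j⁆ by rw [hc, structConst], e]
      simp only [map_add, map_smul, Basis.coord_self_apply, smul_eq_mul]
      fin_cases k <;> simp [mul_comm]
    have hswap : ∀ i j k, c i j k = -c j i k := by rw [hc]; exact structConst_swap f
    have hγs : ∀ i j, γ i j = -γ j i := fun i j => by
      rw [hγ]
      simp only
      rw [← lie_skew, map_neg]
    have hf5 : ∀ y : 𝔤, ⁅f 5, y⁆ = 0 := lie_eq_zero_of_mem_derivedSpan hz (h5 ▸ hbD 0)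
    have hf6 : ∀ y : 𝔤, ⁅f 6, y⁆ = 0 := lie_eq_zero_of_mem_derivedSpan hz (h6 ▸ hbD 1)
    have hf34 : ∀ y : 𝔤, C • ⁅f 4, y⁆ + s • ⁅f 3, y⁆ = 0 := fun y => by
      rw [← smul_lie, ← smul_lie, ← add_lie, ← h2]
      exact lie_eq_zero_of_mem_derivedSpan hz (hbD 2) y
    have form : ∀ ξ : Dual ℝ 𝔤, ∃ a, (fun i j => ξ ⁅f i, f j⁆) = slantForm C s a := fun ξ =>
      ⟨_, eq_slantForm hCs hs0 (fun i j => by rw [← lie_skew, map_neg]) (fun j => by simp [hf5])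
        (fun j => by simp [hf6]) fun j => by simpa using congrArg ξ (hf34 (f j))⟩
    obtain ⟨p, hp⟩ := form (f.coord 5)
    obtain ⟨q, hq⟩ := form (f.coord 6)
    obtain ⟨h, hh⟩ := form (S.metric (b 2))
    have hslant : c = slantConst C s p q h := by
      funext i j k
      rw [hexp, slantConst, ← hp, ← hq, ← hh, hγ, hc]
      rfl
    have hd := hf.isCoclosed_iff.mp hA.1
    have hT := hf.torsionRelations
    have hI := hf.isInstanton_iff.mp hA.2
    have h0 := structConst_ne_zero hne f
    rw [← hc] at hd hT hI h0
    rw [hslant] at hd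
    rw [hslant, eq_slantConst_of_coclosed hs0 hd] at hT hI h0
    obtain ⟨a1, a2, a3, a4, a5, a6⟩ := slant_eq_zero hCs hs0 hT hI
    refine h0 ?_
    rw [a1, a2, a3, a4, a5, a6]
    funext i j k
    simp [slantConst, slantForm]

end Cases

end G2Structure

/-! ### Derived algebras of dimension one -/

namespace G2Structure

section Line

variable {V : Type*} [AddCommGroup V] [Module ℝ V] {S : G2Structure V} {f : Basis (Fin 7) ℝ V}

theorem cross_add (x y z : V) : S.cross x (y + z) = S.cross x y + S.cross x z := by
  refine S.ext_metric fun v => ?_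
  rw [map_add, LinearMap.add_apply, metric_cross, metric_cross, metric_cross, apply_add₁]

theorem cross_smul (x : V) (c : ℝ) (y : V) : S.cross x (c • y) = c • S.cross x y := by
  refine S.ext_metric fun v => ?_
  rw [map_smul, LinearMap.smul_apply, metric_cross, metric_cross, apply_smul₁, smul_eq_mul]

theorem IsFrame.cross_six (hf : S.IsFrame f) :
    S.cross (f 6) (f 0) = f 1 ∧ S.cross (f 6) (f 2) = f 3 ∧ S.cross (f 6) (f 3) = -f 2 ∧
    S.cross (f 6) (f 4) = f 5 ∧ S.cross (f 6) (f 5) = -f 4 := by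
  have hφ : S.φ = stdForm f.coord := hf
  have h : ∀ a k, f.coord k (S.cross (f 6) (f a)) = S.φ ![f 6, f a, f k] := fun a k => by
    rw [← hf.metric_right, metric_cross]
  refine ⟨?_, ?_, ?_, ?_, ?_⟩ <;> refine f.ext_elem fun k => ?_ <;> rw [← Basis.coord_apply, h, hφ,
    stdForm_apply] <;> fin_cases k <;> simp

end Line

section Cases

variable {𝔤 : Type*} [LieRing 𝔤] [LieAlgebra ℝ 𝔤] {S : G2Structure 𝔤}

/-- If the derived algebra is the line spanned by the unit vector `b`, the frame is built from
principal axes of the form `α(x, b × y) + α(y, b × x)`, where `[x, y] = α(x, y) b`, on the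
complement of `b`. In this frame, that form being diagonal and `dψ = 0` leave only the components
`α₀₁`, `α₂₃` and `α₄₅`. -/
theorem exists_isInstantonConst_of_one (hz : ∀ x y z : 𝔤, ⁅⁅x, y⁆, z⁆ = 0)
    (hA : S.IsCoclosed ∧ S.IsInstanton (S.connection 1)) (hne : ∃ x y : 𝔤, ⁅x, y⁆ ≠ 0)
    {b : 𝔤} (hbD : b ∈ derivedSpan 𝔤) (hb : S.metric b b = 1)
    (hsum : ∀ v ∈ derivedSpan 𝔤, v = S.metric b v • b) :
    ∃ g : Basis (Fin 7) ℝ 𝔤, S.IsFrame g ∧ IsInstantonConst (structConst g) := by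
  obtain ⟨q, hq⟩ : ∃ q : LinearMap.BilinForm ℝ 𝔤, ∀ x y,
      q x y = S.metric b ⁅x, S.cross b y⁆ + S.metric b ⁅y, S.cross b x⁆ :=
    ⟨LinearMap.mk₂ ℝ (fun x y => S.metric b ⁅x, S.cross b y⁆ + S.metric b ⁅y, S.cross b x⁆)
      (fun x x' y => by
        simp only [cross_add, add_lie, lie_add, map_add]
        ring)
      (fun c x y => by
        simp only [cross_smul, smul_lie, lie_smul, map_smul, smul_eq_mul]
        ring)
      (fun x y y' => by
        simp only [cross_add, add_lie, lie_add, map_add]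
        ring)
      (fun c x y => by
        simp only [cross_smul, smul_lie, lie_smul, map_smul, smul_eq_mul]
        ring), fun _ _ => rfl⟩
  have hqs : ∀ x y, q x y = q y x := fun x y => by rw [hq, hq, add_comm]
  obtain ⟨u, huu, hu⟩ := S.exists_unit_orthogonal_top (n := 1) (by norm_num) ![b]
  obtain ⟨x, hx, hxx, hqx⟩ := S.exists_principal_axis_mem q hqs (LinearMap.ker (S.metric b))
    (Submodule.ne_bot_iff _ |>.mpr ⟨u, hu 0, by rintro rfl; simp at huu⟩)
  obtain ⟨v, hvv, hv⟩ := S.exists_unit_orthogonal_top (n := 3) (by norm_num) ![b, x, S.cross b x]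
  obtain ⟨y, hy, hyy, hqy⟩ := S.exists_principal_axis_mem q hqs
    (LinearMap.ker (S.metric b) ⊓ LinearMap.ker (S.metric x) ⊓ LinearMap.ker (S.metric (S.cross b
      x)))
    (Submodule.ne_bot_iff _ |>.mpr ⟨v, ⟨⟨hv 0, hv 1⟩, hv 2⟩, by rintro rfl; simp at hvv⟩)
  obtain ⟨⟨hby, hxy⟩, hxy'⟩ := hy
  have hbx : S.metric b x = 0 := hx
  have hby : S.metric b y = 0 := hby
  have hxy : S.metric x y = 0 := hxy
  have hxy' : S.metric (S.cross b x) y = 0 := hxy'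
  obtain ⟨f, hf, h0, h2, h6⟩ := exists_isFrame_zero_two_six hxx hyy hb hxy
    (by rw [S.metric_symm, hbx]) (by rw [S.metric_symm, hby])
    (by rw [S.φ_swap_right, S.φ_swap_left b x, neg_neg, ← metric_cross, hxy'])
  obtain ⟨c0, c2, c3, c4, c5⟩ := hf.cross_six
  have hc : ∀ i j, structConst f i j 6 = S.metric b ⁅f i, f j⁆ := fun i j => by
    rw [← h6, hf.metric_left, structConst]
  have q0 : ∀ j, j ≠ 0 → j ≠ 6 → q (f 0) (f j) = 0 := fun j hj0 hj6 => by
    rw [h0]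
    refine hqx _ ?_ ?_
    · change S.metric b (f j) = 0
      rw [← h6, hf.metric_basis, if_neg hj6.symm]
    · rw [← h0, hf.metric_basis, if_neg hj0.symm]
  have q2 : ∀ j, j ≠ 0 → j ≠ 1 → j ≠ 2 → j ≠ 6 → q (f 2) (f j) = 0 := fun j hj0 hj1 hj2 hj6 => by
    rw [h2]
    refine hqy _ ⟨⟨?_, ?_⟩, ?_⟩ ?_
    · change S.metric b (f j) = 0
      rw [← h6, hf.metric_basis, if_neg hj6.symm]
    · change S.metric x (f j) = 0
      rw [← h0, hf.metric_basis, if_neg hj0.symm]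
    · change S.metric (S.cross b x) (f j) = 0
      rw [← h0, ← h6, c0, hf.metric_basis, if_neg hj1.symm]
    · rw [← h2, hf.metric_basis, if_neg hj2.symm]
  have q02 := q0 2 (by decide) (by decide)
  have q03 := q0 3 (by decide) (by decide)
  have q04 := q0 4 (by decide) (by decide)
  have q05 := q0 5 (by decide) (by decide)
  have q24 := q2 4 (by decide) (by decide) (by decide) (by decide)
  have q25 := q2 5 (by decide) (by decide) (by decide) (by decide)
  rw [hq, ← h6] at q02 q03 q04 q05 q24 q25
  rw [c0, c2, h6, ← hc, ← hc] at q02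
  rw [c0, c3, h6, lie_neg, map_neg, ← hc, ← hc] at q03
  rw [c0, c4, h6, ← hc, ← hc] at q04
  rw [c0, c5, h6, lie_neg, map_neg, ← hc, ← hc] at q05
  rw [c2, c4, h6, ← hc, ← hc] at q24
  rw [c2, c5, h6, lie_neg, map_neg, ← hc, ← hc] at q25
  have sw := structConst_swap f
  have he := eq_heisenbergConst sw
    (structConst_eq_zero_of_lie fun y => by rw [h6]; exact lie_eq_zero_of_mem_derivedSpan hz hbD y)
    (fun i j k hk => by
      rw [structConst, hsum _ (lie_mem_derivedSpan _ _), ← h6, map_smul, Basis.coord_self_apply,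
        if_neg hk.symm, smul_zero])
    (hf.isCoclosed_iff.mp hA.1)
    (by linarith only [q02, sw 1 2 6]) (by linarith only [q03, sw 1 3 6])
    (by linarith only [q04, sw 1 4 6]) (by linarith only [q05, sw 1 5 6])
    (by linarith only [q24, sw 3 4 6]) (by linarith only [q25, sw 3 5 6])
  have ht := hf.torsionRelations
  have hI := hf.isInstanton_iff.mp hA.2
  rw [he] at ht hI
  have htr := heisenberg_trace_eq_zero ht hI
  rw [show -structConst f 4 5 6 = -(-structConst f 0 1 6) - (-structConst f 2 3 6) by
    linarith only [htr]] at he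
  refine ⟨f, hf, Or.inl ⟨_, _, ?_, he⟩⟩
  rintro ⟨e1, e2⟩
  rw [e1, e2, neg_zero, sub_zero, heisenbergConst_zero] at he
  exact structConst_ne_zero hne f he

/-- Necessity: if a `G₂`-structure on a `2`-step nilpotent Lie algebra is coclosed and `∇¹` is an
instanton, the structure constants in a suitable `G₂`-frame have a normal form. -/
theorem exists_isInstantonConst (hz : ∀ x y z : 𝔤, ⁅⁅x, y⁆, z⁆ = 0)
    (hA : S.IsCoclosed ∧ S.IsInstanton (S.connection 1)) (hne : ∃ x y : 𝔤, ⁅x, y⁆ ≠ 0) :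
    ∃ g : Basis (Fin 7) ℝ 𝔤, S.IsFrame g ∧ IsInstantonConst (structConst g) := by
  obtain ⟨x, y, hxy⟩ := hne
  obtain ⟨t, -, ht⟩ := S.exists_smul_unit hxy
  have hD := (derivedSpan 𝔤).smul_mem t (lie_mem_derivedSpan x y)
  obtain ⟨b, hb⟩ : ∃ b, b = t • ⁅x, y⁆ := ⟨_, rfl⟩
  rw [← hb] at hD ht
  rcases S.eq_sum_or_exists_unit (derivedSpan 𝔤) ![b] (by simpa using hD) (by simp [ht])
    with h | ⟨b', hD', ht', hbb'⟩
  · exact exists_isInstantonConst_of_one hz hA ⟨x, y, hxy⟩ hD ht (by simpa using h)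
  have h01 : S.metric b b' = 0 := hbb' 0
  have hmem : ∀ i, ![b, b'] i ∈ derivedSpan 𝔤 := by simp [Fin.forall_fin_two, hD, hD']
  have horth : ∀ i j, S.metric (![b, b'] i) (![b, b'] j) = if i = j then 1 else 0 := by
    simp [Fin.forall_fin_two, ht, ht', h01, S.metric_symm b' b]
  rcases S.eq_sum_or_exists_unit (derivedSpan 𝔤) ![b, b'] hmem horth
    with h | ⟨b'', hD'', ht'', hbb''⟩
  · exact exists_isInstantonConst_of_two hz hA ⟨x, y, hxy⟩ hmem horth h
  have h02 : S.metric b b'' = 0 := hbb'' 0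
  have h12 : S.metric b' b'' = 0 := hbb'' 1
  refine exists_isInstantonConst_of_three hz hA ⟨x, y, hxy⟩ (b := ![b, b', b'']) ?_ ?_
  · intro i
    fin_cases i
    exacts [hD, hD', hD'']
  · intro i j
    fin_cases i <;> fin_cases j <;>
      simp [ht, ht', ht'', h01, h02, h12, S.metric_symm b' b, S.metric_symm b'' b,
        S.metric_symm b'' b']

/-- Sufficiency: the torsion is determined by the structure constants,
  so it is the one exhibited for
each of the normal forms. -/
theorem IsFrame.isCoclosed_and_isInstanton {f : Basis (Fin 7) ℝ 𝔤} (hf : S.IsFrame f)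
    (h : IsInstantonConst (structConst f)) :
    S.IsCoclosed ∧ S.IsInstanton (S.connection 1) := by
  have ht := hf.torsionRelations
  rw [hf.isCoclosed_iff, hf.isInstanton_iff]
  rcases h with ⟨a, b, -, h⟩ | ⟨ν, -, h⟩ | ⟨ν, -, h⟩ <;> rw [h] at ht ⊢
  · have h0 : a + b + (-a - b) = 0 := by ring
    rw [ht.unique (heisenberg_torsionRelations h0)]
    exact ⟨heisenberg_coclosedRelations _ _ _, heisenberg_instantonEquations h0⟩
  · rw [ht.unique (quaternionic_torsionRelations ν)]
    exact ⟨quaternionic_coclosedRelations ν, quaternionic_instantonEquations ν⟩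
  · rw [ht.unique (free_torsionRelations ν)]
    exact ⟨free_coclosedRelations ν, free_instantonEquations ν⟩

end Cases

end G2Structure

/-! ### Structure equations and structure constants -/

namespace G2Structure

section Equations

variable {𝔤 : Type*} [LieRing 𝔤] [LieAlgebra ℝ 𝔤]

theorem dCovector_coord_apply (f : Basis (Fin 7) ℝ 𝔤) (i j k : Fin 7) :
    dCovector (f.coord k) ![f i, f j] = -structConst f i j k := by
  rw [dCovector, ceDiff_one_apply, covectorWedge_one_apply, structConst]

theorem covectorWedge_coord_apply (f : Basis (Fin 7) ℝ 𝔤) {p q : Fin 7} (hpq : p ≠ q)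
    (i j : Fin 7) : covectorWedge ![f.coord p, f.coord q] ![f i, f j] = planeForm p q i j := by
  rw [covectorWedge_two_apply]
  simp only [Basis.coord_self_apply, planeForm, Int.cast_ite, Int.cast_one, Int.cast_neg,
    Int.cast_zero]
  grind

theorem dCovector_coord_eq_iff (f : Basis (Fin 7) ℝ 𝔤) (k : Fin 7) (β : AltForm 𝔤 2) :
    dCovector (f.coord k) = β ↔ ∀ i j, structConst f i j k = -β ![f i, f j] := by
  constructor
  · rintro rfl i j
    rw [dCovector_coord_apply, neg_neg]
  · intro h
    refine AlternatingMap.ext_two f fun i j _ => ?_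
    rw [dCovector_coord_apply, h, neg_neg]

theorem instantonStructureEquations_iff (f : Basis (Fin 7) ℝ 𝔤) :
    InstantonStructureEquations f.coord ↔ IsInstantonConst (structConst f) := by
  have hc : ∀ {c : Fin 7 → Fin 7 → Fin 7 → ℝ}, structConst f = c ↔
      (∀ i j, structConst f i j 0 = c i j 0) ∧ (∀ i j, structConst f i j 1 = c i j 1) ∧
      (∀ i j, structConst f i j 2 = c i j 2) ∧ (∀ i j, structConst f i j 3 = c i j 3) ∧
      (∀ i j, structConst f i j 4 = c i j 4) ∧ (∀ i j, structConst f i j 5 = c i j 5) ∧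
      (∀ i j, structConst f i j 6 = c i j 6) := by
    intro c
    constructor
    · rintro rfl
      simp
    · rintro ⟨h0, h1, h2, h3, h4, h5, h6⟩
      funext i j k
      fin_cases k
      exacts [h0 i j, h1 i j, h2 i j, h3 i j, h4 i j, h5 i j, h6 i j]
  have h01 := covectorWedge_coord_apply f (show (0 : Fin 7) ≠ 1 by decide)
  have h23 := covectorWedge_coord_apply f (show (2 : Fin 7) ≠ 3 by decide)
  have h45 := covectorWedge_coord_apply f (show (4 : Fin 7) ≠ 5 by decide)
  have h02 := covectorWedge_coord_apply f (show (0 : Fin 7) ≠ 2 by decide)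
  have h13 := covectorWedge_coord_apply f (show (1 : Fin 7) ≠ 3 by decide)
  have h03 := covectorWedge_coord_apply f (show (0 : Fin 7) ≠ 3 by decide)
  have h12 := covectorWedge_coord_apply f (show (1 : Fin 7) ≠ 2 by decide)
  have e1 : ∀ a b : ℝ, ∀ i j, heisenbergConst a b (-a - b) i j 6 =
      -(a • (covectorWedge ![f.coord 0, f.coord 1] - covectorWedge ![f.coord 4, f.coord 5])
      + b • (covectorWedge ![f.coord 2, f.coord 3] - covectorWedge ![f.coord 4, f.coord 5]))
        ![f i, f j] := by
    intro a b i j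
    simp only [AlternatingMap.add_apply, AlternatingMap.smul_apply, AlternatingMap.sub_apply, h01,
      h23, h45, heisenbergConst, if_true, smul_eq_mul]
    ring
  have e2 : ∀ ν : ℝ, ∀ i j, ν * (quaternionicConst i j 4 : ℝ) =
      -(ν • (covectorWedge ![f.coord 0, f.coord 2] - covectorWedge ![f.coord 1, f.coord 3]))
        ![f i, f j] := by
    intro ν i j
    simp [h02, h13, quaternionicConst]
    ring
  have e3 : ∀ ν : ℝ, ∀ i j, ν * (quaternionicConst i j 5 : ℝ) =
      -(ν • (-covectorWedge ![f.coord 0, f.coord 3] - covectorWedge ![f.coord 1, f.coord 2]))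
        ![f i, f j] := by
    intro ν i j
    simp [h03, h12, quaternionicConst]
    ring
  have e4 : ∀ ν : ℝ, ∀ i j, ν * (quaternionicConst i j 6 : ℝ) =
      -(ν • (covectorWedge ![f.coord 0, f.coord 1] + covectorWedge ![f.coord 2, f.coord 3]))
        ![f i, f j] := by
    intro ν i j
    simp [h01, h23, quaternionicConst]
    ring
  have e5 : ∀ ν : ℝ, ∀ i j, ν * (freeConst i j 4 : ℝ) =
      -((-2 * ν) • covectorWedge ![f.coord 1, f.coord 3]) ![f i, f j] := by
    intro ν i j
    simp [h13, freeConst]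
    ring
  have e6 : ∀ ν : ℝ, ∀ i j, ν * (freeConst i j 5 : ℝ) =
      -((-2 * ν) • covectorWedge ![f.coord 1, f.coord 2]) ![f i, f j] := by
    intro ν i j
    simp [h12, freeConst]
    ring
  have e7 : ∀ ν : ℝ, ∀ i j, ν * (freeConst i j 6 : ℝ) =
      -((2 * ν) • covectorWedge ![f.coord 2, f.coord 3]) ![f i, f j] := by
    intro ν i j
    simp [h23, freeConst]
    ring
  have z1 : ∀ a b : ℝ, ∀ i j k, k ≠ 6 → heisenbergConst a b (-a - b) i j k = 0 :=
    fun a b i j k hk => if_neg hk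
  have z2 : ∀ ν : ℝ, ∀ i j k, k < 4 → ν * (quaternionicConst i j k : ℝ) = 0 :=
    fun ν i j k hk => (isSpinConst_quaternionic ν).range i j k hk
  have z3 : ∀ ν : ℝ, ∀ i j k, k < 4 → ν * (freeConst i j k : ℝ) = 0 :=
    fun ν i j k hk => (isSpinConst_free ν).range i j k hk
  simp only [InstantonStructureEquations, IsInstantonConst, HeisenbergEquations,
    QuaternionicHeisenbergEquations, FreeTwoStepEquations, dCovector_coord_eq_iff, hc]
  refine or_congr ?_ (or_congr ?_ ?_)
  · simp [e1, z1]
  · simp only [e2, e3, e4, z2 _ _ _ 0 (by decide), z2 _ _ _ 1 (by decide), z2 _ _ _ 2 (by decide),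
      z2 _ _ _ 3 (by decide), AlternatingMap.zero_apply, neg_zero]
  · simp only [e5, e6, e7, z3 _ _ _ 0 (by decide), z3 _ _ _ 1 (by decide), z3 _ _ _ 2 (by decide),
      z3 _ _ _ 3 (by decide), AlternatingMap.zero_apply, neg_zero]

end Equations

section OfBasis

variable {V : Type*} [AddCommGroup V] [Module ℝ V]

/-- The `G₂`-structure for which a given basis is a `G₂`-frame. -/
def ofBasis (f : Basis (Fin 7) ℝ V) : G2Structure V where
  φ := stdForm f.coord
  positive := by
    have := Module.Finite.of_basis f
    exact ⟨f.dualBasis, by rw [Basis.coe_dualBasis]⟩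
  metric := ∑ i, (f.coord i).smulRight (f.coord i)
  metric_symm x y := by
    simp [LinearMap.sum_apply, mul_comm]
  metric_pos x hx := by
    have h : ∃ i, f.coord i x ≠ 0 := by
      by_contra! h
      exact hx (f.ext_elem fun i => by simpa using h i)
    obtain ⟨i, hi⟩ := h
    simp only [LinearMap.sum_apply, LinearMap.smulRight_apply, LinearMap.smul_apply, smul_eq_mul]
    exact Finset.sum_pos' (fun j _ => mul_self_nonneg _)
      ⟨i, Finset.mem_univ i, mul_self_pos.mpr hi⟩
  vol := covectorWedge f.coord
  vol_sq v := by
    rw [covectorWedge_apply, pow_two]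
    nth_rewrite 2 [← Matrix.det_transpose]
    rw [← Matrix.det_mul]
    congr 1
  induced x y := by
    have key : ∀ α β : AltForm V 7, α f = β f → α = β := fun α β h => by
      rw [α.eq_smul_basis_det f, β.eq_smul_basis_det f, h]
    refine key _ _ ?_
    have h := wedge_curryLeft_stdForm_apply f x y f rfl
    have hv : covectorWedge f.coord f = 1 := by
      have h1 : (Matrix.of fun s r => f.coord r (f s)) = (1 : Matrix (Fin 7) (Fin 7) ℝ) := by
        ext s r
        rw [Matrix.of_apply, Basis.coord_self_apply, Matrix.one_apply]
      rw [covectorWedge_apply, h1, Matrix.det_one]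
    refine h.trans ?_
    rw [AlternatingMap.smul_apply, hv]
    simp [LinearMap.sum_apply]

end OfBasis

end G2Structure

end

theorem mainTheorem1 (𝔤 : Type*) [LieRing 𝔤] [LieAlgebra ℝ 𝔤]
    (hdim : Module.finrank ℝ 𝔤 = 7) (hnil : LieModule.nilpotencyLength 𝔤 𝔤 = 2) :
    (∀ S : G2Structure 𝔤, (S.IsCoclosed ∧ S.IsInstanton (S.connection 1)) ↔
      ∃ e : Module.Basis (Fin 7) ℝ (Module.Dual ℝ 𝔤),
        S.φ = stdForm e ∧ InstantonStructureEquations e) ∧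
    ((∃ S : G2Structure 𝔤, S.IsCoclosed ∧ S.IsInstanton (S.connection 1)) ↔
      ∃ e : Module.Basis (Fin 7) ℝ (Module.Dual ℝ 𝔤), InstantonStructureEquations e) := by
  obtain ⟨hlcs, hlcs'⟩ := (LieModule.nilpotencyLength_eq_succ_iff ℝ 𝔤 𝔤 1).mp hnil
  have hz : ∀ x y z : 𝔤, ⁅⁅x, y⁆, z⁆ = 0 := by
    intro x y z
    have h1 : ⁅x, y⁆ ∈ LieModule.lowerCentralSeries ℝ 𝔤 𝔤 1 :=
      LieSubmodule.lie_mem_lie (LieSubmodule.mem_top x) (LieSubmodule.mem_top y)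
    have h2 : ⁅z, ⁅x, y⁆⁆ ∈ LieModule.lowerCentralSeries ℝ 𝔤 𝔤 2 :=
      LieSubmodule.lie_mem_lie (LieSubmodule.mem_top z) h1
    rw [hlcs, LieSubmodule.mem_bot] at h2
    rw [← lie_skew, h2, neg_zero]
  have hne : ∃ x y : 𝔤, ⁅x, y⁆ ≠ 0 := by
    by_contra! h
    have : LieModule.IsTrivial 𝔤 𝔤 := ⟨h⟩
    exact hlcs' ((LieModule.trivial_iff_lower_central_eq_bot ℝ 𝔤 𝔤).mp this)
  have main : ∀ S : G2Structure 𝔤, (S.IsCoclosed ∧ S.IsInstanton (S.connection 1)) ↔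
      ∃ e : Module.Basis (Fin 7) ℝ (Module.Dual ℝ 𝔤),
        S.φ = stdForm e ∧ InstantonStructureEquations e := by
    intro S
    constructor
    · intro hA
      obtain ⟨f, hf, hc⟩ := G2Structure.exists_isInstantonConst hz hA hne
      have := S.finiteDimensional
      refine ⟨f.dualBasis, ?_, ?_⟩ <;> rw [Module.Basis.coe_dualBasis]
      · exact hf
      · exact (G2Structure.instantonStructureEquations_iff f).mpr hc
    · rintro ⟨e, hφ, he⟩
      obtain ⟨f, hf⟩ := exists_basis_coord_eq e
      rw [← hf] at hφ he
      exact G2Structure.IsFrame.isCoclosed_and_isInstanton hφ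
        ((G2Structure.instantonStructureEquations_iff f).mp he)
  refine ⟨main, ?_, ?_⟩
  · rintro ⟨S, hA⟩
    obtain ⟨e, -, he⟩ := (main S).mp hA
    exact ⟨e, he⟩
  · rintro ⟨e, he⟩
    obtain ⟨f, hf⟩ := exists_basis_coord_eq e
    exact ⟨G2Structure.ofBasis f, (main _).mpr ⟨e, by rw [← hf]; rfl, he⟩⟩
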